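/- **Setting.** Let $M$ be a smooth finite-dimensional (Hausdorff) manifold without boundary, $\pi:T^*M\to M$ its cotangent bundle, $\alpha$ the tautological $1$-form, $\alpha_\xi(V)=\xi(d\pi\,V)$, and $\omega=-d\alpha$. For a function $f$ on $T^*M$ let $V_f$ be the vector field with $\omega(V_f,\cdot)=df$ and put $\{f,g\}=\omega(V_f,V_g)$. For a diffeomorphism $f$ of $M$ put $\widetilde f(p,v)=(f(p),df_p v)$ on $TM$ and $f_\sharp(p,\xi)=(f(p),\xi\circ (df_p)^{-1})$ on $T^*M$. A smooth function $L$ on $TM$ is strongly convex if for every $p$ the Hessian of $L_p=L|_{T_pM}$ is everywhere positive definite; its Legendre transform is the fibre derivative $\Phi_L:TM\to T^*M$, $\Phi_L(p,v)=(p,d(L_p)_v)$, and its dual function is $L^*(p,\xi)=\sup_{v\in T_pM}(\xi(v)-L(p,v))$. For $H\in C^\infty(T^*M)$ strong convexity, $\Phi_H:T^*M\to TM$ and $H^*$ are defined in the same way, with $T_p^{**}M=T_pM$. A continuous symmetry of a Lagrangian system $(M,L)$ is a smooth one-parameter family of diffeomorphisms $\{\theta_s:M\to M\}_{s\in\mathbb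 R}$ with $\theta_0=\mathrm{id}$ and $L\circ\widetilde\theta_s=L$ for all $s$; it generates the vector field $W=\frac{d}{ds}\big|_{s=0}\theta_s$ on $M$, and its Noether quantity is $F(p,v)=\Phi_L(p,v)(W_p)$. A conserved quantity of $(M,L)$ is a smooth function on the domain of $L$ in $TM$ whose time derivative vanishes along $(\gamma,\gamma')$ for every solution $\gamma$ of the Euler–Lagrange equations. A continuous symmetry of $(T^*M,\omega,H)$ is a smooth vector field $W$ with $\mathcal L_W\omega=0$ and $\mathcal L_WH=0$ (on the domain of $H$); it preserves $\alpha$ if $\mathcal L_W\alpha=0$. The conserved quantity corresponding to an $\alpha$-preserving symmetry $W$ is the smooth function $f=\alpha(W)$; that it corresponds to $W$ means that $W=V_f$ and $\{f,H\}=0$. **Theorem.** (1) Let $L\in C^\infty(TM)$ be strongly convex. Then $\Phi_L(TM)$ is open in $T^*M$, the supremum defining $H:=L^*$ is finite on $\Phi_L(TM)$, $H$ is smooth there, and $\Phi_H\circ\Phi_L=\mathrm{id}_{TM}$. Let $\{\theta_s\}$ be a continuous symmetry of $(M,L)$ with generator $W$ and Noether quantity $F$, and let $W_\sharp=\frac{d}{ds}\big|_{s=0}\theta_{s,\sharp}$.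 Then $W$ is smooth, and $W_\sharp$ is the cotangent lift of $W$: whenever $\{\varphi_s\}_{s\in\mathbb R}$ is a smooth one-parameter group of diffeomorphisms of $M$ with generator $W$ (for instance $\varphi=\theta$ if $\theta$ is a one-parameter group), the flow of $W_\sharp$ is $\{\varphi_{s,\sharp}\}$. Moreover $W_\sharp$ is a continuous symmetry of $(T^*M,\omega,H=L^*)$ (with $H$ on the domain $\Phi_L(TM)$, which is $T^*M$ when $\Phi_L$ is onto), it preserves $\alpha$, and its corresponding conserved quantity is $F\circ\Phi_L^{-1}=F\circ\Phi_H$ on $\Phi_L(TM)$. (2) Conversely, let $H\in C^\infty(T^*M)$ be strongly convex. Then $\Phi_H(T^*M)$ is open in $TM$, the supremum defining $L:=H^*$ is finite on $\Phi_H(T^*M)$, $L$ is smooth there, and $\Phi_L\circ\Phi_H=\mathrm{id}_{T^*M}$. Let $W$ be a continuous symmetry of $(T^*M,\omega,H)$ which preserves $\alpha$ and has a global flow $\{\psi_s\}_{s\in\mathbb R}$ (a smooth action of $\mathbb R$ whose orbits are the integral curves of $W$). Then $G=\alpha(W)$ is the conserved quantity corresponding to $W$, and there is a smooth one-parameter group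 of diffeomorphisms $\{\theta_s:M\to M\}$ with $\psi_s=\theta_{s,\sharp}$ for all $s$. Each $\widetilde\theta_s$ maps $\Phi_H(T^*M)$ into itself, $\{\theta_s\}$ is a continuous symmetry of $(M,L=H^*)$, its Noether quantity is $G\circ\Phi_H^{-1}=G\circ\Phi_L$, and this is a conserved quantity of $(M,L)$ (with $L$ on the domain $\Phi_H(T^*M)$). -/

import Mathlib

open Set Bundle
open scoped Manifold ContDiff

noncomputable section

/-! ### Convex functions on a vector space -/

section VectorSpace

variable {V : Type*} [NormedAddCommGroup V] [NormedSpace ℝ V]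

/-- The Hessian of `f` is positive definite at every point. -/
def StronglyConvex (f : V → ℝ) : Prop :=
  ∀ v u : V, u ≠ 0 → 0 < fderiv ℝ (fderiv ℝ f) v u u

/-- The set of values `ξ v - f v`, `v ∈ V`, whose supremum is the value at `ξ` of the dual
function of `f`. -/
def dualValues (f : V → ℝ) (ξ : V →L[ℝ] ℝ) : Set ℝ := range fun v : V => ξ v - f v

/-- The vector represented by an element of the bidual of a finite-dimensional space. -/
def ofBidual [FiniteDimensional ℝ V] (Λ : (V →L[ℝ] ℝ) →L[ℝ] ℝ) : V :=
  ∑ i, Λ (LinearMap.toContinuousLinearMap ((Module.finBasis ℝ V).coord i)) •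
    Module.finBasis ℝ V i

/-- `ofBidual` inverts the canonical map from `V` to its bidual. -/
theorem apply_ofBidual [FiniteDimensional ℝ V] (Λ : (V →L[ℝ] ℝ) →L[ℝ] ℝ) (η : V →L[ℝ] ℝ) :
    η (ofBidual Λ) = Λ η := by
  have h : η = ∑ i, η (Module.finBasis ℝ V i) •
      LinearMap.toContinuousLinearMap ((Module.finBasis ℝ V).coord i) := by
    apply ContinuousLinearMap.coe_injective
    apply (Module.finBasis ℝ V).ext
    intro j
    simp [Finsupp.single_apply]
  conv_rhs => rw [h]
  simp [ofBidual, mul_comm]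

end VectorSpace

/-! ### Differential forms and Lie derivatives on a manifold -/

section Forms

variable {E' : Type*} [NormedAddCommGroup E'] [NormedSpace ℝ E']
  {H' : Type*} [TopologicalSpace H'] (I' : ModelWithCorners ℝ E' H')
  {N : Type*} [TopologicalSpace N] [ChartedSpace H' N]

/-- Differential `k`-forms on `N` (not assumed smooth). -/
abbrev DiffForm (N : Type*) [TopologicalSpace N] [ChartedSpace H' N] (k : ℕ) :=
  ∀ z : N, TangentSpace I' z [⋀^Fin k]→L[ℝ] ℝ

/-- Vector fields on `N` (not assumed smooth). -/
abbrev VecField (N : Type*) [TopologicalSpace N] [ChartedSpace H' N] :=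
  ∀ z : N, TangentSpace I' z

/-- The vector field `W` is smooth. -/
def SmoothField [IsManifold I' ∞ N] (W : VecField I' N) : Prop :=
  ContMDiff I' I'.tangent ∞ (fun z => (⟨z, W z⟩ : TangentBundle I' N))

/-- The `k`-form `β` read in the preferred chart at `z`, i.e. its pullback under the inverse of
that chart. -/
def formInChart {k : ℕ} (β : DiffForm I' N k) (z : N) (y : E') : E' [⋀^Fin k]→L[ℝ] ℝ :=
  (β ((extChartAt I' z).symm y)).compContinuousLinearMap
    (mfderiv 𝓘(ℝ, E') I' (extChartAt I' z).symm y)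

/-- The exterior derivative of a form on a manifold without boundary: at `z` it is computed in the
preferred chart at `z`, whose differential at `z` is the identification of `TangentSpace I' z`
with the model space `E'`. -/
def extDer {k : ℕ} (β : DiffForm I' N k) : DiffForm I' N (k + 1) := fun z =>
  (extDeriv (formInChart I' β z) (extChartAt I' z z) : E' [⋀^Fin (k + 1)]→L[ℝ] ℝ)

/-- The interior product of a vector field with a form. -/
def interiorProd {k : ℕ} (W : VecField I' N) (β : DiffForm I' N (k + 1)) : DiffForm I' N k :=
  fun z => (ContinuousAlternatingMap.curryLeft (E := E') (β z)) (W z)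

/-- The Lie derivative of a form of positive degree along `W`, by Cartan's formula
`ℒ_W β = ι_W dβ + d ι_W β`. -/
def lieForm {k : ℕ} (W : VecField I' N) (β : DiffForm I' N (k + 1)) : DiffForm I' N (k + 1) :=
  fun z => interiorProd I' W (extDer I' β) z + extDer I' (interiorProd I' W β) z

/-- The Lie derivative of a function along `W`, `ℒ_W f = df(W)`. -/
def lieFun (W : VecField I' N) (f : N → ℝ) (z : N) : ℝ :=
  (mfderiv I' 𝓘(ℝ, ℝ) f z : TangentSpace I' z →L[ℝ] ℝ) (W z)

/-- `ψ` is the (global) flow of `W`: a smooth action of `ℝ` whose orbits are the integral curves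
of `W`. -/
structure IsFlow (W : VecField I' N) (ψ : ℝ → N → N) : Prop where
  smooth : ContMDiff (𝓘(ℝ, ℝ).prod I') I' ∞ (fun q : ℝ × N => ψ q.1 q.2)
  zero : ∀ z, ψ 0 z = z
  add : ∀ s t z, ψ (s + t) z = ψ s (ψ t z)
  integralCurve : ∀ z, IsMIntegralCurve (I := I') (fun s => ψ s z) W

end Forms

/-! ### Tangent and cotangent bundles -/

section Mechanics

variable {E : Type*} [NormedAddCommGroup E] [NormedSpace ℝ E]
  {M : Type*} [TopologicalSpace M] [ChartedSpace E M] [IsManifold 𝓘(ℝ, E) ∞ M]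

variable (E M) in
/-- The cotangent bundle `T*M`; its points are pairs `⟨p, ξ⟩` with `ξ : T_pM → ℝ` linear. -/
abbrev CotangentBundle : Type _ :=
  TotalSpace (E →L[ℝ] ℝ) (fun p : M => TangentSpace 𝓘(ℝ, E) p →L[ℝ] ℝ)

variable (E) in
/-- The model with corners of `T*M`. -/
abbrev cotModel : ModelWithCorners ℝ (E × (E →L[ℝ] ℝ)) (ModelProd E (E →L[ℝ] ℝ)) :=
  𝓘(ℝ, E).prod 𝓘(ℝ, E →L[ℝ] ℝ)

/-- The lift `f~ : TM → TM`, `(p, v) ↦ (f p, df_p v)`. -/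
def tangentLift (f : M ≃ₘ^∞⟮𝓘(ℝ, E), 𝓘(ℝ, E)⟯ M) (z : TangentBundle 𝓘(ℝ, E) M) :
    TangentBundle 𝓘(ℝ, E) M :=
  ⟨f z.1, mfderiv 𝓘(ℝ, E) 𝓘(ℝ, E) f z.1 z.2⟩

/-- The cotangent lift `f_♯ : T*M → T*M`, `(p, ξ) ↦ (f p, ξ ∘ (df_p)⁻¹)`. -/
def cotangentLift (f : M ≃ₘ^∞⟮𝓘(ℝ, E), 𝓘(ℝ, E)⟯ M) (ξ : CotangentBundle E M) :
    CotangentBundle E M :=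
  ⟨f ξ.1, ξ.2.comp
    ((f.mfderivToContinuousLinearEquiv (by simp) ξ.1).symm : _ →L[ℝ] TangentSpace 𝓘(ℝ, E) ξ.1)⟩

/-! #### The canonical symplectic structure -/

/-- The differential at `ξ` of the projection `π : T*M → M`. -/
def dProj (ξ : CotangentBundle E M) :
    TangentSpace (cotModel E) ξ →L[ℝ] TangentSpace 𝓘(ℝ, E) ξ.1 :=
  mfderiv (cotModel E) 𝓘(ℝ, E) (fun η : CotangentBundle E M => η.1) ξ

/-- The tautological `1`-form `α`, `α_ξ(V) = ξ (dπ V)`. -/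
def tautForm : DiffForm (cotModel E) (CotangentBundle E M) 1 := fun ξ =>
  ContinuousAlternatingMap.ofSubsingleton ℝ (TangentSpace (cotModel E) ξ) ℝ (0 : Fin 1)
    (ξ.2.comp (dProj ξ))

/-- The canonical symplectic `2`-form `ω = -dα`. -/
def sympForm : DiffForm (cotModel E) (CotangentBundle E M) 2 := fun ξ =>
  -extDer (cotModel E) tautForm ξ

/-- The function `α(W)`. -/
def alphaOf (W : VecField (cotModel E) (CotangentBundle E M)) (ξ : CotangentBundle E M) : ℝ :=
  tautForm ξ ![W ξ]

/-- The Hamiltonian vector field `V_f`: the vector field with `ω(V_f, ·) = df`. -/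
def hamField (f : CotangentBundle E M → ℝ) : VecField (cotModel E) (CotangentBundle E M) :=
  fun ξ => Classical.epsilon fun V : TangentSpace (cotModel E) ξ =>
    ∀ U : TangentSpace (cotModel E) ξ, sympForm ξ ![V, U] =
      (mfderiv (cotModel E) 𝓘(ℝ, ℝ) f ξ : TangentSpace (cotModel E) ξ →L[ℝ] ℝ) U

/-- The Poisson bracket `{f, g} = ω(V_f, V_g)`. -/
def poisson (f g : CotangentBundle E M → ℝ) (ξ : CotangentBundle E M) : ℝ :=
  sympForm ξ ![hamField f ξ, hamField g ξ]

/-- `W` is a continuous symmetry of the Hamiltonian system whose Hamiltonian `H` is defined on the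
open set `D` of `T*M`: `W` is smooth, `ℒ_W ω = 0` and `ℒ_W H = 0`. -/
structure IsHamiltonianSymmetry (D : Set (CotangentBundle E M)) (H : CotangentBundle E M → ℝ)
    (W : VecField (cotModel E) (CotangentBundle E M)) : Prop where
  smooth : SmoothField (cotModel E) W
  lie_symp : ∀ ξ, lieForm (cotModel E) W sympForm ξ = 0
  lie_ham : ∀ ξ ∈ D, lieFun (cotModel E) W H ξ = 0

/-- `W` preserves the tautological form: `ℒ_W α = 0`. -/
def PreservesTaut (W : VecField (cotModel E) (CotangentBundle E M)) : Prop :=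
  ∀ ξ, lieForm (cotModel E) W tautForm ξ = 0

/-- `f` is the conserved quantity corresponding to the `α`-preserving symmetry `W` of the
Hamiltonian system with Hamiltonian `H` on the open set `D`: it is smooth, Poisson commutes with
`H`, is a Hamiltonian function of `W`, and is normalised by `f = α(W)`. -/
structure IsHamiltonianConservedQuantity (D : Set (CotangentBundle E M))
    (H : CotangentBundle E M → ℝ) (W : VecField (cotModel E) (CotangentBundle E M))
    (f : CotangentBundle E M → ℝ) : Prop where
  smooth : ContMDiffOn (cotModel E) 𝓘(ℝ, ℝ) ∞ f D
  poisson_eq_zero : ∀ ξ ∈ D, poisson f H ξ = 0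
  eq_hamField : ∀ ξ ∈ D, W ξ = hamField f ξ
  eq_alpha : ∀ ξ ∈ D, f ξ = alphaOf W ξ

/-! #### Families of diffeomorphisms -/

/-- `θ` is a smooth one-parameter family of diffeomorphisms starting at the identity. -/
structure IsSmoothFamily (θ : ℝ → M ≃ₘ^∞⟮𝓘(ℝ, E), 𝓘(ℝ, E)⟯ M) : Prop where
  smooth : ContMDiff (𝓘(ℝ, ℝ).prod 𝓘(ℝ, E)) 𝓘(ℝ, E) ∞ (fun q : ℝ × M => θ q.1 q.2)
  zero : ∀ p, θ 0 p = p

/-- The group law `θ_{s+t} = θ_s ∘ θ_t`. -/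
def IsOneParameterGroup (θ : ℝ → M ≃ₘ^∞⟮𝓘(ℝ, E), 𝓘(ℝ, E)⟯ M) : Prop :=
  ∀ s t p, θ (s + t) p = θ s (θ t p)

/-- The vector field `W_p = d/ds|_{s=0} θ_s(p)` generated by `θ` (where `θ_0 = id`). -/
def generator (θ : ℝ → M ≃ₘ^∞⟮𝓘(ℝ, E), 𝓘(ℝ, E)⟯ M) : VecField 𝓘(ℝ, E) M := fun p =>
  (mfderiv 𝓘(ℝ, ℝ) 𝓘(ℝ, E) (fun s => θ s p) 0 (1 : ℝ) : TangentSpace 𝓘(ℝ, E) (θ 0 p))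

/-- The vector field `W_♯` on `T*M` generated by the cotangent lifts,
`(W_♯)_ξ = d/ds|_{s=0} θ_{s,♯}(ξ)` (where `θ_0 = id`). -/
def liftedGenerator (θ : ℝ → M ≃ₘ^∞⟮𝓘(ℝ, E), 𝓘(ℝ, E)⟯ M) :
    VecField (cotModel E) (CotangentBundle E M) := fun ξ =>
  (mfderiv 𝓘(ℝ, ℝ) (cotModel E) (fun s => cotangentLift (θ s) ξ) 0 (1 : ℝ) :
    TangentSpace (cotModel E) (cotangentLift (θ 0) ξ))

/-! #### The Legendre transform and the dual function -/

/-- `L_p`, the restriction of `L` to the tangent space at `p`. -/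
def fibreT (L : TangentBundle 𝓘(ℝ, E) M → ℝ) (p : M) (v : E) : ℝ :=
  L ⟨p, (v : TangentSpace 𝓘(ℝ, E) p)⟩

/-- `H_p`, the restriction of `H` to the cotangent space at `p`. -/
def fibreC (H : CotangentBundle E M → ℝ) (p : M) (ξ : E →L[ℝ] ℝ) : ℝ :=
  H ⟨p, (ξ : TangentSpace 𝓘(ℝ, E) p →L[ℝ] ℝ)⟩

/-- The Legendre transform `Φ_L : TM → T*M`, the derivative of `L` along the fibres. -/
def legendreT (L : TangentBundle 𝓘(ℝ, E) M → ℝ) (z : TangentBundle 𝓘(ℝ, E) M) :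
    CotangentBundle E M :=
  ⟨z.1, (fderiv ℝ (fibreT L z.1) z.2 : E →L[ℝ] ℝ)⟩

/-- The Legendre transform `Φ_H : T*M → TM`, the derivative of `H` along the fibres, a linear form
on `T*_pM` being identified with a vector of `T_pM`. -/
def legendreC [FiniteDimensional ℝ E] (H : CotangentBundle E M → ℝ) (ξ : CotangentBundle E M) :
    TangentBundle 𝓘(ℝ, E) M :=
  ⟨ξ.1, (ofBidual (fderiv ℝ (fibreC H ξ.1) ξ.2) : E)⟩

/-- The values `ξ v - L(p, v)`, `v ∈ T_pM`, at a covector `ξ` at `p`. -/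
def dualValuesT (L : TangentBundle 𝓘(ℝ, E) M → ℝ) (ξ : CotangentBundle E M) : Set ℝ :=
  dualValues (fibreT L ξ.1) ξ.2

/-- The values `η v - H(p, η)`, `η ∈ T*_pM`, at a vector `v` at `p`. -/
def dualValuesC (H : CotangentBundle E M → ℝ) (z : TangentBundle 𝓘(ℝ, E) M) : Set ℝ :=
  dualValues (fibreC H z.1) (ContinuousLinearMap.apply ℝ ℝ (z.2 : E))

/-- The dual function `L* : T*M → ℝ` (meaningful where the supremum is finite). -/
def dualT (L : TangentBundle 𝓘(ℝ, E) M → ℝ) (ξ : CotangentBundle E M) : ℝ :=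
  sSup (dualValuesT L ξ)

/-- The dual function `H* : TM → ℝ` (meaningful where the supremum is finite). -/
def dualC (H : CotangentBundle E M → ℝ) (z : TangentBundle 𝓘(ℝ, E) M) : ℝ :=
  sSup (dualValuesC H z)

/-! #### Lagrangian systems -/

/-- `θ` is a continuous symmetry of `(M, L)`: a smooth one-parameter family of diffeomorphisms
with `L ∘ θ~_s = L` for all `s`. -/
structure IsLagrangianSymmetry (L : TangentBundle 𝓘(ℝ, E) M → ℝ)
    (θ : ℝ → M ≃ₘ^∞⟮𝓘(ℝ, E), 𝓘(ℝ, E)⟯ M) : Prop extends IsSmoothFamily θ where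
  invariant : ∀ s z, L (tangentLift (θ s) z) = L z

/-- The quantity attached to a symmetry,
`(p, v) ↦ Φ_L(p, v) · d/ds|_{s=0} θ_s(p)`, i.e. `(∂L/∂vⁱ) (dθ_sⁱ/ds)`. -/
def noetherQuantity (L : TangentBundle 𝓘(ℝ, E) M → ℝ)
    (θ : ℝ → M ≃ₘ^∞⟮𝓘(ℝ, E), 𝓘(ℝ, E)⟯ M) (z : TangentBundle 𝓘(ℝ, E) M) : ℝ :=
  (legendreT L z).2 (generator θ z.1)

/-- The velocity lift `t ↦ (γ t, γ' t)` of a curve. -/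
def velocity (γ : ℝ → M) (t : ℝ) : TangentBundle 𝓘(ℝ, E) M :=
  ⟨γ t, mfderiv 𝓘(ℝ, ℝ) 𝓘(ℝ, E) γ t (1 : ℝ)⟩

/-- The function `L` in the coordinates `(x, v)` on `TM` induced by the preferred chart at `p`. -/
def lagInChart (L : TangentBundle 𝓘(ℝ, E) M → ℝ) (p : M) (x v : E) : ℝ :=
  L ⟨(extChartAt 𝓘(ℝ, E) p).symm x,
    mfderiv 𝓘(ℝ, E) 𝓘(ℝ, E) (extChartAt 𝓘(ℝ, E) p).symm x v⟩

/-- The curve `γ` in the preferred chart at `p`. -/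
def curveInChart (γ : ℝ → M) (p : M) (t : ℝ) : E := extChartAt 𝓘(ℝ, E) p (γ t)

/-- `γ` is a motion of `(M, L)` on the open set `J` of times: it is smooth on `J` and at every
time `t₀` in `J` it satisfies, in the chart at `γ t₀`, the Euler-Lagrange equation
`d/dt (∂L/∂v (c, c')) = ∂L/∂x (c, c')`. -/
def IsMotionOn (L : TangentBundle 𝓘(ℝ, E) M → ℝ) (γ : ℝ → M) (J : Set ℝ) : Prop :=
  ContMDiffOn 𝓘(ℝ, ℝ) 𝓘(ℝ, E) ∞ γ J ∧
  ∀ t₀ ∈ J,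
    HasDerivAt
      (fun t => fderiv ℝ (fun v : E => lagInChart L (γ t₀) (curveInChart γ (γ t₀) t) v)
        (deriv (curveInChart (E := E) γ (γ t₀)) t))
      (fderiv ℝ (fun x : E => lagInChart L (γ t₀) x (deriv (curveInChart γ (γ t₀)) t₀))
        (curveInChart γ (γ t₀) t₀)) t₀

/-- `G` is a conserved quantity of the Lagrangian system whose Lagrangian `L` is defined on the
open set `D` of `TM`: it is smooth and its derivative along every motion in `D` vanishes. -/
structure IsLagrangianConserved (D : Set (TangentBundle 𝓘(ℝ, E) M))
    (L G : TangentBundle 𝓘(ℝ, E) M → ℝ) : Prop where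
  smooth : ContMDiffOn 𝓘(ℝ, E).tangent 𝓘(ℝ, ℝ) ∞ G D
  conserved : ∀ (J : Set ℝ) (γ : ℝ → M), IsOpen J → IsMotionOn L γ J →
    (∀ t ∈ J, velocity γ t ∈ D) → ∀ t ∈ J, HasDerivAt (fun t => G (velocity γ t)) 0 t

end Mechanics

end

noncomputable section
open Filter Topology
set_option linter.unusedSectionVars false

/-! The Hamiltonian side rests on Cartan's formula. Since `ω = -dα`, one has `ℒ_W α = d(α(W)) - ι_W
ω`, so `W` preserves `α` exactly when `W` is the Hamiltonian field of `α(W)` (`preservesTaut_iff`).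
For the cotangent lift of a family with generator `w`, a chart computation gives `ι_{W_♯} ω =
d(momentum w)`, where `momentum w` is the function `ξ ↦ ξ(w)`. Hence `W_♯` depends on `w` only,
preserves `α` and `ω`, and satisfies `α(W_♯) = momentum w` (`IsSmoothFamily.liftedGenerator_eq`).

The Legendre side is fibrewise convex analysis with parameters. A positive Hessian puts `f` above
its tangents, so the supremum at `f'(v)` is attained at `v`. It also makes `(x, v) ↦ (x, ∂l/∂v)` a
local diffeomorphism, whence openness of the image and smoothness of the dual. The inequality `η(v)
- f(v) ≤ f*(η)`, an equality at `η = f'(v)`, forces the derivative of `f*` there to be evaluation at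
`v` (`IsConvexFamily.fderiv_paramDual`). Suprema are unchanged by linear substitutions in the fibre,
so invariance of `L` passes to `L*` and invariance of `H` to `H*`.

For the converse, put `G = α(W)`. As `W` is the Hamiltonian field of `G`, the derivative of `G`
along a fibre at `η` is evaluation at `dπ W(η)`, while `G(η) = η(dπ W(η))`. This is Euler's relation
for degree one; a function that satisfies it and is differentiable also at the origin is linear. So
`dπ W` is constant on fibres and descends to a field on `M` (`PreservesTaut.fst_eq_baseField`). The
flow of `W` then covers a flow on `M` whose lift has generator `W`, and uniqueness of integral
curves identifies the two flows. Conservation of the Noether quantity is the classical product rule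
computation with the Euler–Lagrange equation (`IsLagrangianSymmetry.isLagrangianConserved`). -/

theorem minSmoothness_two_le_infty : minSmoothness ℝ 2 ≤ ∞ := by
  rw [minSmoothness_of_isRCLikeNormedField]
  exact WithTop.coe_le_coe.mpr (le_top : (2 : ℕ∞) ≤ ⊤)

/-! ### Independence of the exterior derivative from the chart. -/

section FormNaturality

variable {E' : Type*} [NormedAddCommGroup E'] [NormedSpace ℝ E']
  {H' : Type*} [TopologicalSpace H'] {I' : ModelWithCorners ℝ E' H'} [I'.Boundaryless]
  {N : Type*} [TopologicalSpace N] [ChartedSpace H' N] [IsManifold I' ∞ N]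

theorem mdifferentiableAt_extChartAt_symm_of_mem {z : N} {y : E'}
    (hy : y ∈ (extChartAt I' z).target) :
    MDifferentiableAt 𝓘(ℝ, E') I' (extChartAt I' z).symm y :=
  ((contMDiffOn_extChartAt_symm (n := ∞) z).contMDiffAt
    (extChartAt_target_mem_nhds' hy)).mdifferentiableAt (by simp)

theorem contDiffAt_extChartAt_comp_symm {z₀ z : N} {y : E'}
    (hy : y ∈ (extChartAt I' z₀).target)
    (hz : (extChartAt I' z₀).symm y ∈ (extChartAt I' z).source) :
    ContDiffAt ℝ ∞ (extChartAt I' z ∘ (extChartAt I' z₀).symm) y := by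
  rw [← contMDiffAt_iff_contDiffAt]
  refine ContMDiffAt.comp y (I' := I') (contMDiffAt_extChartAt' ?_) ?_
  · rwa [extChartAt_source] at hz
  · exact (contMDiffOn_extChartAt_symm (n := ∞) z₀).contMDiffAt (extChartAt_target_mem_nhds' hy)

/-- Chain rule for `φ_z⁻¹ ∘ (φ_z ∘ φ_{z₀}⁻¹) = φ_{z₀}⁻¹`, valid near `y`. -/
theorem mfderiv_extChartAt_symm_comp_fderiv {z₀ z : N} {y : E'}
    (hy : y ∈ (extChartAt I' z₀).target)
    (hz : (extChartAt I' z₀).symm y ∈ (extChartAt I' z).source) (u : E') :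
    (mfderiv 𝓘(ℝ, E') I' (extChartAt I' z).symm
        ((extChartAt I' z ∘ (extChartAt I' z₀).symm) y) : E' →L[ℝ] E')
      (fderiv ℝ (extChartAt I' z ∘ (extChartAt I' z₀).symm) y u) =
    (mfderiv 𝓘(ℝ, E') I' (extChartAt I' z₀).symm y : E' →L[ℝ] E') u := by
  have h1 := contDiffAt_extChartAt_comp_symm hy hz
  have h2 : MDifferentiableAt 𝓘(ℝ, E') 𝓘(ℝ, E') (extChartAt I' z ∘ (extChartAt I' z₀).symm) y :=
    (h1.differentiableAt (by simp)).mdifferentiableAt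
  have h3 : MDifferentiableAt 𝓘(ℝ, E') I' (extChartAt I' z).symm
      ((extChartAt I' z ∘ (extChartAt I' z₀).symm) y) :=
    mdifferentiableAt_extChartAt_symm_of_mem ((extChartAt I' z).map_source hz)
  have h4 : (extChartAt I' z).symm ∘ (extChartAt I' z ∘ (extChartAt I' z₀).symm)
      =ᶠ[𝓝 y] (extChartAt I' z₀).symm := by
    have hc : ContinuousAt (extChartAt I' z₀).symm y :=
      (mdifferentiableAt_extChartAt_symm_of_mem hy).continuousAt
    filter_upwards [hc.preimage_mem_nhds (extChartAt_source_mem_nhds' hz)] with w hw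
    exact (extChartAt I' z).left_inv hw
  have h5 := mfderiv_comp y h3 h2
  rw [h4.mfderiv_eq, mfderiv_eq_fderiv] at h5
  exact (DFunLike.congr_fun h5 u).symm

omit [I'.Boundaryless] [IsManifold I' ∞ N] in
-- All tangent spaces unfold to `E'`, so values of a form at equal points can be compared without a
-- cast.
theorem diffForm_congr {k : ℕ} (β : DiffForm I' N k) {p q : N} (h : p = q) :
    (β p : E' [⋀^Fin k]→L[ℝ] ℝ) = β q := by subst h; rfl

theorem formInChart_eventuallyEq_pullback {k : ℕ} (β : DiffForm I' N k) {z₀ z : N} {y : E'}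
    (hy : y ∈ (extChartAt I' z₀).target)
    (hz : (extChartAt I' z₀).symm y ∈ (extChartAt I' z).source) :
    formInChart I' β z₀ =ᶠ[𝓝 y] fun w =>
      (formInChart I' β z ((extChartAt I' z ∘ (extChartAt I' z₀).symm) w)).compContinuousLinearMap
        (fderiv ℝ (extChartAt I' z ∘ (extChartAt I' z₀).symm) w) := by
  have hc : ContinuousAt (extChartAt I' z₀).symm y :=
    (mdifferentiableAt_extChartAt_symm_of_mem hy).continuousAt
  filter_upwards [hc.preimage_mem_nhds (extChartAt_source_mem_nhds' hz),
    extChartAt_target_mem_nhds' hy] with w hw hw'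
  ext u
  have h1 := diffForm_congr β ((extChartAt I' z).left_inv hw)
  have h2 := fun i => mfderiv_extChartAt_symm_comp_fderiv hw' hw (u i)
  exact (congr_arg (β ((extChartAt I' z₀).symm w)) (funext fun i => (h2 i).symm)).trans
    (DFunLike.congr_fun h1 _).symm

/-- The exterior derivative may be computed in any chart. -/
theorem formInChart_extDer {k : ℕ} (β : DiffForm I' N k) {z₀ : N} {y : E'}
    (hy : y ∈ (extChartAt I' z₀).target)
    (hβ : DifferentiableAt ℝ (formInChart I' β ((extChartAt I' z₀).symm y))
      (extChartAt I' ((extChartAt I' z₀).symm y) ((extChartAt I' z₀).symm y))) :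
    formInChart I' (extDer I' β) z₀ y = extDeriv (formInChart I' β z₀) y := by
  have hz := mem_extChartAt_source (I := I') ((extChartAt I' z₀).symm y)
  -- The form in the chart at `z₀` is the pullback, under the transition map, of the form in the
  -- chart centred at the point itself, where `extDer` is defined; pullback commutes with
  -- `extDeriv`.
  rw [(formInChart_eventuallyEq_pullback β hy hz).extDeriv_eq,
    extDeriv_pullback
      (f := extChartAt I' ((extChartAt I' z₀).symm y) ∘ (extChartAt I' z₀).symm) hβ
      (contDiffAt_extChartAt_comp_symm hy hz) minSmoothness_two_le_infty]
  ext u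
  have h2 : ∀ i, fderiv ℝ (extChartAt I' ((extChartAt I' z₀).symm y) ∘ (extChartAt I' z₀).symm) y
      (u i) = (mfderiv 𝓘(ℝ, E') I' (extChartAt I' z₀).symm y : E' →L[ℝ] E') (u i) := by
    intro i
    have h5 := mfderiv_comp y (mdifferentiableAt_extChartAt (mem_chart_source H' _))
      (mdifferentiableAt_extChartAt_symm_of_mem hy)
    rw [mfderiv_eq_fderiv, mfderiv_extChartAt_self] at h5
    exact DFunLike.congr_fun h5 (u i)
  exact congr_arg (extDer I' β ((extChartAt I' z₀).symm y)) (funext fun i => (h2 i).symm)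

end FormNaturality

/-! ### Explicit charts of the tangent and cotangent bundles. -/

section Charts

variable {E : Type*} [NormedAddCommGroup E] [NormedSpace ℝ E]
  {M : Type*} [TopologicalSpace M] [ChartedSpace E M] [IsManifold 𝓘(ℝ, E) ∞ M]

variable (E) in
/-- The differential at `x` of the preferred chart at `p`. -/
def chartL (p x : M) : E →L[ℝ] E :=
  (trivializationAt E (TangentSpace 𝓘(ℝ, E)) p).continuousLinearMapAt ℝ x

variable (E) in
/-- The differential of the inverse of the preferred chart at `p`, at the image of `x`. -/
def chartSymmL (p x : M) : E →L[ℝ] E :=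
  (trivializationAt E (TangentSpace 𝓘(ℝ, E)) p).symmL ℝ x

theorem chartL_eq_mfderiv {p x : M} (hx : x ∈ (extChartAt 𝓘(ℝ, E) p).source) :
    chartL E p x = (mfderiv 𝓘(ℝ, E) 𝓘(ℝ, E) (extChartAt 𝓘(ℝ, E) p) x : E →L[ℝ] E) := by
  rw [extChartAt_source] at hx
  exact TangentBundle.continuousLinearMapAt_trivializationAt hx

theorem chartSymmL_eq_mfderiv {p x : M} (hx : x ∈ (extChartAt 𝓘(ℝ, E) p).source) :
    chartSymmL E p x = (mfderiv 𝓘(ℝ, E) 𝓘(ℝ, E) (extChartAt 𝓘(ℝ, E) p).symm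
      (extChartAt 𝓘(ℝ, E) p x) : E →L[ℝ] E) := by
  rw [extChartAt_source] at hx
  rw [← mfderivWithin_univ, ← 𝓘(ℝ, E).range_eq_univ]
  exact TangentBundle.symmL_trivializationAt hx

theorem chartSymmL_extChartAt_symm {p : M} {y : E} (hy : y ∈ (extChartAt 𝓘(ℝ, E) p).target) :
    chartSymmL E p ((extChartAt 𝓘(ℝ, E) p).symm y) =
      (mfderiv 𝓘(ℝ, E) 𝓘(ℝ, E) (extChartAt 𝓘(ℝ, E) p).symm y : E →L[ℝ] E) := by
  rw [chartSymmL_eq_mfderiv ((extChartAt 𝓘(ℝ, E) p).map_target hy),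
    (extChartAt 𝓘(ℝ, E) p).right_inv hy]

theorem chartL_chartSymmL {p x : M} (hx : x ∈ (extChartAt 𝓘(ℝ, E) p).source) (v : E) :
    chartL E p x (chartSymmL E p x v) = v := by
  rw [extChartAt_source] at hx
  exact (trivializationAt E (TangentSpace 𝓘(ℝ, E)) p).continuousLinearMapAt_symmL hx v

theorem chartSymmL_chartL {p x : M} (hx : x ∈ (extChartAt 𝓘(ℝ, E) p).source) (v : E) :
    chartSymmL E p x (chartL E p x v) = v := by
  rw [extChartAt_source] at hx
  exact (trivializationAt E (TangentSpace 𝓘(ℝ, E)) p).symmL_continuousLinearMapAt (R := ℝ) hx v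

theorem chartL_self (p : M) : (chartL E p p : E →L[ℝ] E) = ContinuousLinearMap.id ℝ E := by
  rw [chartL_eq_mfderiv (mem_extChartAt_source p)]
  exact mfderiv_extChartAt_self

theorem chartSymmL_self (p : M) :
    (chartSymmL E p p : E →L[ℝ] E) = ContinuousLinearMap.id ℝ E := by
  ext v
  have := chartL_chartSymmL (mem_extChartAt_source (I := 𝓘(ℝ, E)) p) v
  rwa [chartL_self] at this

/-- The differential at `x` of the preferred chart at `p` as an equivalence. -/
def chartEquiv (p x : M) (hx : x ∈ (extChartAt 𝓘(ℝ, E) p).source) : E ≃L[ℝ] E :=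
  ContinuousLinearEquiv.equivOfInverse (chartL E p x) (chartSymmL E p x) (chartSymmL_chartL hx)
    (chartL_chartSymmL hx)

/-- The covector underlying a point of `T*M`, as a linear form on the model space. -/
def covec (ξ : CotangentBundle E M) : E →L[ℝ] ℝ := ξ.2

/-- No condition on `ξ` is needed: off the source both sides use the same default values of the
trivialization. -/
theorem extChartAt_cotangent_apply (ξ₀ ξ : CotangentBundle E M) :
    extChartAt (cotModel E) ξ₀ ξ =
      (extChartAt 𝓘(ℝ, E) ξ₀.1 ξ.1, (covec ξ).comp (chartSymmL E ξ₀.1 ξ.1)) := by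
  rw [FiberBundle.extChartAt]
  simp [hom_trivializationAt_apply, ContinuousLinearMap.inCoordinates]
  rfl

theorem extChartAt_cotangent_symm_apply (ξ₀ : CotangentBundle E M) (x : E) (η : E →L[ℝ] ℝ)
    (hx : x ∈ (extChartAt 𝓘(ℝ, E) ξ₀.1).target) :
    (extChartAt (cotModel E) ξ₀).symm (x, η) =
      ⟨(extChartAt 𝓘(ℝ, E) ξ₀.1).symm x,
        η.comp (chartL E ξ₀.1 ((extChartAt 𝓘(ℝ, E) ξ₀.1).symm x))⟩ := by
  have hx' := (extChartAt 𝓘(ℝ, E) ξ₀.1).map_target hx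
  rw [FiberBundle.extChartAt]
  simp only [hom_trivializationAt, PartialEquiv.coe_trans_symm, PartialEquiv.prod_symm,
    PartialEquiv.refl_symm, Function.comp_apply, PartialEquiv.prod_coe, PartialEquiv.refl_coe, id]
  rw [extChartAt_source] at hx'
  have h : (trivializationAt ℝ (fun _ : M => ℝ) ξ₀.1).symmL ℝ ((extChartAt 𝓘(ℝ, E) ξ₀.1).symm x) =
    ContinuousLinearMap.id ℝ ℝ := by
    simp
  refine Eq.trans (b := (⟨(extChartAt 𝓘(ℝ, E) ξ₀.1).symm x,
      ((trivializationAt ℝ (fun _ : M => ℝ) ξ₀.1).symmL ℝ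
        ((extChartAt 𝓘(ℝ, E) ξ₀.1).symm x)).comp
          (η.comp (chartL E ξ₀.1 ((extChartAt 𝓘(ℝ, E) ξ₀.1).symm x)))⟩ :
            CotangentBundle E M)) rfl ?_
  rw [h]
  rfl

theorem extChartAt_cotangent_source (ξ₀ : CotangentBundle E M) :
    (extChartAt (cotModel E) ξ₀).source =
      TotalSpace.proj ⁻¹' (extChartAt 𝓘(ℝ, E) ξ₀.1).source := by
  ext ξ
  rw [FiberBundle.extChartAt]
  simp
  exact id

theorem extChartAt_cotangent_target (ξ₀ : CotangentBundle E M) :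
    (extChartAt (cotModel E) ξ₀).target = (extChartAt 𝓘(ℝ, E) ξ₀.1).target ×ˢ univ := by
  rw [FiberBundle.extChartAt_target]
  congr 1
  rw [inter_eq_left]
  intro x hx
  have := (extChartAt 𝓘(ℝ, E) ξ₀.1).map_target hx
  rw [extChartAt_source] at this
  simpa using this

theorem extChartAt_tangent_apply (z₀ z : TangentBundle 𝓘(ℝ, E) M)
    (hx : z.1 ∈ (extChartAt 𝓘(ℝ, E) z₀.1).source) :
    extChartAt 𝓘(ℝ, E).tangent z₀ z = (extChartAt 𝓘(ℝ, E) z₀.1 z.1, chartL E z₀.1 z.1 z.2) := by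
  rw [extChartAt_source] at hx
  rw [FiberBundle.extChartAt]
  refine Prod.ext (by simp) ?_
  have h := (trivializationAt E (TangentSpace 𝓘(ℝ, E)) z₀.1).coe_linearMapAt_of_mem
    (R := ℝ) hx
  exact (congr_fun h z.2).symm

theorem extChartAt_tangent_symm_apply (z₀ : TangentBundle 𝓘(ℝ, E) M) (x v : E)
    (hx : x ∈ (extChartAt 𝓘(ℝ, E) z₀.1).target) :
    (extChartAt 𝓘(ℝ, E).tangent z₀).symm (x, v) =
      ⟨(extChartAt 𝓘(ℝ, E) z₀.1).symm x,
        chartSymmL E z₀.1 ((extChartAt 𝓘(ℝ, E) z₀.1).symm x) v⟩ := by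
  have hx' := (extChartAt 𝓘(ℝ, E) z₀.1).map_target hx
  rw [extChartAt_source] at hx'
  rw [FiberBundle.extChartAt]
  simp only [PartialEquiv.coe_trans_symm, PartialEquiv.prod_symm,
    PartialEquiv.refl_symm, Function.comp_apply, PartialEquiv.prod_coe, PartialEquiv.refl_coe, id]
  have h := (trivializationAt E (TangentSpace 𝓘(ℝ, E)) z₀.1).symmL_apply (R := ℝ) hx' v
  exact ((trivializationAt E (TangentSpace 𝓘(ℝ, E)) z₀.1).mk_symm hx' v).symm.trans
    (congr_arg (TotalSpace.mk' E ((extChartAt 𝓘(ℝ, E) z₀.1).symm x)) h.symm)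

theorem extChartAt_tangent_source (z₀ : TangentBundle 𝓘(ℝ, E) M) :
    (extChartAt 𝓘(ℝ, E).tangent z₀).source =
      TotalSpace.proj ⁻¹' (extChartAt 𝓘(ℝ, E) z₀.1).source := by
  ext ξ
  rw [FiberBundle.extChartAt]
  simp

theorem extChartAt_tangent_target (z₀ : TangentBundle 𝓘(ℝ, E) M) :
    (extChartAt 𝓘(ℝ, E).tangent z₀).target = (extChartAt 𝓘(ℝ, E) z₀.1).target ×ˢ univ := by
  rw [FiberBundle.extChartAt_target]
  congr 1
  rw [inter_eq_left]
  intro x hx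
  have := (extChartAt 𝓘(ℝ, E) z₀.1).map_target hx
  rw [extChartAt_source] at this
  simpa using this

end Charts

/-! ### The tautological and symplectic forms in charts. -/

section ModelForms

variable {V : Type*} [NormedAddCommGroup V] [NormedSpace ℝ V]

theorem extDeriv_const_eq_zero {n : ℕ} (c : V [⋀^Fin n]→L[ℝ] ℝ) (x : V) :
    extDeriv (fun _ => c) x = 0 := by
  rw [extDeriv, fderiv_const_apply]
  exact map_zero (ContinuousAlternatingMap.alternatizeUncurryFinCLM ℝ V ℝ)

theorem differentiable_ofSubsingleton_comp (B : V →L[ℝ] V →L[ℝ] ℝ) :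
    Differentiable ℝ fun y => ContinuousAlternatingMap.ofSubsingleton ℝ V ℝ (0 : Fin 1) (B y) :=
  (ContinuousAlternatingMap.ofSubsingletonLIE (𝕜 := ℝ) (E := V) (F := ℝ)
    (0 : Fin 1)).differentiable.comp B.differentiable

end ModelForms

section CanonicalForms

variable {E : Type*} [NormedAddCommGroup E] [NormedSpace ℝ E]
  {M : Type*} [TopologicalSpace M] [ChartedSpace E M] [IsManifold 𝓘(ℝ, E) ∞ M]

theorem mdifferentiableAt_cotangent_proj (ξ : CotangentBundle E M) :
    MDifferentiableAt (cotModel E) 𝓘(ℝ, E) (fun η : CotangentBundle E M => η.1) ξ :=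
  ((contMDiff_proj (n := ∞) (fun p : M => TangentSpace 𝓘(ℝ, E) p →L[ℝ] ℝ)) ξ).mdifferentiableAt
    (by simp)

/-- In the charts centred at `ξ` and at its base point the projection is the first coordinate, and a
preferred chart has identity differential at its centre. -/
theorem dProj_eq_fst (ξ : CotangentBundle E M) :
    (dProj ξ : E × (E →L[ℝ] ℝ) →L[ℝ] E) = ContinuousLinearMap.fst ℝ E (E →L[ℝ] ℝ) := by
  have h1 := mfderiv_comp ξ (mdifferentiableAt_extChartAt (mem_chart_source E ξ.1))
    (mdifferentiableAt_cotangent_proj ξ)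
  have h2 := mfderiv_comp (I'' := 𝓘(ℝ, E)) (g := (Prod.fst : E × (E →L[ℝ] ℝ) → E)) ξ
    differentiableAt_fst.mdifferentiableAt
    (mdifferentiableAt_extChartAt (I := cotModel E) (mem_chart_source _ ξ))
  have h3 : (extChartAt 𝓘(ℝ, E) ξ.1 ∘ fun η : CotangentBundle E M => η.1) =
      (Prod.fst : E × (E →L[ℝ] ℝ) → E) ∘ extChartAt (cotModel E) ξ := by
    funext η
    simp only [Function.comp_apply, extChartAt_cotangent_apply]
  rw [h3, h2, mfderiv_extChartAt_self, mfderiv_extChartAt_self, mfderiv_eq_fderiv, fderiv_fst] at h1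
  exact h1.symm

theorem dProj_comp_mfderiv_symm (ξ₀ : CotangentBundle E M) {x : E} (η : E →L[ℝ] ℝ)
    (hx : x ∈ (extChartAt 𝓘(ℝ, E) ξ₀.1).target) (U : E × (E →L[ℝ] ℝ)) :
    (dProj ((extChartAt (cotModel E) ξ₀).symm (x, η)) : E × (E →L[ℝ] ℝ) →L[ℝ] E)
      ((mfderiv 𝓘(ℝ, E × (E →L[ℝ] ℝ)) (cotModel E) (extChartAt (cotModel E) ξ₀).symm (x, η) :
        E × (E →L[ℝ] ℝ) →L[ℝ] E × (E →L[ℝ] ℝ)) U) =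
    (mfderiv 𝓘(ℝ, E) 𝓘(ℝ, E) (extChartAt 𝓘(ℝ, E) ξ₀.1).symm x : E →L[ℝ] E) U.1 := by
  have hy : (x, η) ∈ (extChartAt (cotModel E) ξ₀).target := by
    rw [extChartAt_cotangent_target]; exact ⟨hx, mem_univ _⟩
  have h1 := mfderiv_comp (x, η) (mdifferentiableAt_cotangent_proj _)
    (mdifferentiableAt_extChartAt_symm_of_mem hy)
  have h2 := mfderiv_comp (I := 𝓘(ℝ, E × (E →L[ℝ] ℝ))) (f := (Prod.fst : E × (E →L[ℝ] ℝ) → E))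
    (x, η) (mdifferentiableAt_extChartAt_symm_of_mem (I' := 𝓘(ℝ, E)) hx)
    differentiableAt_fst.mdifferentiableAt
  have h3 : ((fun ζ : CotangentBundle E M => ζ.1) ∘ (extChartAt (cotModel E) ξ₀).symm) =ᶠ[𝓝 (x, η)]
      (extChartAt 𝓘(ℝ, E) ξ₀.1).symm ∘ (Prod.fst : E × (E →L[ℝ] ℝ) → E) := by
    filter_upwards [extChartAt_target_mem_nhds' hy] with w hw
    rw [extChartAt_cotangent_target] at hw
    simp only [Function.comp_apply]
    rw [extChartAt_cotangent_symm_apply _ w.1 w.2 hw.1]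
  rw [h3.mfderiv_eq, h2, mfderiv_eq_fderiv (f := Prod.fst), fderiv_fst] at h1
  exact (DFunLike.congr_fun h1 U).symm

variable (E) in
/-- The tautological form `η dx` on `E × E*`. -/
def modelTautForm (y : E × (E →L[ℝ] ℝ)) : (E × (E →L[ℝ] ℝ)) [⋀^Fin 1]→L[ℝ] ℝ :=
  ContinuousAlternatingMap.ofSubsingleton ℝ (E × (E →L[ℝ] ℝ)) ℝ (0 : Fin 1)
    (y.2.comp (ContinuousLinearMap.fst ℝ E (E →L[ℝ] ℝ)))

omit [IsManifold 𝓘(ℝ, E) ∞ M] in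
theorem cotangentBundle_snd_congr {ξ ζ : CotangentBundle E M} (h : ξ = ζ) :
    (ξ.2 : E →L[ℝ] ℝ) = ζ.2 := by subst h; rfl

/-- The charts of `T*M` are canonical coordinates: the differential of the base chart in the
covector cancels the inverse one in the pushed-forward vector, leaving `η dx`. -/
theorem formInChart_tautForm (ξ₀ : CotangentBundle E M) {y : E × (E →L[ℝ] ℝ)}
    (hy : y ∈ (extChartAt (cotModel E) ξ₀).target) :
    formInChart (cotModel E) tautForm ξ₀ y = modelTautForm E y := by
  obtain ⟨x, η⟩ := y
  rw [extChartAt_cotangent_target] at hy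
  have hx : x ∈ (extChartAt 𝓘(ℝ, E) ξ₀.1).target := hy.1
  ext U
  have h1 := dProj_comp_mfderiv_symm ξ₀ η hx (U 0)
  have h2 := cotangentBundle_snd_congr (extChartAt_cotangent_symm_apply ξ₀ x η hx)
  have h3 : formInChart (cotModel E) tautForm ξ₀ (x, η) U =
    (((extChartAt (cotModel E) ξ₀).symm (x, η)).2 : E →L[ℝ] ℝ)
      ((mfderiv 𝓘(ℝ, E) 𝓘(ℝ, E) (extChartAt 𝓘(ℝ, E) ξ₀.1).symm x : E →L[ℝ] E) (U 0).1) := by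
    rw [← h1]; rfl
  have h4 : modelTautForm E (x, η) U = η (U 0).1 := rfl
  rw [h3, h2, h4, ← chartSymmL_extChartAt_symm hx]
  exact congr_arg η (chartL_chartSymmL ((extChartAt 𝓘(ℝ, E) ξ₀.1).map_target hx) (U 0).1)

theorem differentiable_modelTautForm : Differentiable ℝ (modelTautForm E) :=
  differentiable_ofSubsingleton_comp (((ContinuousLinearMap.compL ℝ _ E ℝ).flip
    (ContinuousLinearMap.fst ℝ E (E →L[ℝ] ℝ))).comp (ContinuousLinearMap.snd ℝ E (E →L[ℝ] ℝ)))

theorem extDeriv_modelTautForm (y : E × (E →L[ℝ] ℝ)) (U : Fin 2 → E × (E →L[ℝ] ℝ)) :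
    extDeriv (modelTautForm E) y U = (U 0).2 (U 1).1 - (U 1).2 (U 0).1 := by
  rw [extDeriv_apply (differentiable_modelTautForm y), Fin.sum_univ_two]
  have h : ∀ u v : E × (E →L[ℝ] ℝ),
      fderiv ℝ (fun z => modelTautForm E z (fun _ => v)) y u = u.2 v.1 := by
    intro u v
    have : (fun z => modelTautForm E z (fun _ => v)) =
      ((ContinuousLinearMap.apply ℝ ℝ v.1).comp (ContinuousLinearMap.snd ℝ E (E →L[ℝ] ℝ))) := rfl
    rw [this, ContinuousLinearMap.fderiv]
    rfl
  have h0 : (0 : Fin 2).removeNth U = fun _ => U 1 := by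
    funext i; fin_cases i; rfl
  have h1 : (1 : Fin 2).removeNth U = fun _ => U 0 := by
    funext i; fin_cases i; rfl
  rw [h0, h1, h, h]
  simp [sub_eq_add_neg]

theorem formInChart_tautForm_eventuallyEq (ξ₀ : CotangentBundle E M) {y : E × (E →L[ℝ] ℝ)}
    (hy : y ∈ (extChartAt (cotModel E) ξ₀).target) :
    formInChart (cotModel E) tautForm ξ₀ =ᶠ[𝓝 y] modelTautForm E := by
  filter_upwards [extChartAt_target_mem_nhds' hy] with w hw using formInChart_tautForm ξ₀ hw

theorem extDer_tautForm_apply (ξ : CotangentBundle E M) (U : Fin 2 → E × (E →L[ℝ] ℝ)) :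
    extDer (cotModel E) tautForm ξ U = (U 0).2 (U 1).1 - (U 1).2 (U 0).1 := by
  rw [← extDeriv_modelTautForm (extChartAt (cotModel E) ξ ξ),
    ← (formInChart_tautForm_eventuallyEq ξ (mem_extChartAt_target ξ)).extDeriv_eq]
  rfl

theorem sympForm_apply (ξ : CotangentBundle E M) (V U : E × (E →L[ℝ] ℝ)) :
    sympForm ξ ![V, U] = U.2 V.1 - V.2 U.1 := by
  have := extDer_tautForm_apply ξ ![V, U]
  refine (congr_arg Neg.neg this).trans ?_
  simp

theorem formInChart_sympForm (ξ₀ : CotangentBundle E M) {y : E × (E →L[ℝ] ℝ)}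
    (hy : y ∈ (extChartAt (cotModel E) ξ₀).target) (U : Fin 2 → E × (E →L[ℝ] ℝ)) :
    formInChart (cotModel E) sympForm ξ₀ y U = (U 1).2 (U 0).1 - (U 0).2 (U 1).1 := by
  have h1 := formInChart_extDer (tautForm (E := E) (M := M)) hy
    (((differentiable_modelTautForm _).congr_of_eventuallyEq
      (formInChart_tautForm_eventuallyEq _ (mem_extChartAt_target _))))
  have h2 : formInChart (cotModel E) sympForm ξ₀ y U =
    - formInChart (cotModel E) (extDer (cotModel E) (tautForm (E := E) (M := M))) ξ₀ y U := rfl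
  rw [h2, h1, (formInChart_tautForm_eventuallyEq ξ₀ hy).extDeriv_eq, extDeriv_modelTautForm]
  ring

/-- In canonical coordinates the coefficients of `ω` are constant. -/
theorem extDer_sympForm (ξ : CotangentBundle E M) : extDer (cotModel E) sympForm ξ = 0 := by
  have h : formInChart (cotModel E) (sympForm (E := E) (M := M)) ξ
      =ᶠ[𝓝 (extChartAt (cotModel E) ξ ξ)]
      fun _ => formInChart (cotModel E) sympForm ξ (extChartAt (cotModel E) ξ ξ) := by
    filter_upwards [extChartAt_target_mem_nhds (I := cotModel E) ξ] with w hw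
    ext U
    rw [formInChart_sympForm ξ hw, formInChart_sympForm ξ (mem_extChartAt_target ξ)]
  have h2 := h.extDeriv_eq
  refine h2.trans ?_
  exact extDeriv_const_eq_zero _ _

end CanonicalForms

/-! ### Functions as forms of degree zero, and `d ∘ d = 0`. -/

section FunForm

variable {E' : Type*} [NormedAddCommGroup E'] [NormedSpace ℝ E']
  {H' : Type*} [TopologicalSpace H'] {I' : ModelWithCorners ℝ E' H'} [I'.Boundaryless]
  {N : Type*} [TopologicalSpace N] [ChartedSpace H' N]

theorem mfderiv_eq_fderiv_comp_extChartAt_symm {g : N → ℝ} {z : N}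
    (hg : MDifferentiableAt I' 𝓘(ℝ, ℝ) g z) :
    (mfderiv I' 𝓘(ℝ, ℝ) g z : E' →L[ℝ] ℝ) =
      fderiv ℝ (g ∘ (extChartAt I' z).symm) (extChartAt I' z z) := by
  rw [hg.mfderiv, I'.range_eq_univ, fderivWithin_univ]
  rfl

theorem fderiv_comp_extChartAt_symm [IsManifold I' ∞ N] {g : N → ℝ} {z₀ : N} {y : E'}
    (hy : y ∈ (extChartAt I' z₀).target)
    (hg : MDifferentiableAt I' 𝓘(ℝ, ℝ) g ((extChartAt I' z₀).symm y)) (u : E') :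
    fderiv ℝ (g ∘ (extChartAt I' z₀).symm) y u =
      (mfderiv I' 𝓘(ℝ, ℝ) g ((extChartAt I' z₀).symm y) : E' →L[ℝ] ℝ)
        ((mfderiv 𝓘(ℝ, E') I' (extChartAt I' z₀).symm y : E' →L[ℝ] E') u) := by
  have h := mfderiv_comp y hg (mdifferentiableAt_extChartAt_symm_of_mem hy)
  rw [mfderiv_eq_fderiv] at h
  exact DFunLike.congr_fun h u

theorem contDiffAt_comp_extChartAt_symm [IsManifold I' ∞ N] {g : N → ℝ} {z₀ : N} {y : E'}
    (hy : y ∈ (extChartAt I' z₀).target)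
    (hg : ContMDiffAt I' 𝓘(ℝ, ℝ) ∞ g ((extChartAt I' z₀).symm y)) :
    ContDiffAt ℝ ∞ (g ∘ (extChartAt I' z₀).symm) y := by
  rw [← contMDiffAt_iff_contDiffAt]
  exact hg.comp y ((contMDiffOn_extChartAt_symm (n := ∞) z₀).contMDiffAt
    (extChartAt_target_mem_nhds' hy))

variable (I') in
/-- A function regarded as a differential form of degree zero. -/
def funForm (g : N → ℝ) : DiffForm I' N 0 := fun z =>
  (ContinuousAlternatingMap.constOfIsEmpty ℝ E' (Fin 0) (g z) : E' [⋀^Fin 0]→L[ℝ] ℝ)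

omit [I'.Boundaryless] in
theorem formInChart_funForm (g : N → ℝ) (z : N) :
    formInChart I' (funForm I' g) z = fun y =>
      ContinuousAlternatingMap.constOfIsEmpty ℝ E' (Fin 0) ((g ∘ (extChartAt I' z).symm) y) := by
  funext y
  ext u
  rfl

theorem extDer_funForm {g : N → ℝ} {z : N} (hg : MDifferentiableAt I' 𝓘(ℝ, ℝ) g z) :
    (extDer I' (funForm I' g) z : E' [⋀^Fin 1]→L[ℝ] ℝ) =
      ContinuousAlternatingMap.ofSubsingleton ℝ E' ℝ (0 : Fin 1)
        (mfderiv I' 𝓘(ℝ, ℝ) g z : E' →L[ℝ] ℝ) := by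
  rw [mfderiv_eq_fderiv_comp_extChartAt_symm hg, ← extDeriv_constOfIsEmpty, ← formInChart_funForm]
  rfl

theorem contDiffAt_formInChart_funForm [IsManifold I' ∞ N] {g : N → ℝ}
    (hg : ContMDiff I' 𝓘(ℝ, ℝ) ∞ g) (z : N) :
    ContDiffAt ℝ ∞ (formInChart I' (funForm I' g) z) (extChartAt I' z z) := by
  rw [formInChart_funForm]
  exact (ContinuousAlternatingMap.constOfIsEmptyLIE ℝ E' ℝ (Fin 0)).contDiff.contDiffAt.comp _
    (contDiffAt_comp_extChartAt_symm (mem_extChartAt_target z) (hg _))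

theorem extDer_extDer [IsManifold I' ∞ N] {k : ℕ} {β : DiffForm I' N k}
    (hβ : ∀ z, ContDiffAt ℝ ∞ (formInChart I' β z) (extChartAt I' z z)) (z : N) :
    extDer I' (extDer I' β) z = 0 := by
  -- At nearby points `extDer` is defined through other charts; independence of the chart moves
  -- everything to the chart at `z`, where `d ∘ d = 0` in the model space applies.
  have h : formInChart I' (extDer I' β) z =ᶠ[𝓝 (extChartAt I' z z)]
      extDeriv (formInChart I' β z) := by
    filter_upwards [extChartAt_target_mem_nhds (I := I') z] with y hy
    exact formInChart_extDer β hy ((hβ _).differentiableAt (by simp))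
  exact h.extDeriv_eq.trans (extDeriv_extDeriv_apply (hβ z) minSmoothness_two_le_infty)

end FunForm

/-! ### Linear algebra of the canonical pairing on `V × V*`. -/

section Bidual

variable {V : Type*} [NormedAddCommGroup V] [NormedSpace ℝ V] [FiniteDimensional ℝ V]

theorem contDiff_ofBidual : ContDiff ℝ ∞ (ofBidual : ((V →L[ℝ] ℝ) →L[ℝ] ℝ) → V) := by
  unfold ofBidual
  refine ContDiff.sum fun i _ => ContDiff.smul ?_ contDiff_const
  exact contDiff_id.clm_apply contDiff_const

theorem ofBidual_eq_iff (Λ : (V →L[ℝ] ℝ) →L[ℝ] ℝ) (v : V) :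
    ofBidual Λ = v ↔ Λ = ContinuousLinearMap.apply ℝ ℝ v := by
  constructor
  · rintro rfl
    ext η
    exact (apply_ofBidual Λ η).symm
  · rintro rfl
    refine (SeparatingDual.eq_iff_forall_dual_eq (R := ℝ)).2 fun η => ?_
    exact apply_ofBidual _ _

omit [FiniteDimensional ℝ V] in
/-- The canonical symplectic form on `V × V*` is nondegenerate. -/
theorem canonical_pairing_injective {A B : V × (V →L[ℝ] ℝ)}
    (h : ∀ U : V × (V →L[ℝ] ℝ), U.2 A.1 - A.2 U.1 = U.2 B.1 - B.2 U.1) : A = B := by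
  refine Prod.ext ((SeparatingDual.eq_iff_forall_dual_eq (R := ℝ)).2 fun η => ?_) ?_
  · simpa using h (0, η)
  · ext u
    simpa using h (u, 0)

/-- The vector representing a linear form on `V × V*` through the canonical symplectic form. -/
def sympGradient (l : V × (V →L[ℝ] ℝ) →L[ℝ] ℝ) : V × (V →L[ℝ] ℝ) :=
  (ofBidual (l.comp (ContinuousLinearMap.inr ℝ V (V →L[ℝ] ℝ))),
    -l.comp (ContinuousLinearMap.inl ℝ V (V →L[ℝ] ℝ)))

theorem sympGradient_spec (l : V × (V →L[ℝ] ℝ) →L[ℝ] ℝ) (U : V × (V →L[ℝ] ℝ)) :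
    U.2 (sympGradient l).1 - (sympGradient l).2 U.1 = l U := by
  simp only [sympGradient, apply_ofBidual]
  simp [← map_add]

theorem contDiff_sympGradient :
    ContDiff ℝ ∞ (sympGradient : (V × (V →L[ℝ] ℝ) →L[ℝ] ℝ) → V × (V →L[ℝ] ℝ)) := by
  refine ContDiff.prodMk (contDiff_ofBidual.comp ?_) (ContDiff.neg ?_)
  · exact contDiff_id.clm_comp contDiff_const
  · exact contDiff_id.clm_comp contDiff_const

end Bidual

/-! ### Cartan's formula and Hamiltonian vector fields. -/

section HamiltonianFields

variable {E : Type*} [NormedAddCommGroup E] [NormedSpace ℝ E]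
  {M : Type*} [TopologicalSpace M] [ChartedSpace E M] [IsManifold 𝓘(ℝ, E) ∞ M]

/-- The differential of a function on `T*M`. -/
def cotDiff (f : CotangentBundle E M → ℝ) (ξ : CotangentBundle E M) : E × (E →L[ℝ] ℝ) →L[ℝ] ℝ :=
  mfderiv (cotModel E) 𝓘(ℝ, ℝ) f ξ

theorem alphaOf_eq (W : VecField (cotModel E) (CotangentBundle E M)) (ξ : CotangentBundle E M) :
    alphaOf W ξ = (ξ.2 : E →L[ℝ] ℝ) (W ξ : E × (E →L[ℝ] ℝ)).1 :=
  congr_arg (ξ.2 : E →L[ℝ] ℝ) (DFunLike.congr_fun (dProj_eq_fst ξ) (W ξ))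

theorem interiorProd_tautForm (W : VecField (cotModel E) (CotangentBundle E M)) :
    interiorProd (cotModel E) W tautForm = funForm (cotModel E) (alphaOf W) := by
  funext ξ
  ext U
  exact congr_arg (tautForm ξ) (funext fun i => by fin_cases i; rfl)

/-- Cartan's formula with `dα = -ω` and `ι_W α = α(W)`. -/
theorem lieForm_tautForm_apply {W : VecField (cotModel E) (CotangentBundle E M)}
    {ξ : CotangentBundle E M} (hW : MDifferentiableAt (cotModel E) 𝓘(ℝ, ℝ) (alphaOf W) ξ)
    (U : E × (E →L[ℝ] ℝ)) :
    lieForm (cotModel E) W tautForm ξ ![U] =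
      cotDiff (alphaOf W) ξ U - sympForm ξ ![W ξ, U] := by
  have h1 : interiorProd (cotModel E) W (extDer (cotModel E) tautForm) ξ ![U] =
      - sympForm ξ ![W ξ, U] := by
    refine (neg_neg _).symm.trans (congr_arg Neg.neg ?_)
    rfl
  have h2 : extDer (cotModel E) (interiorProd (cotModel E) W tautForm) ξ ![U] =
      cotDiff (alphaOf W) ξ U := by
    rw [interiorProd_tautForm]
    exact DFunLike.congr_fun (extDer_funForm hW) ![U]
  rw [sub_eq_neg_add, ← h1, ← h2]
  rfl

theorem preservesTaut_iff {W : VecField (cotModel E) (CotangentBundle E M)}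
    (hW : MDifferentiable (cotModel E) 𝓘(ℝ, ℝ) (alphaOf W)) :
    PreservesTaut W ↔ ∀ (ξ : CotangentBundle E M) (U : E × (E →L[ℝ] ℝ)),
      sympForm ξ ![W ξ, U] = cotDiff (alphaOf W) ξ U := by
  constructor
  · intro h ξ U
    have h1 := lieForm_tautForm_apply (hW ξ) U
    rw [h ξ] at h1
    have h2 : (0 : ℝ) = cotDiff (alphaOf W) ξ U - sympForm ξ ![W ξ, U] := h1
    linarith
  · intro h ξ
    ext U
    have h0 : U = ![U 0] := by funext i; fin_cases i; rfl
    rw [h0]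
    refine (lieForm_tautForm_apply (hW ξ) (U 0)).trans ?_
    rw [← h ξ (U 0)]
    exact sub_self _

/-- With `ι_W ω = dg`, Cartan's two terms are `ι_W dω`, zero because `ω` is closed, and `d(dg) = 0`.
-/
theorem lieForm_sympForm_eq_zero {W : VecField (cotModel E) (CotangentBundle E M)}
    {g : CotangentBundle E M → ℝ} (hg : ContMDiff (cotModel E) 𝓘(ℝ, ℝ) ∞ g)
    (h : ∀ (ξ : CotangentBundle E M) (U : E × (E →L[ℝ] ℝ)),
      sympForm ξ ![W ξ, U] = cotDiff g ξ U) (ξ : CotangentBundle E M) :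
    lieForm (cotModel E) W sympForm ξ = 0 := by
  have h1 : interiorProd (cotModel E) W sympForm =
      extDer (cotModel E) (funForm (cotModel E) g) := by
    funext ζ
    rw [extDer_funForm (hg.mdifferentiable (by simp) ζ)]
    ext U
    have h0 : U = ![U 0] := by funext i; fin_cases i; rfl
    rw [h0]
    exact h ζ (U 0)
  have h2 : interiorProd (cotModel E) W (extDer (cotModel E) sympForm) ξ = 0 := by
    ext U
    exact DFunLike.congr_fun (extDer_sympForm ξ) _
  rw [lieForm, h1, h2, extDer_extDer (contDiffAt_formInChart_funForm hg)]
  exact add_zero _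

theorem sympForm_injective {ξ : CotangentBundle E M} {A B : E × (E →L[ℝ] ℝ)}
    (h : ∀ U : E × (E →L[ℝ] ℝ), sympForm ξ ![A, U] = sympForm ξ ![B, U]) : A = B := by
  refine canonical_pairing_injective fun U => ?_
  rw [← sympForm_apply ξ A U, ← sympForm_apply ξ B U]
  exact h U

theorem sympForm_swap (ξ : CotangentBundle E M) (A B : E × (E →L[ℝ] ℝ)) :
    sympForm ξ ![A, B] = -sympForm ξ ![B, A] := by
  have h1 := sympForm_apply ξ A B
  have h2 := sympForm_apply ξ B A
  exact h1.trans ((by ring : B.2 A.1 - A.2 B.1 = -(A.2 B.1 - B.2 A.1)).trans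
    (congr_arg Neg.neg h2.symm))

variable [FiniteDimensional ℝ E]

/-- `sympGradient` supplies a witness for the choice in the definition of `hamField`, so the chosen
vector does satisfy its equation. -/
theorem sympForm_hamField (f : CotangentBundle E M → ℝ) (ξ : CotangentBundle E M)
    (U : E × (E →L[ℝ] ℝ)) : sympForm ξ ![hamField f ξ, U] = cotDiff f ξ U := by
  refine Classical.epsilon_spec (p := fun V : TangentSpace (cotModel E) ξ =>
    ∀ U : TangentSpace (cotModel E) ξ, sympForm ξ ![V, U] =
      (mfderiv (cotModel E) 𝓘(ℝ, ℝ) f ξ : TangentSpace (cotModel E) ξ →L[ℝ] ℝ) U) ?_ U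
  refine ⟨sympGradient (cotDiff f ξ), fun U => ?_⟩
  exact (sympForm_apply ξ _ U).trans (sympGradient_spec (cotDiff f ξ) U)

theorem eq_hamField {f : CotangentBundle E M → ℝ} {ξ : CotangentBundle E M}
    {A : E × (E →L[ℝ] ℝ)} (h : ∀ U : E × (E →L[ℝ] ℝ), sympForm ξ ![A, U] = cotDiff f ξ U) :
    A = hamField f ξ :=
  sympForm_injective fun U => (h U).trans (sympForm_hamField f ξ U).symm

theorem poisson_eq_neg_lieFun (f g : CotangentBundle E M → ℝ) (ξ : CotangentBundle E M) :
    poisson f g ξ = -lieFun (cotModel E) (hamField f) g ξ := by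
  refine (sympForm_swap ξ (hamField f ξ) (hamField g ξ)).trans (congr_arg Neg.neg ?_)
  exact sympForm_hamField g ξ (hamField f ξ)

omit [FiniteDimensional ℝ E] in
-- Smoothness is tested at each point in its own preferred chart; there the trivialization of the
-- tangent bundle is the differential of the chart.
theorem smoothField_iff {E' : Type*} [NormedAddCommGroup E'] [NormedSpace ℝ E']
    {H' : Type*} [TopologicalSpace H'] {I' : ModelWithCorners ℝ E' H'} {N : Type*}
    [TopologicalSpace N] [ChartedSpace H' N] [IsManifold I' ∞ N] {W : VecField I' N} :
    SmoothField I' W ↔ ∀ z₀ : N, ContMDiffAt I' 𝓘(ℝ, E') ∞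
      (fun z => (mfderiv I' 𝓘(ℝ, E') (extChartAt I' z₀) z : E' →L[ℝ] E') (W z)) z₀ := by
  refine forall_congr' fun z₀ => ?_
  refine (contMDiffAt_section (IB := I') z₀).trans ?_
  refine Filter.EventuallyEq.contMDiffAt_iff ?_
  filter_upwards [(chartAt H' z₀).open_source.mem_nhds (mem_chart_source H' z₀)] with z hz
  have h := (trivializationAt E' (TangentSpace I') z₀).coe_linearMapAt_of_mem (R := ℝ) hz
  have h2 := TangentBundle.continuousLinearMapAt_trivializationAt (I := I') hz
  exact (congr_fun h (W z)).symm.trans (DFunLike.congr_fun h2 (W z))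

/-- Since `ω` has its standard shape in the chart, the Hamiltonian field is given by Hamilton's
equations there, not only at the centre. This gives its smoothness. -/
theorem mfderiv_extChartAt_hamField {f : CotangentBundle E M → ℝ}
    (hf : MDifferentiable (cotModel E) 𝓘(ℝ, ℝ) f) {ξ₀ : CotangentBundle E M}
    {y : E × (E →L[ℝ] ℝ)} (hy : y ∈ (extChartAt (cotModel E) ξ₀).target) :
    (mfderiv (cotModel E) 𝓘(ℝ, E × (E →L[ℝ] ℝ)) (extChartAt (cotModel E) ξ₀)
      ((extChartAt (cotModel E) ξ₀).symm y) : E × (E →L[ℝ] ℝ) →L[ℝ] E × (E →L[ℝ] ℝ))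
        (hamField f ((extChartAt (cotModel E) ξ₀).symm y)) =
    sympGradient (fderiv ℝ (f ∘ (extChartAt (cotModel E) ξ₀).symm) y) := by
  set A := (mfderiv (cotModel E) 𝓘(ℝ, E × (E →L[ℝ] ℝ)) (extChartAt (cotModel E) ξ₀)
      ((extChartAt (cotModel E) ξ₀).symm y) : E × (E →L[ℝ] ℝ) →L[ℝ] E × (E →L[ℝ] ℝ))
        (hamField f ((extChartAt (cotModel E) ξ₀).symm y)) with hA
  have h1 : (mfderiv 𝓘(ℝ, E × (E →L[ℝ] ℝ)) (cotModel E) (extChartAt (cotModel E) ξ₀).symm y :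
      E × (E →L[ℝ] ℝ) →L[ℝ] E × (E →L[ℝ] ℝ)) A =
      hamField f ((extChartAt (cotModel E) ξ₀).symm y) := by
    have h := mfderivWithin_extChartAt_symm_comp_mfderiv_extChartAt (I := cotModel E) hy
    rw [(cotModel E).range_eq_univ, mfderivWithin_univ] at h
    exact DFunLike.congr_fun h (hamField f ((extChartAt (cotModel E) ξ₀).symm y))
  refine canonical_pairing_injective fun U => ?_
  rw [sympGradient_spec, fderiv_comp_extChartAt_symm hy (hf _)]
  refine (formInChart_sympForm ξ₀ hy ![A, U]).symm.trans ?_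
  refine Eq.trans ?_ (sympForm_hamField f ((extChartAt (cotModel E) ξ₀).symm y) _)
  refine congr_arg (sympForm ((extChartAt (cotModel E) ξ₀).symm y)) ?_
  funext i
  fin_cases i
  · exact h1
  · rfl

theorem smoothField_hamField {f : CotangentBundle E M → ℝ}
    (hf : ContMDiff (cotModel E) 𝓘(ℝ, ℝ) ∞ f) : SmoothField (cotModel E) (hamField f) := by
  rw [smoothField_iff]
  intro ξ₀
  have h1 : ContDiffAt ℝ ∞ (fderiv ℝ (f ∘ (extChartAt (cotModel E) ξ₀).symm))
      (extChartAt (cotModel E) ξ₀ ξ₀) :=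
    (contDiffAt_comp_extChartAt_symm (mem_extChartAt_target ξ₀) (hf _)).fderiv_right (by simp)
  have h2 := (contDiff_sympGradient (V := E)).contDiffAt.comp _ h1
  refine ContMDiffAt.congr_of_eventuallyEq
    (h2.contMDiffAt.comp ξ₀ (contMDiffAt_extChartAt (I := cotModel E))) ?_
  filter_upwards [extChartAt_source_mem_nhds (I := cotModel E) ξ₀] with ξ hξ
  have h := mfderiv_extChartAt_hamField (hf.mdifferentiable (by simp))
    ((extChartAt (cotModel E) ξ₀).map_source hξ)
  rwa [(extChartAt (cotModel E) ξ₀).left_inv hξ] at h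

end HamiltonianFields

/-! ### Curves, vector fields and momentum functions in charts. -/

section Curves

variable {E' : Type*} [NormedAddCommGroup E'] [NormedSpace ℝ E']
  {H' : Type*} [TopologicalSpace H'] {I' : ModelWithCorners ℝ E' H'}
  {N : Type*} [TopologicalSpace N] [ChartedSpace H' N]

theorem hasDerivAt_extChartAt_comp [IsManifold I' ∞ N] {c : ℝ → N} {t : ℝ} {z₀ : N}
    (hc : MDifferentiableAt 𝓘(ℝ, ℝ) I' c t) (hz₀ : c t ∈ (extChartAt I' z₀).source) :
    HasDerivAt (extChartAt I' z₀ ∘ c)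
      ((mfderiv I' 𝓘(ℝ, E') (extChartAt I' z₀) (c t) : E' →L[ℝ] E')
        (mfderiv 𝓘(ℝ, ℝ) I' c t (1 : ℝ))) t := by
  rw [extChartAt_source] at hz₀
  have h := (mdifferentiableAt_extChartAt (I := I') hz₀).hasMFDerivAt.comp t hc.hasMFDerivAt
  obtain ⟨L, hL⟩ : ∃ L : ℝ →L[ℝ] E', L =
      (mfderiv I' 𝓘(ℝ, E') (extChartAt I' z₀) (c t) : E' →L[ℝ] E').comp
        (mfderiv 𝓘(ℝ, ℝ) I' c t : ℝ →L[ℝ] E') := ⟨_, rfl⟩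
  have h' : HasFDerivAt (extChartAt I' z₀ ∘ c) L t := hL ▸ h.hasFDerivAt
  exact (DFunLike.congr_fun hL 1) ▸ h'.hasDerivAt

end Curves

section FieldsAndMomenta

variable {E : Type*} [NormedAddCommGroup E] [NormedSpace ℝ E]
  {M : Type*} [TopologicalSpace M] [ChartedSpace E M] [IsManifold 𝓘(ℝ, E) ∞ M]

/-- A vector field read in the preferred chart at `p`. -/
def fieldInChart (w : VecField 𝓘(ℝ, E) M) (p : M) (x : E) : E :=
  chartL E p ((extChartAt 𝓘(ℝ, E) p).symm x) (w ((extChartAt 𝓘(ℝ, E) p).symm x))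

theorem SmoothField.contDiffAt_fieldInChart {w : VecField 𝓘(ℝ, E) M}
    (hw : SmoothField 𝓘(ℝ, E) w) (p : M) :
    ContDiffAt ℝ ∞ (fieldInChart w p) (extChartAt 𝓘(ℝ, E) p p) := by
  have h := smoothField_iff.1 hw p
  rw [← contMDiffAt_iff_contDiffAt]
  have h1 : ContMDiffAt 𝓘(ℝ, E) 𝓘(ℝ, E) ∞ (extChartAt 𝓘(ℝ, E) p).symm
      (extChartAt 𝓘(ℝ, E) p p) :=
    (contMDiffOn_extChartAt_symm (n := ∞) p).contMDiffAt (extChartAt_target_mem_nhds p)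
  refine ContMDiffAt.congr_of_eventuallyEq
    (h.comp_of_eq h1 (extChartAt_to_inv (I := 𝓘(ℝ, E)) p)) ?_
  filter_upwards [extChartAt_target_mem_nhds (I := 𝓘(ℝ, E)) p] with x hx
  have := chartL_eq_mfderiv ((extChartAt 𝓘(ℝ, E) p).map_target hx)
  exact DFunLike.congr_fun this (w ((extChartAt 𝓘(ℝ, E) p).symm x))

theorem smoothField_of_contDiffAt_fieldInChart {w : VecField 𝓘(ℝ, E) M}
    (hw : ∀ p, ContDiffAt ℝ ∞ (fieldInChart w p) (extChartAt 𝓘(ℝ, E) p p)) :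
    SmoothField 𝓘(ℝ, E) w := by
  refine smoothField_iff.2 fun p => ?_
  refine ContMDiffAt.congr_of_eventuallyEq
    ((hw p).contMDiffAt.comp p (contMDiffAt_extChartAt (I := 𝓘(ℝ, E)))) ?_
  filter_upwards [extChartAt_source_mem_nhds (I := 𝓘(ℝ, E)) p] with q hq
  simp only [Function.comp_apply, fieldInChart]
  rw [(extChartAt 𝓘(ℝ, E) p).left_inv hq, chartL_eq_mfderiv hq]
  rfl

/-- The function `ξ ↦ ξ(w)` on `T*M` attached to a vector field `w` on `M`. -/
def momentum (w : VecField 𝓘(ℝ, E) M) (ξ : CotangentBundle E M) : ℝ :=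
  covec ξ (w ξ.1)

theorem momentum_eq_inChart (w : VecField 𝓘(ℝ, E) M) {ξ₀ ξ : CotangentBundle E M}
    (hξ : ξ ∈ (extChartAt (cotModel E) ξ₀).source) :
    momentum w ξ = (extChartAt (cotModel E) ξ₀ ξ).2
      (fieldInChart w ξ₀.1 (extChartAt (cotModel E) ξ₀ ξ).1) := by
  rw [extChartAt_cotangent_source] at hξ
  rw [extChartAt_cotangent_apply]
  refine Eq.trans ?_ (congr_arg (fun q => covec ξ (chartSymmL E ξ₀.1 ξ.1 (chartL E ξ₀.1 q (w q))))
    ((extChartAt 𝓘(ℝ, E) ξ₀.1).left_inv hξ).symm)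
  exact congr_arg (covec ξ) (chartSymmL_chartL hξ (w ξ.1)).symm

theorem momentum_comp_symm_eventuallyEq (w : VecField 𝓘(ℝ, E) M) (ξ : CotangentBundle E M) :
    momentum w ∘ (extChartAt (cotModel E) ξ).symm =ᶠ[𝓝 (extChartAt (cotModel E) ξ ξ)]
      fun y => y.2 (fieldInChart w ξ.1 y.1) := by
  filter_upwards [extChartAt_target_mem_nhds (I := cotModel E) ξ] with y hy
  rw [Function.comp_apply, momentum_eq_inChart w ((extChartAt (cotModel E) ξ).map_target hy),
    (extChartAt (cotModel E) ξ).right_inv hy]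

theorem extChartAt_cotangent_self (ξ : CotangentBundle E M) :
    extChartAt (cotModel E) ξ ξ = (extChartAt 𝓘(ℝ, E) ξ.1 ξ.1, covec ξ) := by
  rw [extChartAt_cotangent_apply, chartSymmL_self]
  rfl

theorem SmoothField.contMDiff_momentum {w : VecField 𝓘(ℝ, E) M} (hw : SmoothField 𝓘(ℝ, E) w) :
    ContMDiff (cotModel E) 𝓘(ℝ, ℝ) ∞ (momentum w) := by
  intro ξ
  have h1 : ContDiffAt ℝ ∞ (fun y : E × (E →L[ℝ] ℝ) => y.2 (fieldInChart w ξ.1 y.1))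
      (extChartAt (cotModel E) ξ ξ) := by
    rw [extChartAt_cotangent_self]
    exact contDiffAt_snd.clm_apply ((hw.contDiffAt_fieldInChart ξ.1).comp
      (extChartAt 𝓘(ℝ, E) ξ.1 ξ.1, covec ξ) contDiffAt_fst)
  refine ContMDiffAt.congr_of_eventuallyEq
    (h1.contMDiffAt.comp ξ (contMDiffAt_extChartAt (I := cotModel E))) ?_
  filter_upwards [extChartAt_source_mem_nhds (I := cotModel E) ξ] with ζ hζ
  exact momentum_eq_inChart w hζ

/-- Product rule for the chart expression `(x, η) ↦ η(w(x))`. -/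
theorem SmoothField.cotDiff_momentum {w : VecField 𝓘(ℝ, E) M} (hw : SmoothField 𝓘(ℝ, E) w)
    (ξ : CotangentBundle E M) (U : E × (E →L[ℝ] ℝ)) :
    cotDiff (momentum w) ξ U = U.2 (w ξ.1) +
      covec ξ (fderiv ℝ (fieldInChart w ξ.1) (extChartAt 𝓘(ℝ, E) ξ.1 ξ.1) U.1) := by
  have h0 : cotDiff (momentum w) ξ = fderiv ℝ (momentum w ∘ (extChartAt (cotModel E) ξ).symm)
      (extChartAt (cotModel E) ξ ξ) :=
    mfderiv_eq_fderiv_comp_extChartAt_symm (hw.contMDiff_momentum.mdifferentiable (by simp) ξ)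
  rw [h0, (momentum_comp_symm_eventuallyEq w ξ).fderiv_eq, extChartAt_cotangent_self]
  have h1 : HasFDerivAt (fieldInChart w ξ.1)
      (fderiv ℝ (fieldInChart w ξ.1) (extChartAt 𝓘(ℝ, E) ξ.1 ξ.1)) (extChartAt 𝓘(ℝ, E) ξ.1 ξ.1) :=
    ((hw.contDiffAt_fieldInChart ξ.1).differentiableAt (by simp)).hasFDerivAt
  have h2 := HasFDerivAt.comp (extChartAt 𝓘(ℝ, E) ξ.1 ξ.1, covec ξ) h1
    (hasFDerivAt_fst (𝕜 := ℝ) (E := E) (F := E →L[ℝ] ℝ))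
  have h4 := (hasFDerivAt_snd (𝕜 := ℝ) (E := E) (F := E →L[ℝ] ℝ)).clm_apply h2
  refine (DFunLike.congr_fun (HasFDerivAt.fderiv h4) U).trans ?_
  have h3 : fieldInChart w ξ.1 (extChartAt 𝓘(ℝ, E) ξ.1 ξ.1) = w ξ.1 := by
    simp only [fieldInChart]
    rw [extChartAt_to_inv, chartL_self]
    rfl
  exact (add_comm _ _).trans (congr_arg (· + _) (congr_arg U.2 h3))

/-- Differentiate `φ ∘ π = fst ∘ Φ`, where `Φ` is the chart of `T*M` over the chart `φ` of `M`. -/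
theorem mfderiv_extChartAt_cotangent_fst {ξ₀ ξ : CotangentBundle E M}
    (hξ : ξ.1 ∈ (extChartAt 𝓘(ℝ, E) ξ₀.1).source) (U : E × (E →L[ℝ] ℝ)) :
    ((mfderiv (cotModel E) 𝓘(ℝ, E × (E →L[ℝ] ℝ)) (extChartAt (cotModel E) ξ₀) ξ :
      E × (E →L[ℝ] ℝ) →L[ℝ] E × (E →L[ℝ] ℝ)) U).1 = chartL E ξ₀.1 ξ.1 U.1 := by
  have hξ' : ξ ∈ (chartAt (ModelProd E (E →L[ℝ] ℝ)) ξ₀).source := by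
    rw [← extChartAt_source (cotModel E), extChartAt_cotangent_source]
    exact hξ
  have e1 := mfderiv_comp ξ
    (mdifferentiableAt_extChartAt (I := 𝓘(ℝ, E)) (x := ξ₀.1)
      (by rw [← extChartAt_source 𝓘(ℝ, E)]; exact hξ))
    (mdifferentiableAt_cotangent_proj ξ)
  have e2 := mfderiv_comp (I'' := 𝓘(ℝ, E)) (g := (Prod.fst : E × (E →L[ℝ] ℝ) → E)) ξ
    differentiableAt_fst.mdifferentiableAt (mdifferentiableAt_extChartAt (I := cotModel E) hξ')
  have e3 : (extChartAt 𝓘(ℝ, E) ξ₀.1 ∘ fun η : CotangentBundle E M => η.1) =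
      (Prod.fst : E × (E →L[ℝ] ℝ) → E) ∘ extChartAt (cotModel E) ξ₀ := by
    funext η
    simp only [Function.comp_apply, extChartAt_cotangent_apply]
  rw [e3, e2, mfderiv_eq_fderiv, fderiv_fst] at e1
  have e4 := DFunLike.congr_fun e1 U
  refine Eq.trans e4 ?_
  rw [chartL_eq_mfderiv hξ]
  exact congr_arg (mfderiv 𝓘(ℝ, E) 𝓘(ℝ, E) (extChartAt 𝓘(ℝ, E) ξ₀.1) ξ.1 : E →L[ℝ] E)
    (DFunLike.congr_fun (dProj_eq_fst ξ) U)

/-- In a chart, `α(W)` pairs the covector coordinate with the base component of `W`; both are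
smooth. -/
theorem SmoothField.contMDiff_alphaOf {W : VecField (cotModel E) (CotangentBundle E M)}
    (hW : SmoothField (cotModel E) W) : ContMDiff (cotModel E) 𝓘(ℝ, ℝ) ∞ (alphaOf W) := by
  intro ξ₀
  have h1 := smoothField_iff.1 hW ξ₀
  have h2 : ContMDiffAt (cotModel E) 𝓘(ℝ, E × (E →L[ℝ] ℝ)) ∞ (extChartAt (cotModel E) ξ₀) ξ₀ :=
    contMDiffAt_extChartAt (I := cotModel E)
  have h3 := contDiff_snd.contMDiff.contMDiffAt.comp ξ₀ h2
  have h4 := contDiff_fst.contMDiff.contMDiffAt.comp ξ₀ h1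
  refine (h3.clm_apply h4).congr_of_eventuallyEq ?_
  filter_upwards [extChartAt_source_mem_nhds (I := cotModel E) ξ₀] with ξ hξ
  rw [extChartAt_cotangent_source] at hξ
  have e5 := mfderiv_extChartAt_cotangent_fst hξ (W ξ)
  rw [alphaOf_eq]
  refine Eq.trans ?_ (congr_arg (extChartAt (cotModel E) ξ₀ ξ).2 e5.symm)
  rw [extChartAt_cotangent_apply]
  exact congr_arg (covec ξ) (chartSymmL_chartL hξ _).symm

end FieldsAndMomenta

/-! ### One-parameter families of diffeomorphisms and their lifts. -/

section Families

variable {E : Type*} [NormedAddCommGroup E] [NormedSpace ℝ E]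
  {M : Type*} [TopologicalSpace M] [ChartedSpace E M] [IsManifold 𝓘(ℝ, E) ∞ M]

/-- The differential of a diffeomorphism at a point, as an equivalence of the model space. -/
def diffeoEquiv (f : M ≃ₘ^∞⟮𝓘(ℝ, E), 𝓘(ℝ, E)⟯ M) (p : M) : E ≃L[ℝ] E :=
  f.mfderivToContinuousLinearEquiv (by simp) p

theorem diffeoEquiv_coe (f : M ≃ₘ^∞⟮𝓘(ℝ, E), 𝓘(ℝ, E)⟯ M) (p : M) :
    (diffeoEquiv f p : E →L[ℝ] E) = mfderiv 𝓘(ℝ, E) 𝓘(ℝ, E) f p :=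
  f.mfderivToContinuousLinearEquiv_coe (by simp)

theorem covec_cotangentLift (f : M ≃ₘ^∞⟮𝓘(ℝ, E), 𝓘(ℝ, E)⟯ M) (ξ : CotangentBundle E M) :
    covec (cotangentLift f ξ) = (covec ξ).comp ((diffeoEquiv f ξ.1).symm : E →L[ℝ] E) := rfl

theorem cotangentBundle_ext {ξ ζ : CotangentBundle E M} (h : ξ.1 = ζ.1) (h' : covec ξ = covec ζ) :
    ξ = ζ := by
  obtain ⟨p, a⟩ := ξ
  obtain ⟨q, b⟩ := ζ
  obtain rfl : p = q := h
  exact congr_arg (TotalSpace.mk p) h'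

/-- A family of diffeomorphisms read in the preferred chart at `p`. -/
def famInChart (θ : ℝ → M ≃ₘ^∞⟮𝓘(ℝ, E), 𝓘(ℝ, E)⟯ M) (p : M) (y : ℝ × E) : E :=
  extChartAt 𝓘(ℝ, E) p (θ y.1 ((extChartAt 𝓘(ℝ, E) p).symm y.2))

variable {θ : ℝ → M ≃ₘ^∞⟮𝓘(ℝ, E), 𝓘(ℝ, E)⟯ M} (hθ : IsSmoothFamily θ)
include hθ

theorem IsSmoothFamily.contDiffAt_famInChart {p : M} {s : ℝ} {x : E}
    (hx : x ∈ (extChartAt 𝓘(ℝ, E) p).target)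
    (hq : θ s ((extChartAt 𝓘(ℝ, E) p).symm x) ∈ (extChartAt 𝓘(ℝ, E) p).source) :
    ContDiffAt ℝ ∞ (famInChart θ p) (s, x) := by
  rw [← contMDiffAt_iff_contDiffAt]
  have h1 : ContMDiffAt 𝓘(ℝ, E) 𝓘(ℝ, E) ∞ (extChartAt 𝓘(ℝ, E) p).symm x :=
    (contMDiffOn_extChartAt_symm (n := ∞) p).contMDiffAt (extChartAt_target_mem_nhds' hx)
  have h2 : ContMDiffAt 𝓘(ℝ, ℝ × E) (𝓘(ℝ, ℝ).prod 𝓘(ℝ, E)) ∞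
      (fun y : ℝ × E => (y.1, (extChartAt 𝓘(ℝ, E) p).symm y.2)) (s, x) :=
    contDiffAt_fst.contMDiffAt.prodMk (h1.comp (s, x) contDiffAt_snd.contMDiffAt)
  have h3 := (hθ.smooth (s, (extChartAt 𝓘(ℝ, E) p).symm x)).comp (s, x) h2
  rw [extChartAt_source] at hq
  exact (contMDiffAt_extChartAt' hq).comp (s, x) h3

theorem IsSmoothFamily.contMDiff_apply (p : M) :
    ContMDiff 𝓘(ℝ, ℝ) 𝓘(ℝ, E) ∞ (fun s => θ s p) :=
  hθ.smooth.comp (contMDiff_id.prodMk contMDiff_const)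

theorem IsSmoothFamily.hasDerivAt_extChartAt_apply {p₀ p : M}
    (hp : p ∈ (extChartAt 𝓘(ℝ, E) p₀).source) :
    HasDerivAt (fun s => extChartAt 𝓘(ℝ, E) p₀ (θ s p)) (chartL E p₀ p (generator θ p)) 0 := by
  have h0 : θ 0 p = p := hθ.zero p
  have h := hasDerivAt_extChartAt_comp (z₀ := p₀)
    ((hθ.contMDiff_apply p).mdifferentiable (by simp) (0 : ℝ)) (by rwa [h0])
  rw [chartL_eq_mfderiv hp]
  have e : (mfderiv 𝓘(ℝ, E) 𝓘(ℝ, E) (extChartAt 𝓘(ℝ, E) p₀) (θ 0 p) : E →L[ℝ] E) =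
    mfderiv 𝓘(ℝ, E) 𝓘(ℝ, E) (extChartAt 𝓘(ℝ, E) p₀) p := by rw [h0]
  exact e ▸ h

theorem IsSmoothFamily.fieldInChart_generator {p : M} {x : E}
    (hx : x ∈ (extChartAt 𝓘(ℝ, E) p).target) :
    fieldInChart (generator θ) p x = fderiv ℝ (famInChart θ p) (0, x) (1, 0) := by
  have hq := (extChartAt 𝓘(ℝ, E) p).map_target hx
  have h1 := hθ.hasDerivAt_extChartAt_apply hq
  have h2 : HasFDerivAt (famInChart θ p) (fderiv ℝ (famInChart θ p) (0, x)) (0, x) :=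
    ((hθ.contDiffAt_famInChart hx (by rwa [hθ.zero])).differentiableAt (by simp)).hasFDerivAt
  have h3 : HasDerivAt (fun s : ℝ => (s, x)) ((1 : ℝ), (0 : E)) 0 :=
    (hasDerivAt_id (0 : ℝ)).prodMk (hasDerivAt_const _ _)
  exact h1.unique
    (HasFDerivAt.comp_hasDerivAt (l := famInChart θ p) (f := fun s : ℝ => (s, x)) (0 : ℝ) h2 h3)

theorem IsSmoothFamily.smoothField_generator : SmoothField 𝓘(ℝ, E) (generator θ) := by
  refine smoothField_of_contDiffAt_fieldInChart fun p => ?_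
  have h1 : ContDiffAt ℝ ∞ (fderiv ℝ (famInChart θ p)) (0, extChartAt 𝓘(ℝ, E) p p) :=
    (hθ.contDiffAt_famInChart (mem_extChartAt_target p)
      (by rw [hθ.zero, extChartAt_to_inv]; exact mem_extChartAt_source p)).fderiv_right (by simp)
  have h2 : ContDiffAt ℝ ∞ (fun x => fderiv ℝ (famInChart θ p) (0, x) ((1 : ℝ), (0 : E)))
      (extChartAt 𝓘(ℝ, E) p p) :=
    (h1.comp (extChartAt 𝓘(ℝ, E) p p) (contDiffAt_const.prodMk contDiffAt_id)).clm_apply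
      contDiffAt_const
  refine h2.congr_of_eventuallyEq ?_
  filter_upwards [extChartAt_target_mem_nhds (I := 𝓘(ℝ, E)) p] with x hx
  exact hθ.fieldInChart_generator hx

/-- The partial derivative in the space variable is `dθ_s` conjugated by the chart. -/
theorem IsSmoothFamily.fderiv_famInChart_inr {p : M} {s : ℝ} {x : E}
    (hx : x ∈ (extChartAt 𝓘(ℝ, E) p).target)
    (hq : θ s ((extChartAt 𝓘(ℝ, E) p).symm x) ∈ (extChartAt 𝓘(ℝ, E) p).source) (v : E) :
    fderiv ℝ (famInChart θ p) (s, x) (0, v) =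
      chartL E p (θ s ((extChartAt 𝓘(ℝ, E) p).symm x))
        (diffeoEquiv (θ s) ((extChartAt 𝓘(ℝ, E) p).symm x)
          (chartSymmL E p ((extChartAt 𝓘(ℝ, E) p).symm x) v)) := by
  have h1 : HasFDerivAt (famInChart θ p) (fderiv ℝ (famInChart θ p) (s, x)) (s, x) :=
    ((hθ.contDiffAt_famInChart hx hq).differentiableAt (by simp)).hasFDerivAt
  have h2 := h1.comp x (hasFDerivAt_prodMk_right s x)
  have h3 : MDifferentiableAt 𝓘(ℝ, E) 𝓘(ℝ, E) (θ s) ((extChartAt 𝓘(ℝ, E) p).symm x) :=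
    (θ s).contMDiff_toFun.mdifferentiable (by simp) _
  have h4 := mfderiv_comp x h3 (mdifferentiableAt_extChartAt_symm_of_mem hx)
  have hq' := hq
  rw [extChartAt_source] at hq'
  have h5 := mfderiv_comp x (mdifferentiableAt_extChartAt (I := 𝓘(ℝ, E)) hq')
    (h3.comp x (mdifferentiableAt_extChartAt_symm_of_mem hx))
  rw [h4, mfderiv_eq_fderiv] at h5
  have h6 := (DFunLike.congr_fun h2.fderiv v).symm.trans (DFunLike.congr_fun h5 v)
  rw [chartL_eq_mfderiv hq, chartSymmL_extChartAt_symm hx]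
  refine h6.trans ?_
  have h7 := diffeoEquiv_coe (θ s) ((extChartAt 𝓘(ℝ, E) p).symm x)
  exact congr_arg (mfderiv 𝓘(ℝ, E) 𝓘(ℝ, E) (extChartAt 𝓘(ℝ, E) p)
    (θ s ((extChartAt 𝓘(ℝ, E) p).symm x)) : E →L[ℝ] E) (DFunLike.congr_fun h7 _).symm

end Families

/-- Symmetry of the second derivative: `∂_s ∂_x F = ∂_x ∂_s F`. -/
theorem hasDerivAt_partial_fderiv {V : Type*} [NormedAddCommGroup V] [NormedSpace ℝ V]
    {F : ℝ × V → V} {x₀ : V} (hF : ContDiffAt ℝ ∞ F (0, x₀)) (v : V) :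
    HasDerivAt (fun s : ℝ => fderiv ℝ F (s, x₀) (0, v))
      (fderiv ℝ (fun x => fderiv ℝ F (0, x) (1, 0)) x₀ v) 0 := by
  have h1 : HasFDerivAt (fderiv ℝ F) (fderiv ℝ (fderiv ℝ F) (0, x₀)) (0, x₀) :=
    ((hF.fderiv_right (m := ∞) (by simp)).differentiableAt (by simp)).hasFDerivAt
  have h2 : HasDerivAt (fun s : ℝ => (s, x₀)) ((1 : ℝ), (0 : V)) 0 :=
    (hasDerivAt_id (0 : ℝ)).prodMk (hasDerivAt_const _ _)
  have h3 := (HasFDerivAt.comp_hasDerivAt (l := fderiv ℝ F) (f := fun s : ℝ => (s, x₀)) (0 : ℝ)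
    h1 h2).clm_apply (hasDerivAt_const (0 : ℝ) ((0 : ℝ), v))
  have h4 := HasFDerivAt.clm_apply (HasFDerivAt.comp (g := fderiv ℝ F) x₀ h1
    (hasFDerivAt_prodMk_right (0 : ℝ) x₀)) (hasFDerivAt_const ((1 : ℝ), (0 : V)) x₀)
  have h5 : fderiv ℝ (fun x => fderiv ℝ F (0, x) (1, 0)) x₀ v =
      fderiv ℝ (fderiv ℝ F) (0, x₀) (0, v) (1, 0) := by
    refine (DFunLike.congr_fun (HasFDerivAt.fderiv h4) v).trans ?_
    simp
  rw [h5, hF.isSymmSndFDerivAt minSmoothness_two_le_infty (0, v) (1, 0)]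
  simpa using h3

section Families

variable {E : Type*} [NormedAddCommGroup E] [NormedSpace ℝ E]
  {M : Type*} [TopologicalSpace M] [ChartedSpace E M] [IsManifold 𝓘(ℝ, E) ∞ M]
  {θ : ℝ → M ≃ₘ^∞⟮𝓘(ℝ, E), 𝓘(ℝ, E)⟯ M}

/-- The `s`-derivative of `dθ_s` at `0` is the derivative of the generator, by exchanging partial
derivatives. -/
theorem IsSmoothFamily.hasDerivAt_fderiv_famInChart (hθ : IsSmoothFamily θ) (p : M) (v : E) :
    HasDerivAt (fun s : ℝ => fderiv ℝ (famInChart θ p) (s, extChartAt 𝓘(ℝ, E) p p) (0, v))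
      (fderiv ℝ (fieldInChart (generator θ) p) (extChartAt 𝓘(ℝ, E) p p) v) 0 := by
  have h : fieldInChart (generator θ) p =ᶠ[𝓝 (extChartAt 𝓘(ℝ, E) p p)]
      fun x => fderiv ℝ (famInChart θ p) (0, x) (1, 0) := by
    filter_upwards [extChartAt_target_mem_nhds (I := 𝓘(ℝ, E)) p] with x hx
    exact hθ.fieldInChart_generator hx
  rw [h.fderiv_eq]
  refine hasDerivAt_partial_fderiv (hθ.contDiffAt_famInChart (mem_extChartAt_target p) ?_) v
  rw [hθ.zero, extChartAt_to_inv]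
  exact mem_extChartAt_source p

theorem diffeoEquiv_eq_refl {f : M ≃ₘ^∞⟮𝓘(ℝ, E), 𝓘(ℝ, E)⟯ M} (hf : ∀ p, f p = p) (p : M) :
    diffeoEquiv f p = ContinuousLinearEquiv.refl ℝ E := by
  have h : ⇑f = id := funext hf
  have h2 : (mfderiv 𝓘(ℝ, E) 𝓘(ℝ, E) f p : E →L[ℝ] E) = ContinuousLinearMap.id ℝ E := by
    rw [h]; exact mfderiv_id
  ext v
  exact DFunLike.congr_fun ((diffeoEquiv_coe f p).trans h2) v

theorem diffeoEquiv_comp {f g h : M ≃ₘ^∞⟮𝓘(ℝ, E), 𝓘(ℝ, E)⟯ M} (hfg : ∀ p, h p = f (g p)) (p : M) :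
    diffeoEquiv h p = (diffeoEquiv g p).trans (diffeoEquiv f (g p)) := by
  have e : ⇑h = f ∘ g := funext hfg
  have h2 : (mfderiv 𝓘(ℝ, E) 𝓘(ℝ, E) h p : E →L[ℝ] E) =
      (mfderiv 𝓘(ℝ, E) 𝓘(ℝ, E) f (g p) : E →L[ℝ] E).comp
        (mfderiv 𝓘(ℝ, E) 𝓘(ℝ, E) g p : E →L[ℝ] E) := by
    rw [e]
    exact mfderiv_comp p (f.contMDiff_toFun.mdifferentiable (by simp) _)
      (g.contMDiff_toFun.mdifferentiable (by simp) _)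
  ext v
  have h3 := DFunLike.congr_fun ((diffeoEquiv_coe h p).trans h2) v
  refine h3.trans ?_
  have h4 := DFunLike.congr_fun (diffeoEquiv_coe g p) v
  have h5 := DFunLike.congr_fun (diffeoEquiv_coe f (g p)) (diffeoEquiv g p v)
  refine Eq.trans ?_ h5.symm
  exact congr_arg (mfderiv 𝓘(ℝ, E) 𝓘(ℝ, E) f (g p) : E →L[ℝ] E) h4.symm

theorem cotangentLift_of_eq_id {f : M ≃ₘ^∞⟮𝓘(ℝ, E), 𝓘(ℝ, E)⟯ M} (hf : ∀ p, f p = p)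
    (ξ : CotangentBundle E M) : cotangentLift f ξ = ξ := by
  refine cotangentBundle_ext (hf ξ.1) ?_
  rw [covec_cotangentLift, diffeoEquiv_eq_refl hf]
  rfl

theorem cotangentLift_comp {f g h : M ≃ₘ^∞⟮𝓘(ℝ, E), 𝓘(ℝ, E)⟯ M} (hfg : ∀ p, h p = f (g p))
    (ξ : CotangentBundle E M) : cotangentLift h ξ = cotangentLift f (cotangentLift g ξ) := by
  refine cotangentBundle_ext (hfg ξ.1) ?_
  rw [covec_cotangentLift, covec_cotangentLift, covec_cotangentLift, diffeoEquiv_comp hfg]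
  rfl

theorem inCoordinates_cotangent (p : M) (ξ : CotangentBundle E M) :
    ContinuousLinearMap.inCoordinates E (TangentSpace 𝓘(ℝ, E)) ℝ (fun _ : M => ℝ) p ξ.1 p ξ.1 ξ.2 =
      (covec ξ).comp (chartSymmL E p ξ.1) := by
  simp [ContinuousLinearMap.inCoordinates]
  rfl

variable [FiniteDimensional ℝ E]

theorem IsSmoothFamily.contMDiff_cotangentLift (hθ : IsSmoothFamily θ) :
    ContMDiff (𝓘(ℝ, ℝ).prod (cotModel E)) (cotModel E) ∞
      (fun q : ℝ × CotangentBundle E M => cotangentLift (θ q.1) q.2) := by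
  intro q₀
  have hpr : ContMDiff (𝓘(ℝ, ℝ).prod (cotModel E)) 𝓘(ℝ, E) ∞
      (fun q : ℝ × CotangentBundle E M => q.2.1) :=
    (contMDiff_proj (n := ∞) (fun p : M => TangentSpace 𝓘(ℝ, E) p →L[ℝ] ℝ)).comp contMDiff_snd
  have hbase : ContMDiff (𝓘(ℝ, ℝ).prod (cotModel E)) 𝓘(ℝ, E) ∞
      (fun q : ℝ × CotangentBundle E M => θ q.1 q.2.1) :=
    hθ.smooth.comp (contMDiff_fst.prodMk hpr)
  refine (contMDiffAt_hom_bundle _).2 ⟨hbase q₀, ?_⟩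
  have h1 := ContMDiffAt.mfderiv (m := ∞) (n := ∞) (x₀ := q₀)
    (fun (q : ℝ × CotangentBundle E M) (p : M) => θ q.1 p)
    (fun q : ℝ × CotangentBundle E M => q.2.1)
    ((hθ.smooth.comp ((contMDiff_fst.comp contMDiff_fst).prodMk contMDiff_snd)) (q₀, q₀.2.1))
    (hpr q₀) (by simp)
  have h2 := ((contMDiffAt_hom_bundle (fun q : ℝ × CotangentBundle E M => q.2)).1
    (contMDiff_snd (I := 𝓘(ℝ, ℝ)) (J := cotModel E) (n := ∞) q₀)).2
  -- Near `q₀` the coordinate expression of `dθ_s` is an invertible operator, so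
  -- `ContinuousLinearMap.inverse` is its true inverse.
  have h3 : ∀ q : ℝ × CotangentBundle E M,
      ∀ hp : q.2.1 ∈ (extChartAt 𝓘(ℝ, E) q₀.2.1).source,
      ∀ hq : θ q.1 q.2.1 ∈ (extChartAt 𝓘(ℝ, E) (θ q₀.1 q₀.2.1)).source,
      inTangentCoordinates 𝓘(ℝ, E) 𝓘(ℝ, E) (fun q : ℝ × CotangentBundle E M => q.2.1)
        (fun q : ℝ × CotangentBundle E M => θ q.1 q.2.1)
        (fun q => mfderiv 𝓘(ℝ, E) 𝓘(ℝ, E) (θ q.1) q.2.1) q₀ q =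
      (((chartEquiv q₀.2.1 q.2.1 hp).symm.trans (diffeoEquiv (θ q.1) q.2.1)).trans
        (chartEquiv (θ q₀.1 q₀.2.1) (θ q.1 q.2.1) hq) : E ≃L[ℝ] E) := by
    intro q hp hq
    ext v
    have := DFunLike.congr_fun (diffeoEquiv_coe (θ q.1) q.2.1) (chartSymmL E q₀.2.1 q.2.1 v)
    exact congr_arg (chartL E (θ q₀.1 q₀.2.1) (θ q.1 q.2.1)) this.symm
  -- Inversion of operators is smooth at an invertible one; this makes `ξ ∘ (dθ_s)⁻¹` smooth in `(s,
  -- ξ)`.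
  have h4 := contDiffAt_map_inverse (n := ∞) (𝕜 := ℝ)
    (((chartEquiv q₀.2.1 q₀.2.1 (mem_extChartAt_source _)).symm.trans
      (diffeoEquiv (θ q₀.1) q₀.2.1)).trans
        (chartEquiv (θ q₀.1 q₀.2.1) (θ q₀.1 q₀.2.1) (mem_extChartAt_source _)) : E ≃L[ℝ] E)
  rw [← h3 q₀ (mem_extChartAt_source _) (mem_extChartAt_source _)] at h4
  have h5 := h4.contMDiffAt.comp q₀ h1
  refine (h2.clm_comp h5).congr_of_eventuallyEq ?_
  filter_upwards [(hpr q₀).continuousAt.preimage_mem_nhds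
      (extChartAt_source_mem_nhds (I := 𝓘(ℝ, E)) _),
    (hbase q₀).continuousAt.preimage_mem_nhds
      (extChartAt_source_mem_nhds (I := 𝓘(ℝ, E)) _)] with q hp hq
  have h6 := congr_arg ContinuousLinearMap.inverse (h3 q hp hq)
  rw [ContinuousLinearMap.inverse_equiv] at h6
  simp only [Function.comp_apply]
  rw [h6]
  ext v
  have h7 := DFunLike.congr_fun
    (inCoordinates_cotangent (θ q₀.1 q₀.2.1) (cotangentLift (θ q.1) q.2)) v
  have h8 := DFunLike.congr_fun (inCoordinates_cotangent q₀.2.1 q.2)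
    ((((chartEquiv q₀.2.1 q.2.1 hp).symm.trans (diffeoEquiv (θ q.1) q.2.1)).trans
      (chartEquiv (θ q₀.1 q₀.2.1) (θ q.1 q.2.1) hq)).symm v)
  refine h7.trans (Eq.trans ?_ h8.symm)
  refine congr_arg (covec q.2) ?_
  exact (chartSymmL_chartL hp _).symm

end Families

/-- With the group law this carries the derivative of an orbit at time `0` to any time `s`. -/
theorem hasMFDerivAt_comp_sub_const {E' : Type*} [NormedAddCommGroup E'] [NormedSpace ℝ E']
    {H' : Type*} [TopologicalSpace H'] {I' : ModelWithCorners ℝ E' H'}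
    {N : Type*} [TopologicalSpace N] [ChartedSpace H' N] {c : ℝ → N} {L : ℝ →L[ℝ] E'} (s : ℝ)
    (h : HasMFDerivAt 𝓘(ℝ, ℝ) I' c 0 L) : HasMFDerivAt 𝓘(ℝ, ℝ) I' (fun t => c (t - s)) s L := by
  have h1 : HasMFDerivAt 𝓘(ℝ, ℝ) I' c ((fun t : ℝ => t - s) s) L := by
    have e : (fun t : ℝ => t - s) s = 0 := sub_self s
    rw [e]
    exact h
  have h2 : HasMFDerivAt 𝓘(ℝ, ℝ) 𝓘(ℝ, ℝ) (fun t : ℝ => t - s) s (ContinuousLinearMap.id ℝ ℝ) :=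
    ((hasFDerivAt_id s).sub_const s).hasMFDerivAt
  exact HasMFDerivAt.comp (f := fun t : ℝ => t - s) s h1 h2

/-! ### The generator of the cotangent lifts. -/

section LiftedGenerator

variable {E : Type*} [NormedAddCommGroup E] [NormedSpace ℝ E] [FiniteDimensional ℝ E]
  {M : Type*} [TopologicalSpace M] [ChartedSpace E M] [IsManifold 𝓘(ℝ, E) ∞ M]
  {θ : ℝ → M ≃ₘ^∞⟮𝓘(ℝ, E), 𝓘(ℝ, E)⟯ M}

theorem IsSmoothFamily.mdifferentiableAt_cotangentLift (hθ : IsSmoothFamily θ)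
    (ξ : CotangentBundle E M) (s : ℝ) :
    MDifferentiableAt 𝓘(ℝ, ℝ) (cotModel E) (fun s => cotangentLift (θ s) ξ) s :=
  (hθ.contMDiff_cotangentLift.comp
    ((contMDiff_id (I := 𝓘(ℝ, ℝ))).prodMk contMDiff_const)).mdifferentiable (by simp) s

theorem IsSmoothFamily.hasDerivAt_cotangentLift (hθ : IsSmoothFamily θ)
    (ξ : CotangentBundle E M) :
    HasDerivAt (fun s => extChartAt (cotModel E) ξ (cotangentLift (θ s) ξ))
      (liftedGenerator θ ξ : E × (E →L[ℝ] ℝ)) 0 := by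
  have h0 : cotangentLift (θ 0) ξ = ξ := cotangentLift_of_eq_id hθ.zero ξ
  have h := hasDerivAt_extChartAt_comp (z₀ := cotangentLift (θ 0) ξ)
    (hθ.mdifferentiableAt_cotangentLift ξ 0) (mem_extChartAt_source _)
  rw [mfderiv_extChartAt_self] at h
  have e : extChartAt (cotModel E) (cotangentLift (θ 0) ξ) = extChartAt (cotModel E) ξ := by
    rw [h0]
  exact e ▸ h

theorem IsSmoothFamily.liftedGenerator_fst (hθ : IsSmoothFamily θ) (ξ : CotangentBundle E M) :
    (liftedGenerator θ ξ : E × (E →L[ℝ] ℝ)).1 = generator θ ξ.1 := by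
  have h1 := (ContinuousLinearMap.fst ℝ E (E →L[ℝ] ℝ)).hasFDerivAt.comp_hasDerivAt (0 : ℝ)
    (hθ.hasDerivAt_cotangentLift ξ)
  have h2 := hθ.hasDerivAt_extChartAt_apply (mem_extChartAt_source (I := 𝓘(ℝ, E)) ξ.1)
  have h3 : (fun s => extChartAt 𝓘(ℝ, E) ξ.1 (θ s ξ.1)) = ContinuousLinearMap.fst ℝ E (E →L[ℝ] ℝ) ∘
      fun s => extChartAt (cotModel E) ξ (cotangentLift (θ s) ξ) := by
    funext s
    simp only [Function.comp_apply, extChartAt_cotangent_apply]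
    rfl
  rw [h3, chartL_self] at h2
  exact h1.unique h2

/-- Differentiate at `s = 0` the identity `(θ_{s,♯} ξ)(dθ_s v) = ξ(v)`, read in the chart at the
base point; its right side is constant in `s`. -/
theorem IsSmoothFamily.liftedGenerator_snd (hθ : IsSmoothFamily θ) (ξ : CotangentBundle E M)
    (v : E) : (liftedGenerator θ ξ : E × (E →L[ℝ] ℝ)).2 v =
      -covec ξ (fderiv ℝ (fieldInChart (generator θ) ξ.1) (extChartAt 𝓘(ℝ, E) ξ.1 ξ.1) v) := by
  have h1 := (ContinuousLinearMap.snd ℝ E (E →L[ℝ] ℝ)).hasFDerivAt.comp_hasDerivAt (0 : ℝ)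
    (hθ.hasDerivAt_cotangentLift ξ)
  have h2 := h1.clm_apply (hθ.hasDerivAt_fderiv_famInChart ξ.1 v)
  have hx := mem_extChartAt_target (I := 𝓘(ℝ, E)) ξ.1
  have hs : ∀ᶠ s : ℝ in 𝓝 0, θ s ξ.1 ∈ (extChartAt 𝓘(ℝ, E) ξ.1).source := by
    refine (hθ.contMDiff_apply ξ.1).continuous.continuousAt.preimage_mem_nhds ?_
    rw [hθ.zero]
    exact extChartAt_source_mem_nhds (I := 𝓘(ℝ, E)) ξ.1
  have h3 : (fun s : ℝ => ((ContinuousLinearMap.snd ℝ E (E →L[ℝ] ℝ)) ∘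
      fun s => extChartAt (cotModel E) ξ (cotangentLift (θ s) ξ)) s
        (fderiv ℝ (famInChart θ ξ.1) (s, extChartAt 𝓘(ℝ, E) ξ.1 ξ.1) (0, v))) =ᶠ[𝓝 0]
      fun _ => covec ξ v := by
    filter_upwards [hs] with s hs
    rw [hθ.fderiv_famInChart_inr hx (by rwa [extChartAt_to_inv]), extChartAt_to_inv,
      chartSymmL_self]
    simp only [Function.comp_apply, extChartAt_cotangent_apply]
    have e1 : covec (cotangentLift (θ s) ξ) (chartSymmL E ξ.1 (θ s ξ.1) (chartL E ξ.1 (θ s ξ.1)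
        (diffeoEquiv (θ s) ξ.1 v))) = covec ξ v := by
      rw [chartSymmL_chartL hs, covec_cotangentLift]
      simp
    exact e1
  have h4 := h2.unique ((hasDerivAt_const (0 : ℝ) (covec ξ v)).congr_of_eventuallyEq h3)
  have h0 : cotangentLift (θ 0) ξ = ξ := cotangentLift_of_eq_id hθ.zero ξ
  have h5 : fderiv ℝ (famInChart θ ξ.1) (0, extChartAt 𝓘(ℝ, E) ξ.1 ξ.1) (0, v) = v := by
    rw [hθ.fderiv_famInChart_inr hx
        (by rw [hθ.zero, extChartAt_to_inv]; exact mem_extChartAt_source _), extChartAt_to_inv,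
      chartSymmL_self, diffeoEquiv_eq_refl hθ.zero, hθ.zero, chartL_self]
    rfl
  rw [h5] at h4
  simp only [Function.comp_apply] at h4
  rw [h0, extChartAt_cotangent_self] at h4
  exact eq_neg_of_add_eq_zero_left h4

/-- The two components of `W_♯`, `w` and `-ξ ∘ Dw`, match the two terms of the differential of `ξ ↦
ξ(w)`. -/
theorem IsSmoothFamily.sympForm_liftedGenerator (hθ : IsSmoothFamily θ)
    (ξ : CotangentBundle E M) (U : E × (E →L[ℝ] ℝ)) :
    sympForm ξ ![liftedGenerator θ ξ, U] = cotDiff (momentum (generator θ)) ξ U := by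
  rw [hθ.smoothField_generator.cotDiff_momentum]
  refine (sympForm_apply ξ _ U).trans ?_
  rw [hθ.liftedGenerator_fst, hθ.liftedGenerator_snd, sub_neg_eq_add]

theorem IsSmoothFamily.liftedGenerator_eq (hθ : IsSmoothFamily θ) :
    liftedGenerator θ = hamField (momentum (generator θ)) := by
  funext ξ
  exact eq_hamField (hθ.sympForm_liftedGenerator ξ)

theorem IsSmoothFamily.smoothField_liftedGenerator (hθ : IsSmoothFamily θ) :
    SmoothField (cotModel E) (liftedGenerator θ) := by
  rw [hθ.liftedGenerator_eq]
  exact smoothField_hamField hθ.smoothField_generator.contMDiff_momentum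

theorem IsSmoothFamily.alphaOf_liftedGenerator (hθ : IsSmoothFamily θ) :
    alphaOf (liftedGenerator θ) = momentum (generator θ) := by
  funext ξ
  rw [alphaOf_eq, hθ.liftedGenerator_fst]
  rfl

theorem IsSmoothFamily.preservesTaut_liftedGenerator (hθ : IsSmoothFamily θ) :
    PreservesTaut (liftedGenerator θ) := by
  have h := hθ.alphaOf_liftedGenerator
  rw [preservesTaut_iff]
  · intro ξ U
    rw [h]
    exact hθ.sympForm_liftedGenerator ξ U
  · rw [h]
    exact hθ.smoothField_generator.contMDiff_momentum.mdifferentiable (by simp)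

theorem IsSmoothFamily.lieForm_liftedGenerator_sympForm (hθ : IsSmoothFamily θ)
    (ξ : CotangentBundle E M) : lieForm (cotModel E) (liftedGenerator θ) sympForm ξ = 0 :=
  lieForm_sympForm_eq_zero hθ.smoothField_generator.contMDiff_momentum
    hθ.sympForm_liftedGenerator ξ

theorem IsSmoothFamily.hasMFDerivAt_cotangentLift_zero (hθ : IsSmoothFamily θ)
    (ξ : CotangentBundle E M) :
    HasMFDerivAt 𝓘(ℝ, ℝ) (cotModel E) (fun s => cotangentLift (θ s) ξ) 0
      (ContinuousLinearMap.smulRight (1 : ℝ →L[ℝ] ℝ) (liftedGenerator θ ξ :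
        E × (E →L[ℝ] ℝ)) : ℝ →L[ℝ] E × (E →L[ℝ] ℝ)) := by
  have h := (hθ.mdifferentiableAt_cotangentLift ξ 0).hasMFDerivAt
  have e : (ContinuousLinearMap.smulRight (1 : ℝ →L[ℝ] ℝ) (liftedGenerator θ ξ :
      E × (E →L[ℝ] ℝ)) : ℝ →L[ℝ] E × (E →L[ℝ] ℝ)) =
      mfderiv 𝓘(ℝ, ℝ) (cotModel E) (fun s => cotangentLift (θ s) ξ) 0 :=
    ContinuousLinearMap.ext_ring (one_smul ℝ (liftedGenerator θ ξ : E × (E →L[ℝ] ℝ)))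
  exact e ▸ h

theorem IsOneParameterGroup.isFlow_cotangentLift {φ : ℝ → M ≃ₘ^∞⟮𝓘(ℝ, E), 𝓘(ℝ, E)⟯ M}
    (hφ : IsSmoothFamily φ) (hg : IsOneParameterGroup φ) :
    IsFlow (cotModel E) (liftedGenerator φ) (fun s => cotangentLift (φ s)) where
  smooth := hφ.contMDiff_cotangentLift
  zero := cotangentLift_of_eq_id hφ.zero
  add s t ξ := cotangentLift_comp (hg s t) ξ
  integralCurve ξ s := by
    have h1 : (fun t => cotangentLift (φ t) ξ) =
        fun t => cotangentLift (φ (t - s)) (cotangentLift (φ s) ξ) := by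
      funext t
      rw [← cotangentLift_comp (hg (t - s) s), sub_add_cancel]
    have h2 := hasMFDerivAt_comp_sub_const s
      (hφ.hasMFDerivAt_cotangentLift_zero (cotangentLift (φ s) ξ))
    rw [← h1] at h2
    exact h2

end LiftedGenerator

/-! ### Strongly convex functions on a vector space. -/

section Convexity

variable {V : Type*} [NormedAddCommGroup V] [NormedSpace ℝ V] {f : V → ℝ}

/-- Along the segment from `v` to `u` the directional derivative has the Hessian as its derivative,
which is positive. -/
theorem StronglyConvex.fderiv_strictMono (hf : StronglyConvex f) (hs : ContDiff ℝ ∞ f) {u v : V}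
    (h : u ≠ v) : fderiv ℝ f v (u - v) < fderiv ℝ f u (u - v) := by
  set w := u - v with hw
  have hw0 : w ≠ 0 := sub_ne_zero.2 h
  have hline : ∀ t : ℝ, HasDerivAt (fun t : ℝ => v + t • w) w t := fun t => by
    simpa using ((hasDerivAt_id t).smul_const w).const_add v
  have h1 : ∀ t : ℝ, HasDerivAt (fun t : ℝ => fderiv ℝ f (v + t • w) w)
      (fderiv ℝ (fderiv ℝ f) (v + t • w) w w) t := by
    intro t
    have h2 : HasFDerivAt (fderiv ℝ f) (fderiv ℝ (fderiv ℝ f) (v + t • w)) (v + t • w) :=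
      ((hs.fderiv_right (m := ∞) (by simp)).differentiable (by simp) _).hasFDerivAt
    simpa using (HasFDerivAt.comp_hasDerivAt (l := fderiv ℝ f) (f := fun t : ℝ => v + t • w) t h2
      (hline t)).clm_apply (hasDerivAt_const t w)
  have h3 : StrictMono fun t : ℝ => fderiv ℝ f (v + t • w) w :=
    strictMono_of_deriv_pos fun t => by
      rw [(h1 t).deriv]
      exact hf _ _ hw0
  have h4 := h3 zero_lt_one
  simpa [hw] using h4

theorem StronglyConvex.le_of_tangent (hf : StronglyConvex f) (hs : ContDiff ℝ ∞ f) (u v : V) :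
    f v + fderiv ℝ f v (u - v) ≤ f u := by
  rcases eq_or_ne u v with rfl | h
  · simp
  set w := u - v with hw
  have hline : ∀ t : ℝ, HasDerivAt (fun t : ℝ => f (v + t • w)) (fderiv ℝ f (v + t • w) w) t := by
    intro t
    have h1 : HasDerivAt (fun t : ℝ => v + t • w) w t := by
      simpa using ((hasDerivAt_id t).smul_const w).const_add v
    exact (hs.differentiable (by simp) _).hasFDerivAt.comp_hasDerivAt t h1
  -- The mean value theorem writes `f u - f v` as the directional derivative at `v + c • w`; by
  -- monotonicity it exceeds that at `v`.
  obtain ⟨c, hc, hc'⟩ := exists_hasDerivAt_eq_slope (fun t : ℝ => f (v + t • w)) _ zero_lt_one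
    (fun t _ => (hline t).continuousAt.continuousWithinAt) (fun t _ => hline t)
  have h2 := hf.fderiv_strictMono hs (u := v + c • w) (v := v) (by
    simp [hc.1.ne', sub_ne_zero.2 h, hw])
  simp only [add_sub_cancel_left, map_smul, smul_eq_mul] at h2
  have h3 := lt_of_mul_lt_mul_left h2 hc.1.le
  simp [hw] at hc' h3 ⊢
  linarith

theorem StronglyConvex.isGreatest_dualValues (hf : StronglyConvex f) (hs : ContDiff ℝ ∞ f)
    (v : V) : IsGreatest (dualValues f (fderiv ℝ f v)) (fderiv ℝ f v v - f v) := by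
  refine ⟨⟨v, rfl⟩, ?_⟩
  rintro _ ⟨u, rfl⟩
  have := hf.le_of_tangent hs u v
  simp only [map_sub] at this
  linarith

/-- A linear change of variable only reindexes the set of values. Hence dual functions can be
computed in charts and are invariant under symmetries. -/
theorem dualValues_comp_equiv {V' : Type*} [NormedAddCommGroup V'] [NormedSpace ℝ V']
    (A : V' ≃L[ℝ] V) (ξ : V →L[ℝ] ℝ) :
    dualValues (f ∘ A) (ξ.comp (A : V' →L[ℝ] V)) = dualValues f ξ :=
  A.surjective.range_comp fun v => ξ v - f v

theorem fderiv_comp_equiv {V' : Type*} [NormedAddCommGroup V'] [NormedSpace ℝ V']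
    (A : V' ≃L[ℝ] V) (v : V') :
    fderiv ℝ (f ∘ A) v = (fderiv ℝ f (A v)).comp (A : V' →L[ℝ] V) :=
  A.comp_right_fderiv

theorem StronglyConvex.comp_equiv {V' : Type*} [NormedAddCommGroup V'] [NormedSpace ℝ V']
    (hf : StronglyConvex f) (hs : ContDiff ℝ ∞ f) (A : V' ≃L[ℝ] V) : StronglyConvex (f ∘ A) := by
  intro v u hu
  have h1 : fderiv ℝ (f ∘ A) = fun v => (fderiv ℝ f (A v)).comp (A : V' →L[ℝ] V) :=
    funext fun v => fderiv_comp_equiv A v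
  have h2 : HasFDerivAt (fderiv ℝ f) (fderiv ℝ (fderiv ℝ f) (A v)) (A v) :=
    ((hs.fderiv_right (m := ∞) (by simp)).differentiable (by simp) _).hasFDerivAt
  have h3 := (HasFDerivAt.comp (g := fderiv ℝ f) v h2 A.hasFDerivAt).clm_comp
    (hasFDerivAt_const (A : V' →L[ℝ] V) v)
  have h4 : fderiv ℝ (fderiv ℝ (f ∘ A)) v u u = fderiv ℝ (fderiv ℝ f) (A v) (A u) (A u) := by
    rw [h1]
    refine (DFunLike.congr_fun (DFunLike.congr_fun (HasFDerivAt.fderiv h3) u) u).trans ?_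
    simp
  rw [h4]
  exact hf _ _ (by simpa using hu)

end Convexity

/-! ### Legendre duality with parameters. -/

section ParametricLegendre

variable {E : Type*} [NormedAddCommGroup E] [NormedSpace ℝ E] [FiniteDimensional ℝ E]
  {V : Type*} [NormedAddCommGroup V] [NormedSpace ℝ V] [FiniteDimensional ℝ V]
  {l : E × V → ℝ} {U : Set E}

/-- The Legendre transform of a family of functions on `V` with parameters in `E`. -/
def paramLegendre (l : E × V → ℝ) (y : E × V) : E × (V →L[ℝ] ℝ) :=
  (y.1, fderiv ℝ (fun v => l (y.1, v)) y.2)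

/-- The dual of a family of functions on `V` with parameters in `E`. -/
def paramDual (l : E × V → ℝ) (y : E × (V →L[ℝ] ℝ)) : ℝ :=
  sSup (dualValues (fun v => l (y.1, v)) y.2)

theorem fderiv_fibre_eq {y : E × V} (hl : ContDiffAt ℝ ∞ l y) :
    fderiv ℝ (fun v => l (y.1, v)) y.2 = (fderiv ℝ l y).comp (ContinuousLinearMap.inr ℝ E V) :=
  (HasFDerivAt.comp (g := l) y.2 (hl.differentiableAt (by simp)).hasFDerivAt
    (hasFDerivAt_prodMk_right y.1 y.2)).fderiv

/-- A family of functions on `V`, with parameters in an open subset `U` of `E`, which is smooth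
and fibrewise strongly convex. -/
structure IsConvexFamily (U : Set E) (l : E × V → ℝ) : Prop where
  isOpen : IsOpen U
  smooth : ∀ y : E × V, y.1 ∈ U → ContDiffAt ℝ ∞ l y
  convex : ∀ x ∈ U, StronglyConvex fun v => l (x, v)

namespace IsConvexFamily

variable (h : IsConvexFamily U l)
include h

theorem contDiff_fibre {x : E} (hx : x ∈ U) : ContDiff ℝ ∞ fun v => l (x, v) :=
  contDiff_iff_contDiffAt.2 fun v =>
    (h.smooth (x, v) hx).comp v (contDiffAt_const.prodMk contDiffAt_id)

theorem eventually_mem {y : E × V} (hy : y.1 ∈ U) : ∀ᶠ z in 𝓝 y, z.1 ∈ U :=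
  continuousAt_fst.preimage_mem_nhds (h.isOpen.mem_nhds hy)

theorem paramLegendre_eventuallyEq {y : E × V} (hy : y.1 ∈ U) : paramLegendre l =ᶠ[𝓝 y]
    fun z => (z.1, (fderiv ℝ l z).comp (ContinuousLinearMap.inr ℝ E V)) := by
  filter_upwards [h.eventually_mem hy] with z hz
  rw [paramLegendre, fderiv_fibre_eq (h.smooth z hz)]

theorem contDiffAt_paramLegendre {y : E × V} (hy : y.1 ∈ U) :
    ContDiffAt ℝ ∞ (paramLegendre l) y := by
  refine ContDiffAt.congr_of_eventuallyEq ?_ (h.paramLegendre_eventuallyEq hy)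
  exact contDiffAt_fst.prodMk (((h.smooth y hy).fderiv_right (by simp)).clm_comp contDiffAt_const)

theorem fderiv_paramLegendre_apply {y : E × V} (hy : y.1 ∈ U) (w : E × V) :
    fderiv ℝ (paramLegendre l) y w =
      (w.1, (fderiv ℝ (fderiv ℝ l) y w).comp (ContinuousLinearMap.inr ℝ E V)) := by
  have h1 : HasFDerivAt (fderiv ℝ l) (fderiv ℝ (fderiv ℝ l) y) y :=
    (((h.smooth y hy).fderiv_right (m := ∞) (by simp)).differentiableAt (by simp)).hasFDerivAt
  have h2 := hasFDerivAt_fst.prodMk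
    (h1.clm_comp (hasFDerivAt_const (ContinuousLinearMap.inr ℝ E V) y))
  rw [(h.paramLegendre_eventuallyEq hy).fderiv_eq, HasFDerivAt.fderiv h2]
  ext <;> simp

theorem fderiv_fderiv_fibre {y : E × V} (hy : y.1 ∈ U) (u : V) :
    fderiv ℝ (fderiv ℝ fun v => l (y.1, v)) y.2 u =
      (fderiv ℝ (fderiv ℝ l) y (0, u)).comp (ContinuousLinearMap.inr ℝ E V) := by
  have h1 : (fderiv ℝ fun v => l (y.1, v)) =
      fun v => (fderiv ℝ l (y.1, v)).comp (ContinuousLinearMap.inr ℝ E V) :=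
    funext fun v => fderiv_fibre_eq (y := (y.1, v)) (h.smooth (y.1, v) hy)
  have h2 : HasFDerivAt (fderiv ℝ l) (fderiv ℝ (fderiv ℝ l) y) y :=
    (((h.smooth y hy).fderiv_right (m := ∞) (by simp)).differentiableAt (by simp)).hasFDerivAt
  have h3 := (HasFDerivAt.comp (g := fderiv ℝ l) y.2 h2
    (hasFDerivAt_prodMk_right y.1 y.2)).clm_comp
      (hasFDerivAt_const (ContinuousLinearMap.inr ℝ E V) y.2)
  rw [h1]
  refine (DFunLike.congr_fun (HasFDerivAt.fderiv h3) u).trans ?_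
  simp

/-- A vector `(X, u)` in the kernel has `X = 0`; its second image component evaluated at `u` is then
the fibre Hessian at `(u, u)`, so `u = 0`. -/
theorem injective_fderiv_paramLegendre {y : E × V} (hy : y.1 ∈ U) :
    Function.Injective (fderiv ℝ (paramLegendre l) y) := by
  rw [injective_iff_map_eq_zero]
  rintro ⟨X, u⟩ hw
  rw [h.fderiv_paramLegendre_apply hy, Prod.mk_eq_zero] at hw
  obtain ⟨rfl : X = 0, h2⟩ := hw
  rw [← h.fderiv_fderiv_fibre hy] at h2
  by_contra hu
  have h3 := h.convex y.1 hy y.2 u (fun h => hu (by rw [h]; rfl))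
  rw [h2] at h3
  exact lt_irrefl _ h3

theorem exists_equiv {y : E × V} (hy : y.1 ∈ U) : ∃ A : (E × V) ≃L[ℝ] (E × (V →L[ℝ] ℝ)),
    HasFDerivAt (paramLegendre l) (A : E × V →L[ℝ] E × (V →L[ℝ] ℝ)) y := by
  have hd : Module.finrank ℝ (E × V) = Module.finrank ℝ (E × (V →L[ℝ] ℝ)) := by
    rw [Module.finrank_prod, Module.finrank_prod,
      ← (LinearMap.toContinuousLinearMap (𝕜 := ℝ) (E := V) (F' := ℝ)).finrank_eq]
    congr 1
    exact (Subspace.dual_finrank_eq (K := ℝ) (V := V)).symm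
  let A := (LinearMap.linearEquivOfInjective
    (fderiv ℝ (paramLegendre l) y : E × V →ₗ[ℝ] E × (V →L[ℝ] ℝ))
    (h.injective_fderiv_paramLegendre hy) hd).toContinuousLinearEquiv
  refine ⟨A, ?_⟩
  have e : (A : E × V →L[ℝ] E × (V →L[ℝ] ℝ)) = fderiv ℝ (paramLegendre l) y := by
    exact ContinuousLinearMap.ext fun w => rfl
  rw [e]
  exact ((h.contDiffAt_paramLegendre hy).differentiableAt (by simp)).hasFDerivAt

theorem paramDual_paramLegendre {y : E × V} (hy : y.1 ∈ U) :
    paramDual l (paramLegendre l y) = (paramLegendre l y).2 y.2 - l y :=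
  ((h.convex y.1 hy).isGreatest_dualValues (h.contDiff_fibre hy) y.2).csSup_eq

theorem isLUB {y : E × V} (hy : y.1 ∈ U) :
    IsLUB (dualValues (fun v => l (y.1, v)) (paramLegendre l y).2)
      (paramDual l (paramLegendre l y)) := by
  rw [h.paramDual_paramLegendre hy]
  exact ((h.convex y.1 hy).isGreatest_dualValues (h.contDiff_fibre hy) y.2).isLUB

/-- Inverse function theorem; continuity of the inverse keeps the parameter in `U`. -/
theorem exists_localInverse {y : E × V} (hy : y.1 ∈ U) :
    ∃ g : E × (V →L[ℝ] ℝ) → E × V, ContDiffAt ℝ ∞ g (paramLegendre l y) ∧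
      g (paramLegendre l y) = y ∧
      ∀ᶠ z in 𝓝 (paramLegendre l y), (g z).1 ∈ U ∧ paramLegendre l (g z) = z := by
  obtain ⟨A, hA⟩ := h.exists_equiv hy
  have hs := h.contDiffAt_paramLegendre hy
  have hst := hs.hasStrictFDerivAt' hA (by simp)
  have h1 := hs.to_localInverse hA (by simp)
  have h2 : hs.localInverse hA (by simp) (paramLegendre l y) = y := hst.localInverse_apply_image
  refine ⟨hs.localInverse hA (by simp), h1, h2, ?_⟩
  have h3 := h1.continuousAt
  rw [ContinuousAt, h2] at h3
  exact (h3.eventually (h.eventually_mem hy)).and hst.eventually_right_inverse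

theorem eventually_exists {y : E × V} (hy : y.1 ∈ U) :
    ∀ᶠ z in 𝓝 (paramLegendre l y), ∃ b : E × V, b.1 ∈ U ∧ paramLegendre l b = z := by
  obtain ⟨g, -, -, hg⟩ := h.exists_localInverse hy
  filter_upwards [hg] with z hz using ⟨g z, hz⟩

/-- With the smooth local inverse `g`, the attained supremum is `z.2 (g z).2 - l (g z)`. -/
theorem contDiffAt_paramDual {y : E × V} (hy : y.1 ∈ U) :
    ContDiffAt ℝ ∞ (paramDual l) (paramLegendre l y) := by
  obtain ⟨g, hg, hgy, hg'⟩ := h.exists_localInverse hy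
  have h1 : ContDiffAt ℝ ∞ (fun z => z.2 (g z).2 - l (g z)) (paramLegendre l y) :=
    (contDiffAt_snd.clm_apply (contDiffAt_snd.comp _ hg)).sub
      (ContDiffAt.comp _ (hgy.symm ▸ h.smooth y hy) hg)
  refine h1.congr_of_eventuallyEq ?_
  filter_upwards [hg'] with z hz
  have h2 := h.paramDual_paramLegendre hz.1
  rwa [hz.2] at h2

/-- Envelope argument: subtracting evaluation at `y.2` from the dual leaves a local minimum at the
image of `y`. It is local because the supremum is known to be finite only near there. -/
theorem fderiv_paramDual {y : E × V} (hy : y.1 ∈ U) :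
    HasFDerivAt (fun η => paramDual l (y.1, η)) (ContinuousLinearMap.apply ℝ ℝ y.2)
      (paramLegendre l y).2 := by
  have h1 : DifferentiableAt ℝ (fun η => paramDual l (y.1, η)) (paramLegendre l y).2 :=
    DifferentiableAt.comp (g := paramDual l) (paramLegendre l y).2
      ((h.contDiffAt_paramDual hy).differentiableAt (by simp))
      ((hasFDerivAt_prodMk_right y.1 (paramLegendre l y).2).differentiableAt)
  have h2 : IsLocalMin (fun η => paramDual l (y.1, η) - ContinuousLinearMap.apply ℝ ℝ y.2 η)
      (paramLegendre l y).2 := by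
    have h3 : Tendsto (fun η : V →L[ℝ] ℝ => (y.1, η)) (𝓝 (paramLegendre l y).2)
        (𝓝 (paramLegendre l y)) :=
      (Continuous.prodMk_right y.1).continuousAt
    filter_upwards [h3.eventually (h.eventually_exists hy)] with η hη
    obtain ⟨b, hb, hb'⟩ := hη
    have h4 := h.isLUB hb
    rw [hb'] at h4
    have hb1 : b.1 = y.1 := congr_arg (fun z : E × (V →L[ℝ] ℝ) => z.1) hb'
    rw [hb1] at h4
    have h5 : η y.2 - l y ≤ paramDual l (y.1, η) := h4.1 ⟨y.2, rfl⟩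
    have h6 := h.paramDual_paramLegendre hy
    have h7 : paramDual l (y.1, (paramLegendre l y).2) = paramDual l (paramLegendre l y) := rfl
    rw [h7, h6]
    simp only [ContinuousLinearMap.apply_apply]
    linarith
  have h8 := h2.hasFDerivAt_eq_zero (h1.hasFDerivAt.sub (ContinuousLinearMap.hasFDerivAt _))
  rw [← sub_eq_zero.1 h8]
  exact h1.hasFDerivAt

end IsConvexFamily

end ParametricLegendre

/-! ### The Legendre transform and the dual of a Lagrangian. -/

section LegendreTangent

variable {E : Type*} [NormedAddCommGroup E] [NormedSpace ℝ E]
  {M : Type*} [TopologicalSpace M] [ChartedSpace E M] [IsManifold 𝓘(ℝ, E) ∞ M]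

/-- The vector underlying a point of `TM`, as an element of the model space. -/
def vec (z : TangentBundle 𝓘(ℝ, E) M) : E := z.2

theorem tangentBundle_ext {z w : TangentBundle 𝓘(ℝ, E) M} (h : z.1 = w.1) (h' : vec z = vec w) :
    z = w := by
  obtain ⟨p, a⟩ := z
  obtain ⟨q, b⟩ := w
  obtain rfl : p = q := h
  exact congr_arg (TotalSpace.mk p) h'

/-- A function on `TM` read in the chart of `TM` induced by the preferred chart at `p`. -/
def lagFamily (L : TangentBundle 𝓘(ℝ, E) M → ℝ) (p : M) (y : E × E) : ℝ :=
  fibreT L ((extChartAt 𝓘(ℝ, E) p).symm y.1)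
    (chartSymmL E p ((extChartAt 𝓘(ℝ, E) p).symm y.1) y.2)

theorem lagFamily_eq_comp (L : TangentBundle 𝓘(ℝ, E) M → ℝ) (z₀ : TangentBundle 𝓘(ℝ, E) M)
    {y : E × E} (hy : y.1 ∈ (extChartAt 𝓘(ℝ, E) z₀.1).target) :
    lagFamily L z₀.1 y = L ((extChartAt 𝓘(ℝ, E).tangent z₀).symm y) :=
  congr_arg L (extChartAt_tangent_symm_apply z₀ y.1 y.2 hy).symm

theorem contDiffAt_lagFamily {L : TangentBundle 𝓘(ℝ, E) M → ℝ} {p : M} {y : E × E}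
    (hy : y.1 ∈ (extChartAt 𝓘(ℝ, E) p).target)
    (hL : ContMDiffAt 𝓘(ℝ, E).tangent 𝓘(ℝ, ℝ) ∞ L ⟨(extChartAt 𝓘(ℝ, E) p).symm y.1,
      (chartSymmL E p ((extChartAt 𝓘(ℝ, E) p).symm y.1) y.2 : E)⟩) :
    ContDiffAt ℝ ∞ (lagFamily L p) y := by
  let z₀ : TangentBundle 𝓘(ℝ, E) M := ⟨p, (0 : E)⟩
  have hy' : y ∈ (extChartAt 𝓘(ℝ, E).tangent z₀).target := by
    rw [extChartAt_tangent_target]; exact ⟨hy, mem_univ _⟩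
  rw [← extChartAt_tangent_symm_apply z₀ y.1 y.2 hy] at hL
  refine (contDiffAt_comp_extChartAt_symm (I' := 𝓘(ℝ, E).tangent) hy' hL).congr_of_eventuallyEq ?_
  filter_upwards [extChartAt_target_mem_nhds' hy'] with w hw
  rw [extChartAt_tangent_target] at hw
  exact lagFamily_eq_comp L z₀ hw.1

theorem fibreT_contDiffAt {L : TangentBundle 𝓘(ℝ, E) M → ℝ} {z : TangentBundle 𝓘(ℝ, E) M}
    (hL : ContMDiffAt 𝓘(ℝ, E).tangent 𝓘(ℝ, ℝ) ∞ L z) :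
    ContDiffAt ℝ ∞ (fibreT L z.1) (vec z) := by
  have hx := mem_extChartAt_target (I := 𝓘(ℝ, E)) z.1
  have e : (⟨(extChartAt 𝓘(ℝ, E) z.1).symm (extChartAt 𝓘(ℝ, E) z.1 z.1),
      (chartSymmL E z.1 ((extChartAt 𝓘(ℝ, E) z.1).symm (extChartAt 𝓘(ℝ, E) z.1 z.1)) (vec z) : E)⟩ :
        TangentBundle 𝓘(ℝ, E) M) = z := by
    refine tangentBundle_ext (extChartAt_to_inv z.1) ?_
    simp only [vec, extChartAt_to_inv, chartSymmL_self]
    rfl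
  have h1 := contDiffAt_lagFamily (y := (extChartAt 𝓘(ℝ, E) z.1 z.1, vec z)) hx (e.symm ▸ hL)
  have h2 := h1.comp (vec z) (contDiffAt_const.prodMk contDiffAt_id)
  refine h2.congr_of_eventuallyEq (Eventually.of_forall fun v => ?_)
  simp only [Function.comp_apply, lagFamily, extChartAt_to_inv, chartSymmL_self]
  rfl

theorem fibreT_contDiff {L : TangentBundle 𝓘(ℝ, E) M → ℝ}
    (hL : ContMDiff 𝓘(ℝ, E).tangent 𝓘(ℝ, ℝ) ∞ L) (p : M) : ContDiff ℝ ∞ (fibreT L p) :=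
  contDiff_iff_contDiffAt.2 fun v => fibreT_contDiffAt (z := ⟨p, v⟩) (hL _)

theorem lagFamily_fibre (L : TangentBundle 𝓘(ℝ, E) M → ℝ) {p : M} {x : E}
    (hx : x ∈ (extChartAt 𝓘(ℝ, E) p).target) :
    (fun v => lagFamily L p (x, v)) = fibreT L ((extChartAt 𝓘(ℝ, E) p).symm x) ∘
      (chartEquiv p ((extChartAt 𝓘(ℝ, E) p).symm x)
        ((extChartAt 𝓘(ℝ, E) p).map_target hx)).symm := rfl

theorem isConvexFamily_lagFamily {L : TangentBundle 𝓘(ℝ, E) M → ℝ}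
    (hL : ContMDiff 𝓘(ℝ, E).tangent 𝓘(ℝ, ℝ) ∞ L) (hc : ∀ p, StronglyConvex (fibreT L p)) (p : M) :
    IsConvexFamily (extChartAt 𝓘(ℝ, E) p).target (lagFamily L p) where
  isOpen := isOpen_extChartAt_target p
  smooth y hy := contDiffAt_lagFamily hy (hL _)
  convex x hx := by
    rw [lagFamily_fibre L hx]
    exact (hc _).comp_equiv (fibreT_contDiff hL _) _

theorem covec_legendreT (L : TangentBundle 𝓘(ℝ, E) M → ℝ) (z : TangentBundle 𝓘(ℝ, E) M) :
    covec (legendreT L z) = fderiv ℝ (fibreT L z.1) (vec z) := rfl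

theorem dualT_eq_paramDual (L : TangentBundle 𝓘(ℝ, E) M → ℝ) {ξ₀ ξ : CotangentBundle E M}
    (hξ : ξ.1 ∈ (extChartAt 𝓘(ℝ, E) ξ₀.1).source) :
    dualT L ξ = paramDual (lagFamily L ξ₀.1) (extChartAt (cotModel E) ξ₀ ξ) := by
  rw [extChartAt_cotangent_apply, paramDual]
  have hx := (extChartAt 𝓘(ℝ, E) ξ₀.1).map_source hξ
  have h1 : (fun v => lagFamily L ξ₀.1 (extChartAt 𝓘(ℝ, E) ξ₀.1 ξ.1, v)) =
      fibreT L ξ.1 ∘ (chartEquiv ξ₀.1 ξ.1 hξ).symm := by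
    funext v
    simp only [lagFamily]
    rw [(extChartAt 𝓘(ℝ, E) ξ₀.1).left_inv hξ]
    rfl
  rw [h1]
  exact congr_arg sSup (dualValues_comp_equiv (chartEquiv ξ₀.1 ξ.1 hξ).symm (covec ξ)).symm

/-- The Legendre transform in charts. -/
theorem extChartAt_legendreT (L : TangentBundle 𝓘(ℝ, E) M → ℝ) {ξ₀ : CotangentBundle E M}
    {z : TangentBundle 𝓘(ℝ, E) M} (hz : z.1 ∈ (extChartAt 𝓘(ℝ, E) ξ₀.1).source) :
    extChartAt (cotModel E) ξ₀ (legendreT L z) = paramLegendre (lagFamily L ξ₀.1)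
      (extChartAt 𝓘(ℝ, E) ξ₀.1 z.1, chartL E ξ₀.1 z.1 (vec z)) := by
  rw [extChartAt_cotangent_apply, paramLegendre]
  refine Prod.ext rfl ?_
  have h1 : (fun v => lagFamily L ξ₀.1 (extChartAt 𝓘(ℝ, E) ξ₀.1 z.1, v)) =
      fibreT L z.1 ∘ (chartEquiv ξ₀.1 z.1 hz).symm := by
    funext v
    simp only [lagFamily]
    rw [(extChartAt 𝓘(ℝ, E) ξ₀.1).left_inv hz]
    rfl
  simp only
  rw [h1, fderiv_comp_equiv, covec_legendreT]
  have h2 : (chartEquiv ξ₀.1 z.1 hz).symm (chartL E ξ₀.1 z.1 (vec z)) = vec z :=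
    chartSymmL_chartL hz _
  rw [h2]
  rfl

theorem isGreatest_dualT [FiniteDimensional ℝ E] {L : TangentBundle 𝓘(ℝ, E) M → ℝ}
    (hL : ContMDiff 𝓘(ℝ, E).tangent 𝓘(ℝ, ℝ) ∞ L) (hc : ∀ p, StronglyConvex (fibreT L p))
    (z : TangentBundle 𝓘(ℝ, E) M) :
    IsGreatest (dualValuesT L (legendreT L z)) (covec (legendreT L z) (vec z) - L z) :=
  (hc z.1).isGreatest_dualValues (fibreT_contDiff hL z.1) (vec z)

variable [FiniteDimensional ℝ E] {L : TangentBundle 𝓘(ℝ, E) M → ℝ}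
  (hL : ContMDiff 𝓘(ℝ, E).tangent 𝓘(ℝ, ℝ) ∞ L) (hc : ∀ p, StronglyConvex (fibreT L p))
include hL hc

theorem eventually_mem_range_legendreT (z : TangentBundle 𝓘(ℝ, E) M) :
    ∀ᶠ ξ in 𝓝 (legendreT L z), ξ ∈ range (legendreT L) := by
  have hz : z.1 ∈ (extChartAt 𝓘(ℝ, E) (legendreT L z).1).source := mem_extChartAt_source z.1
  have h1 := (isConvexFamily_lagFamily hL hc z.1).eventually_exists
    (y := (extChartAt 𝓘(ℝ, E) z.1 z.1, chartL E z.1 z.1 (vec z))) (mem_extChartAt_target z.1)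
  have h2 := extChartAt_legendreT L hz
  have h3 : ContinuousAt (extChartAt (cotModel E) (legendreT L z)) (legendreT L z) :=
    continuousAt_extChartAt (I := cotModel E) _
  rw [ContinuousAt, h2] at h3
  filter_upwards [h3.eventually h1, extChartAt_source_mem_nhds (I := cotModel E) (legendreT L z)]
    with ξ hξ hξ'
  obtain ⟨b, hb, hb'⟩ := hξ
  let w : TangentBundle 𝓘(ℝ, E) M := ⟨(extChartAt 𝓘(ℝ, E) z.1).symm b.1,
    (chartSymmL E z.1 ((extChartAt 𝓘(ℝ, E) z.1).symm b.1) b.2 : E)⟩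
  have hw : w.1 ∈ (extChartAt 𝓘(ℝ, E) (legendreT L z).1).source :=
    (extChartAt 𝓘(ℝ, E) z.1).map_target hb
  -- The preimage `b` found in coordinates is transported to the point `w` of `TM`; injectivity of
  -- the chart gives `Φ_L w = ξ`.
  refine ⟨w, (extChartAt (cotModel E) (legendreT L z)).injOn ?_ hξ' ?_⟩
  · rw [extChartAt_cotangent_source]
    exact hw
  · rw [extChartAt_legendreT L hw, ← hb']
    refine congr_arg (paramLegendre (lagFamily L z.1)) (Prod.ext ?_ ?_)
    · exact (extChartAt 𝓘(ℝ, E) z.1).right_inv hb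
    · exact chartL_chartSymmL hw _

theorem isOpen_range_legendreT : IsOpen (range (legendreT L)) := by
  rw [isOpen_iff_mem_nhds]
  rintro _ ⟨z, rfl⟩
  exact eventually_mem_range_legendreT hL hc z

theorem contMDiffAt_dualT (z : TangentBundle 𝓘(ℝ, E) M) :
    ContMDiffAt (cotModel E) 𝓘(ℝ, ℝ) ∞ (dualT L) (legendreT L z) := by
  have hz : z.1 ∈ (extChartAt 𝓘(ℝ, E) (legendreT L z).1).source := mem_extChartAt_source z.1
  have h1 := (isConvexFamily_lagFamily hL hc z.1).contDiffAt_paramDual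
    (y := (extChartAt 𝓘(ℝ, E) z.1 z.1, chartL E z.1 z.1 (vec z))) (mem_extChartAt_target z.1)
  have h2 := extChartAt_legendreT L hz
  have h3 : ContMDiffAt (cotModel E) 𝓘(ℝ, E × (E →L[ℝ] ℝ)) ∞
    (extChartAt (cotModel E) (legendreT L z)) (legendreT L z) :=
    contMDiffAt_extChartAt (I := cotModel E)
  refine (h1.contMDiffAt.comp_of_eq h3 h2).congr_of_eventuallyEq ?_
  filter_upwards [extChartAt_source_mem_nhds (I := cotModel E) (legendreT L z)] with ξ hξ
  rw [extChartAt_cotangent_source] at hξ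
  exact dualT_eq_paramDual L hξ

theorem legendreC_legendreT (z : TangentBundle 𝓘(ℝ, E) M) :
    legendreC (dualT L) (legendreT L z) = z := by
  refine tangentBundle_ext rfl ?_
  have hx := mem_extChartAt_target (I := 𝓘(ℝ, E)) z.1
  have h1 := (isConvexFamily_lagFamily hL hc z.1).fderiv_paramDual
    (y := (extChartAt 𝓘(ℝ, E) z.1 z.1, vec z)) hx
  have h2 : (fun η => paramDual (lagFamily L z.1) (extChartAt 𝓘(ℝ, E) z.1 z.1, η)) =
      fibreC (dualT L) z.1 := by
    funext η
    have := dualT_eq_paramDual L (ξ₀ := ⟨z.1, η⟩) (ξ := ⟨z.1, η⟩)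
      (mem_extChartAt_source (I := 𝓘(ℝ, E)) z.1)
    rw [extChartAt_cotangent_self] at this
    exact this.symm
  have h3 := extChartAt_legendreT L (ξ₀ := legendreT L z) (mem_extChartAt_source (I := 𝓘(ℝ, E)) z.1)
  have h4 : (paramLegendre (lagFamily L z.1) (extChartAt 𝓘(ℝ, E) z.1 z.1, vec z)).2 =
      covec (legendreT L z) := by
    rw [extChartAt_cotangent_self] at h3
    have h5 : (legendreT L z).1 = z.1 := rfl
    rw [h5, chartL_self] at h3
    exact (congr_arg (fun y : E × (E →L[ℝ] ℝ) => y.2) h3).symm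
  rw [h2, h4] at h1
  exact (ofBidual_eq_iff _ _).2 (HasFDerivAt.fderiv h1)

end LegendreTangent

/-! ### The Legendre transform and the dual of a Hamiltonian. -/

section Evaluation

variable {V : Type*} [NormedAddCommGroup V] [NormedSpace ℝ V]

variable (V) in
/-- The canonical map from `V` to its bidual. -/
def evalL : V →L[ℝ] (V →L[ℝ] ℝ) →L[ℝ] ℝ := (ContinuousLinearMap.id ℝ (V →L[ℝ] ℝ)).flip

theorem evalL_apply (v : V) : evalL V v = ContinuousLinearMap.apply ℝ ℝ v := rfl

theorem injective_evalL [FiniteDimensional ℝ V] : Function.Injective (evalL V) := by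
  intro v w h
  rw [← (ofBidual_eq_iff _ v).2 (evalL_apply v), h, (ofBidual_eq_iff _ w).2 (evalL_apply w)]

variable {A B : Type*} [NormedAddCommGroup A] [NormedSpace ℝ A] [NormedAddCommGroup B]
  [NormedSpace ℝ B]

theorem contDiffAt_comp_prod_clm {g : A × B → ℝ} {T : V →L[ℝ] B} {x : A} {v : V}
    (h : ContDiffAt ℝ ∞ g (x, T v)) : ContDiffAt ℝ ∞ (fun y : A × V => g (y.1, T y.2)) (x, v) :=
  ContDiffAt.comp (g := g) (f := fun y : A × V => (y.1, T y.2)) (x, v) h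
    (contDiffAt_fst.prodMk (T.contDiff.contDiffAt.comp _ contDiffAt_snd))

theorem tendsto_prod_evalL (x : A) (v : V) :
    Tendsto (fun y : A × V => (y.1, evalL V y.2)) (𝓝 (x, v)) (𝓝 (x, evalL V v)) :=
  (continuous_fst.prodMk ((evalL V).continuous.comp continuous_snd)).continuousAt

theorem fderiv_comp_clm {g : B → ℝ} {T : V →L[ℝ] B} {v : V} {D : B →L[ℝ] ℝ}
    (h : HasFDerivAt g D (T v)) : fderiv ℝ (fun v => g (T v)) v = D.comp T :=
  (HasFDerivAt.comp (g := g) v h T.hasFDerivAt).fderiv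

end Evaluation

section LegendreCotangent

variable {E : Type*} [NormedAddCommGroup E] [NormedSpace ℝ E]
  {M : Type*} [TopologicalSpace M] [ChartedSpace E M] [IsManifold 𝓘(ℝ, E) ∞ M]

/-- A function on `T*M` read in the chart of `T*M` induced by the preferred chart at `p`. -/
def hamFamily (H : CotangentBundle E M → ℝ) (p : M) (y : E × (E →L[ℝ] ℝ)) : ℝ :=
  fibreC H ((extChartAt 𝓘(ℝ, E) p).symm y.1)
    (y.2.comp (chartL E p ((extChartAt 𝓘(ℝ, E) p).symm y.1)))

theorem hamFamily_eq_comp (H : CotangentBundle E M → ℝ) (ξ₀ : CotangentBundle E M)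
    {y : E × (E →L[ℝ] ℝ)} (hy : y.1 ∈ (extChartAt 𝓘(ℝ, E) ξ₀.1).target) :
    hamFamily H ξ₀.1 y = H ((extChartAt (cotModel E) ξ₀).symm y) :=
  congr_arg H (extChartAt_cotangent_symm_apply ξ₀ y.1 y.2 hy).symm

theorem contDiffAt_hamFamily {H : CotangentBundle E M → ℝ}
    (hH : ContMDiff (cotModel E) 𝓘(ℝ, ℝ) ∞ H) {p : M} {y : E × (E →L[ℝ] ℝ)}
    (hy : y.1 ∈ (extChartAt 𝓘(ℝ, E) p).target) : ContDiffAt ℝ ∞ (hamFamily H p) y := by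
  let ξ₀ : CotangentBundle E M := ⟨p, (0 : E →L[ℝ] ℝ)⟩
  have hy' : y ∈ (extChartAt (cotModel E) ξ₀).target := by
    rw [extChartAt_cotangent_target]; exact ⟨hy, mem_univ _⟩
  refine (contDiffAt_comp_extChartAt_symm (I' := cotModel E) hy' (hH _)).congr_of_eventuallyEq ?_
  filter_upwards [extChartAt_target_mem_nhds' hy'] with w hw
  rw [extChartAt_cotangent_target] at hw
  exact hamFamily_eq_comp H ξ₀ hw.1

theorem fibreC_eq_hamFamily (H : CotangentBundle E M → ℝ) (p : M) :
    fibreC H p = fun η => hamFamily H p (extChartAt 𝓘(ℝ, E) p p, η) := by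
  funext η
  simp only [hamFamily, extChartAt_to_inv, chartL_self]
  rfl

theorem fibreC_contDiff {H : CotangentBundle E M → ℝ}
    (hH : ContMDiff (cotModel E) 𝓘(ℝ, ℝ) ∞ H) (p : M) : ContDiff ℝ ∞ (fibreC H p) := by
  rw [fibreC_eq_hamFamily]
  exact contDiff_iff_contDiffAt.2 fun η =>
    ContDiffAt.comp (g := hamFamily H p) η
      (contDiffAt_hamFamily hH (mem_extChartAt_target (I := 𝓘(ℝ, E)) p))
      (contDiffAt_const.prodMk contDiffAt_id)

/-- The map induced on covectors by the differential at `x` of the preferred chart at `p`. -/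
def cochartEquiv (p x : M) (hx : x ∈ (extChartAt 𝓘(ℝ, E) p).source) :
    (E →L[ℝ] ℝ) ≃L[ℝ] (E →L[ℝ] ℝ) :=
  (chartEquiv p x hx).arrowCongr (ContinuousLinearEquiv.refl ℝ ℝ)

theorem hamFamily_fibre (H : CotangentBundle E M → ℝ) {p : M} {x : E}
    (hx : x ∈ (extChartAt 𝓘(ℝ, E) p).target) :
    (fun η => hamFamily H p (x, η)) = fibreC H ((extChartAt 𝓘(ℝ, E) p).symm x) ∘
      (cochartEquiv p ((extChartAt 𝓘(ℝ, E) p).symm x)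
        ((extChartAt 𝓘(ℝ, E) p).map_target hx)).symm := rfl

theorem hamFamily_fibre' (H : CotangentBundle E M → ℝ) {p q : M}
    (hq : q ∈ (extChartAt 𝓘(ℝ, E) p).source) :
    (fun η => hamFamily H p (extChartAt 𝓘(ℝ, E) p q, η)) =
      fibreC H q ∘ (cochartEquiv p q hq).symm := by
  funext η
  simp only [hamFamily]
  rw [(extChartAt 𝓘(ℝ, E) p).left_inv hq]
  rfl

theorem isConvexFamily_hamFamily {H : CotangentBundle E M → ℝ}
    (hH : ContMDiff (cotModel E) 𝓘(ℝ, ℝ) ∞ H) (hc : ∀ p, StronglyConvex (fibreC H p)) (p : M) :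
    IsConvexFamily (extChartAt 𝓘(ℝ, E) p).target (hamFamily H p) where
  isOpen := isOpen_extChartAt_target p
  smooth _ hy := contDiffAt_hamFamily hH hy
  convex x hx := by
    rw [hamFamily_fibre H hx]
    exact (hc _).comp_equiv (fibreC_contDiff hH _) _

/-- The model dual lives on the bidual of `E`, so it is restricted along `evalL`; the same device
reduces the other statements on `TM` to `IsConvexFamily`. -/
theorem dualC_eq_paramDual (H : CotangentBundle E M → ℝ) {p : M} {z : TangentBundle 𝓘(ℝ, E) M}
    (hz : z.1 ∈ (extChartAt 𝓘(ℝ, E) p).source) :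
    dualC H z = paramDual (hamFamily H p)
      (extChartAt 𝓘(ℝ, E) p z.1, evalL E (chartL E p z.1 (vec z))) := by
  simp only [paramDual]
  rw [hamFamily_fibre' H hz]
  exact congr_arg sSup (dualValues_comp_equiv (cochartEquiv p z.1 hz).symm
    (evalL E (vec z))).symm

variable [FiniteDimensional ℝ E]

theorem fderiv_fibreC (H : CotangentBundle E M → ℝ) (ξ : CotangentBundle E M) :
    fderiv ℝ (fibreC H ξ.1) (covec ξ) = evalL E (vec (legendreC H ξ)) :=
  (ofBidual_eq_iff _ _).1 rfl

/-- The Legendre transform in charts. -/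
theorem paramLegendre_hamFamily (H : CotangentBundle E M → ℝ) {p : M}
    {ξ : CotangentBundle E M} (hξ : ξ.1 ∈ (extChartAt 𝓘(ℝ, E) p).source) :
    paramLegendre (hamFamily H p)
      (extChartAt 𝓘(ℝ, E) p ξ.1, (covec ξ).comp (chartSymmL E p ξ.1)) =
        (extChartAt 𝓘(ℝ, E) p ξ.1, evalL E (chartL E p ξ.1 (vec (legendreC H ξ)))) := by
  refine Prod.ext rfl ?_
  simp only [paramLegendre]
  rw [hamFamily_fibre' H hξ, fderiv_comp_equiv]
  have h2 : (cochartEquiv p ξ.1 hξ).symm ((covec ξ).comp (chartSymmL E p ξ.1)) = covec ξ :=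
    (cochartEquiv p ξ.1 hξ).symm_apply_apply (covec ξ)
  rw [h2, fderiv_fibreC]
  ext η
  rfl

variable {H : CotangentBundle E M → ℝ}
  (hH : ContMDiff (cotModel E) 𝓘(ℝ, ℝ) ∞ H) (hc : ∀ p, StronglyConvex (fibreC H p))
include hH hc

theorem isGreatest_dualC (ξ : CotangentBundle E M) :
    IsGreatest (dualValuesC H (legendreC H ξ)) (covec ξ (vec (legendreC H ξ)) - H ξ) := by
  have h := (hc ξ.1).isGreatest_dualValues (fibreC_contDiff hH ξ.1) (covec ξ)
  rw [fderiv_fibreC] at h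
  exact h

theorem eventually_mem_range_legendreC (ξ : CotangentBundle E M) :
    ∀ᶠ z in 𝓝 (legendreC H ξ), z ∈ range (legendreC H) := by
  have hξ := mem_extChartAt_source (I := 𝓘(ℝ, E)) ξ.1
  have h1 := (isConvexFamily_hamFamily hH hc ξ.1).eventually_exists
    (y := (extChartAt 𝓘(ℝ, E) ξ.1 ξ.1, (covec ξ).comp (chartSymmL E ξ.1 ξ.1)))
    (mem_extChartAt_target ξ.1)
  rw [paramLegendre_hamFamily H hξ] at h1
  have h3 : ContinuousAt (extChartAt 𝓘(ℝ, E).tangent (legendreC H ξ)) (legendreC H ξ) :=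
    continuousAt_extChartAt (I := 𝓘(ℝ, E).tangent) _
  have h4 : extChartAt 𝓘(ℝ, E).tangent (legendreC H ξ) (legendreC H ξ) =
      (extChartAt 𝓘(ℝ, E) ξ.1 ξ.1, chartL E ξ.1 ξ.1 (vec (legendreC H ξ))) :=
    extChartAt_tangent_apply _ _ hξ
  -- The neighbourhood in `E × E**` given by the local inverse is pulled back to `E × E`;
  -- injectivity of `evalL` recovers the vector afterwards.
  have h5 := tendsto_prod_evalL (extChartAt 𝓘(ℝ, E) ξ.1 ξ.1)
    (chartL E ξ.1 ξ.1 (vec (legendreC H ξ)))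
  rw [ContinuousAt, h4] at h3
  filter_upwards [h3.eventually (h5.eventually h1),
    extChartAt_source_mem_nhds (I := 𝓘(ℝ, E).tangent) (legendreC H ξ)] with z hz hz'
  rw [extChartAt_tangent_source] at hz'
  obtain ⟨b, hb, hb'⟩ := hz
  have e := extChartAt_tangent_apply (legendreC H ξ) z hz'
  let w : CotangentBundle E M := ⟨(extChartAt 𝓘(ℝ, E) ξ.1).symm b.1,
    (b.2.comp (chartL E ξ.1 ((extChartAt 𝓘(ℝ, E) ξ.1).symm b.1)) : E →L[ℝ] ℝ)⟩
  have hw : w.1 ∈ (extChartAt 𝓘(ℝ, E) ξ.1).source := (extChartAt 𝓘(ℝ, E) ξ.1).map_target hb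
  have hwb : ((extChartAt 𝓘(ℝ, E) ξ.1 w.1, (covec w).comp (chartSymmL E ξ.1 w.1)) :
      E × (E →L[ℝ] ℝ)) = b :=
    Prod.ext ((extChartAt 𝓘(ℝ, E) ξ.1).right_inv hb)
      (ContinuousLinearMap.ext fun v => congr_arg b.2 (chartL_chartSymmL hw v))
  have h6 := paramLegendre_hamFamily H hw
  rw [hwb, hb', e] at h6
  have h7 := (congr_arg (fun y : E × ((E →L[ℝ] ℝ) →L[ℝ] ℝ) => y.1) h6)
  have h8 := injective_evalL (congr_arg (fun y : E × ((E →L[ℝ] ℝ) →L[ℝ] ℝ) => y.2) h6)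
  refine ⟨w, (extChartAt 𝓘(ℝ, E).tangent (legendreC H ξ)).injOn ?_ ?_ ?_⟩
  · rw [extChartAt_tangent_source]; exact hw
  · rw [extChartAt_tangent_source]; exact hz'
  · exact (extChartAt_tangent_apply (legendreC H ξ) (legendreC H w) hw).trans
      ((Prod.mk_inj.2 ⟨h7.symm, h8.symm⟩).trans e.symm)

theorem isOpen_range_legendreC : IsOpen (range (legendreC H)) := by
  rw [isOpen_iff_mem_nhds]
  rintro _ ⟨ξ, rfl⟩
  exact eventually_mem_range_legendreC hH hc ξ

theorem contMDiffAt_dualC (ξ : CotangentBundle E M) :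
    ContMDiffAt 𝓘(ℝ, E).tangent 𝓘(ℝ, ℝ) ∞ (dualC H) (legendreC H ξ) := by
  have hξ := mem_extChartAt_source (I := 𝓘(ℝ, E)) ξ.1
  have h1 := (isConvexFamily_hamFamily hH hc ξ.1).contDiffAt_paramDual
    (y := (extChartAt 𝓘(ℝ, E) ξ.1 ξ.1, (covec ξ).comp (chartSymmL E ξ.1 ξ.1)))
    (mem_extChartAt_target ξ.1)
  rw [paramLegendre_hamFamily H hξ] at h1
  have h2 : ContDiffAt ℝ ∞ (fun y : E × E => paramDual (hamFamily H ξ.1) (y.1, evalL E y.2))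
      (extChartAt 𝓘(ℝ, E) ξ.1 ξ.1, chartL E ξ.1 ξ.1 (vec (legendreC H ξ))) :=
    contDiffAt_comp_prod_clm h1
  have h3 : ContMDiffAt 𝓘(ℝ, E).tangent 𝓘(ℝ, E × E) ∞
    (extChartAt 𝓘(ℝ, E).tangent (legendreC H ξ)) (legendreC H ξ) :=
    contMDiffAt_extChartAt (I := 𝓘(ℝ, E).tangent)
  have h4 : extChartAt 𝓘(ℝ, E).tangent (legendreC H ξ) (legendreC H ξ) =
      (extChartAt 𝓘(ℝ, E) ξ.1 ξ.1, chartL E ξ.1 ξ.1 (vec (legendreC H ξ))) :=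
    extChartAt_tangent_apply _ _ hξ
  refine (h2.contMDiffAt.comp_of_eq h3 h4).congr_of_eventuallyEq ?_
  filter_upwards [extChartAt_source_mem_nhds (I := 𝓘(ℝ, E).tangent) (legendreC H ξ)] with z hz
  rw [extChartAt_tangent_source] at hz
  simp only [Function.comp_apply]
  rw [extChartAt_tangent_apply (legendreC H ξ) z hz]
  exact dualC_eq_paramDual H hz

theorem legendreT_legendreC (ξ : CotangentBundle E M) :
    legendreT (dualC H) (legendreC H ξ) = ξ := by
  refine cotangentBundle_ext rfl ?_
  have hξ := mem_extChartAt_source (I := 𝓘(ℝ, E)) ξ.1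
  have h1 := (isConvexFamily_hamFamily hH hc ξ.1).fderiv_paramDual
    (y := (extChartAt 𝓘(ℝ, E) ξ.1 ξ.1, (covec ξ).comp (chartSymmL E ξ.1 ξ.1)))
    (mem_extChartAt_target ξ.1)
  rw [paramLegendre_hamFamily H hξ, chartL_self, chartSymmL_self] at h1
  have h2 : fibreT (dualC H) ξ.1 =
      fun v => paramDual (hamFamily H ξ.1) (extChartAt 𝓘(ℝ, E) ξ.1 ξ.1, evalL E v) := by
    funext v
    have := dualC_eq_paramDual H (z := ⟨ξ.1, v⟩) hξ
    rw [chartL_self] at this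
    exact this
  refine Eq.trans ?_ ((fderiv_comp_clm h1).trans (ContinuousLinearMap.ext fun v => rfl))
  rw [covec_legendreT, ← h2]
  rfl

end LegendreCotangent

/-! ### Lagrangian symmetries give Hamiltonian symmetries. -/

section LagrangianSymmetry

variable {E : Type*} [NormedAddCommGroup E] [NormedSpace ℝ E]
  {M : Type*} [TopologicalSpace M] [ChartedSpace E M] [IsManifold 𝓘(ℝ, E) ∞ M]
  {θ : ℝ → M ≃ₘ^∞⟮𝓘(ℝ, E), 𝓘(ℝ, E)⟯ M}

theorem tangentLift_eq (f : M ≃ₘ^∞⟮𝓘(ℝ, E), 𝓘(ℝ, E)⟯ M) (p : M) (v : E) :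
    tangentLift f ⟨p, v⟩ = (⟨f p, (diffeoEquiv f p v : E)⟩ : TangentBundle 𝓘(ℝ, E) M) :=
  congr_arg (TotalSpace.mk (f p)) (DFunLike.congr_fun (diffeoEquiv_coe f p) v).symm

/-- Substituting `v ↦ df v` matches the two sets of values, whether or not they are bounded, so `L*`
is invariant on all of `T*M`. -/
theorem dualValuesT_cotangentLift {L : TangentBundle 𝓘(ℝ, E) M → ℝ}
    {f : M ≃ₘ^∞⟮𝓘(ℝ, E), 𝓘(ℝ, E)⟯ M} (h : ∀ z, L (tangentLift f z) = L z)
    (ξ : CotangentBundle E M) : dualValuesT L (cotangentLift f ξ) = dualValuesT L ξ := by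
  have h1 : fibreT L ξ.1 = fibreT L (f ξ.1) ∘ diffeoEquiv f ξ.1 := by
    funext v
    exact (h ⟨ξ.1, v⟩).symm.trans (congr_arg L (tangentLift_eq f ξ.1 v))
  have h2 : covec ξ =
      (covec (cotangentLift f ξ)).comp (diffeoEquiv f ξ.1 : E →L[ℝ] E) := by
    rw [covec_cotangentLift]
    ext v
    simp
  have h3 := dualValues_comp_equiv (f := fibreT L (f ξ.1)) (diffeoEquiv f ξ.1)
    (covec (cotangentLift f ξ))
  rw [← h1, ← h2] at h3
  exact h3.symm

variable [FiniteDimensional ℝ E]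

/-- `F ∘ Φ_H` is known to equal the momentum of `W` only on the open set `Φ_L(TM)`; this suffices to
compare their Hamiltonian fields there. -/
theorem hamField_congr {f g : CotangentBundle E M → ℝ} {ξ : CotangentBundle E M}
    (h : f =ᶠ[𝓝 ξ] g) : hamField f ξ = hamField g ξ := by
  refine eq_hamField fun U => ?_
  have e : cotDiff f ξ = cotDiff g ξ := h.mfderiv_eq (I := cotModel E) (I' := 𝓘(ℝ, ℝ))
  rw [← e]
  exact sympForm_hamField f ξ U

theorem IsSmoothFamily.lieFun_liftedGenerator_eq_zero (hθ : IsSmoothFamily θ)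
    {f : CotangentBundle E M → ℝ} {ξ : CotangentBundle E M}
    (hf : MDifferentiableAt (cotModel E) 𝓘(ℝ, ℝ) f ξ)
    (h : ∀ s, f (cotangentLift (θ s) ξ) = f ξ) :
    lieFun (cotModel E) (liftedGenerator θ) f ξ = 0 := by
  have h0 : cotangentLift (θ 0) ξ = ξ := cotangentLift_of_eq_id hθ.zero ξ
  have h1 : HasMFDerivAt (cotModel E) 𝓘(ℝ, ℝ) f (cotangentLift (θ 0) ξ) (cotDiff f ξ) := by
    rw [h0]
    exact hf.hasMFDerivAt
  have h2 := HasMFDerivAt.comp (f := fun s => cotangentLift (θ s) ξ) (0 : ℝ) h1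
    (hθ.hasMFDerivAt_cotangentLift_zero ξ)
  have h3 : f ∘ (fun s => cotangentLift (θ s) ξ) = fun _ => f ξ := funext h
  rw [h3] at h2
  have h4 : HasFDerivAt (fun _ : ℝ => f ξ) ((cotDiff f ξ).comp
      (ContinuousLinearMap.smulRight (1 : ℝ →L[ℝ] ℝ) (liftedGenerator θ ξ : E × (E →L[ℝ] ℝ)) :
        ℝ →L[ℝ] E × (E →L[ℝ] ℝ))) 0 := h2.hasFDerivAt
  have h5 := DFunLike.congr_fun (h4.unique (hasFDerivAt_const (f ξ) (0 : ℝ))) (1 : ℝ)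
  refine Eq.trans ?_ h5
  exact congr_arg (cotDiff f ξ) (one_smul ℝ (liftedGenerator θ ξ : E × (E →L[ℝ] ℝ))).symm

variable {L : TangentBundle 𝓘(ℝ, E) M → ℝ}
  (hL : ContMDiff 𝓘(ℝ, E).tangent 𝓘(ℝ, ℝ) ∞ L) (hc : ∀ p, StronglyConvex (fibreT L p))
include hL hc

theorem IsLagrangianSymmetry.lieFun_dualT (hθ : IsLagrangianSymmetry L θ)
    {ξ : CotangentBundle E M} (hξ : ξ ∈ range (legendreT L)) :
    lieFun (cotModel E) (liftedGenerator θ) (dualT L) ξ = 0 := by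
  obtain ⟨z, rfl⟩ := hξ
  refine hθ.toIsSmoothFamily.lieFun_liftedGenerator_eq_zero
    ((contMDiffAt_dualT hL hc z).mdifferentiableAt (by simp)) fun s => ?_
  exact congr_arg sSup (dualValuesT_cotangentLift (hθ.invariant s) _)

theorem IsLagrangianSymmetry.isHamiltonianSymmetry (hθ : IsLagrangianSymmetry L θ) :
    IsHamiltonianSymmetry (range (legendreT L)) (dualT L) (liftedGenerator θ) where
  smooth := hθ.toIsSmoothFamily.smoothField_liftedGenerator
  lie_symp := hθ.toIsSmoothFamily.lieForm_liftedGenerator_sympForm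
  lie_ham _ := hθ.lieFun_dualT hL hc

theorem noetherQuantity_comp_legendreC {ξ : CotangentBundle E M} (hξ : ξ ∈ range (legendreT L)) :
    (noetherQuantity L θ ∘ legendreC (dualT L)) ξ = momentum (generator θ) ξ := by
  obtain ⟨z, rfl⟩ := hξ
  exact congr_arg (noetherQuantity L θ) (legendreC_legendreT hL hc z)

theorem IsLagrangianSymmetry.isHamiltonianConservedQuantity (hθ : IsLagrangianSymmetry L θ) :
    IsHamiltonianConservedQuantity (range (legendreT L)) (dualT L) (liftedGenerator θ)
      (noetherQuantity L θ ∘ legendreC (dualT L)) := by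
  have hs := hθ.toIsSmoothFamily
  have h1 : ∀ ξ ∈ range (legendreT L), liftedGenerator θ ξ =
      hamField (noetherQuantity L θ ∘ legendreC (dualT L)) ξ := by
    intro ξ hξ
    rw [hs.liftedGenerator_eq]
    refine (hamField_congr ?_).symm
    filter_upwards [(isOpen_range_legendreT hL hc).mem_nhds hξ] with η hη
    exact noetherQuantity_comp_legendreC hL hc hη
  refine ⟨?_, fun ξ hξ => ?_, h1, fun ξ hξ => ?_⟩
  · exact hs.smoothField_generator.contMDiff_momentum.contMDiffOn.congr
      fun ξ hξ => noetherQuantity_comp_legendreC hL hc hξ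
  · rw [poisson_eq_neg_lieFun, neg_eq_zero, lieFun, ← h1 ξ hξ]
    exact hθ.lieFun_dualT hL hc hξ
  · rw [noetherQuantity_comp_legendreC hL hc hξ, hs.alphaOf_liftedGenerator]

end LagrangianSymmetry

/-! ### Euler's relation in degree one forces linearity. -/

section Homogeneous

/-- The relation makes `f(t)/t` constant for `t > 0`, and its limit at `0` is `f' 0`. The
substitution `t = exp u` turns this quotient into a function on all of `ℝ` with zero derivative. -/
theorem deriv_zero_eq_of_euler {f f' : ℝ → ℝ} (hf : ∀ t, HasDerivAt f (f' t) t)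
    (h : ∀ t, t * f' t = f t) : f' 0 = f 1 := by
  have h1 : ∀ u, HasDerivAt (fun u => f (Real.exp u) * Real.exp (-u)) 0 u := fun u => by
    have h2 := ((hf (Real.exp u)).comp u (Real.hasDerivAt_exp u)).mul ((hasDerivAt_neg u).exp)
    have h3 : f' (Real.exp u) * Real.exp u * Real.exp (-u) +
        f (Real.exp u) * (Real.exp (-u) * -1) = 0 := by
      rw [← h (Real.exp u)]
      ring
    exact h3 ▸ h2
  have h3 : ∀ u, f (Real.exp u) * Real.exp (-u) = f 1 := fun u => by
    have := is_const_of_deriv_eq_zero (fun u => (h1 u).differentiableAt) (fun u => (h1 u).deriv) u 0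
    simpa using this
  have h0 : f 0 = 0 := by simpa using (h 0).symm
  have h4 : Tendsto Real.exp atBot (𝓝[≠] 0) :=
    tendsto_nhdsWithin_iff.2 ⟨Real.tendsto_exp_atBot,
      Eventually.of_forall fun u => (Real.exp_pos u).ne'⟩
  have h5 := (hasDerivAt_iff_tendsto_slope.1 (hf 0)).comp h4
  refine tendsto_nhds_unique h5 (tendsto_const_nhds.congr fun u => ?_)
  rw [← h3 u, Function.comp_apply, slope_def_field, h0, sub_zero, sub_zero, Real.exp_neg,
    div_eq_mul_inv]

variable {V : Type*} [NormedAddCommGroup V] [NormedSpace ℝ V]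

/-- A differentiable function which satisfies Euler's relation for degree one is linear. -/
theorem fderiv_eq_fderiv_zero_of_euler {g : V → ℝ} {D : V → V →L[ℝ] ℝ}
    (hg : ∀ η, HasFDerivAt g (D η) η) (h : ∀ η, D η η = g η) (η : V) : D η = D 0 := by
  have h1 : ∀ η, D 0 η = g η := fun η => by
    have h2 := deriv_zero_eq_of_euler (f := fun t : ℝ => g (t • η)) (f' := fun t => D (t • η) η)
      (fun t => by
        have h3 : HasDerivAt (fun t : ℝ => t • η) η t := by
          simpa using (hasDerivAt_id t).smul_const η
        exact (hg (t • η)).comp_hasDerivAt t h3)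
      (fun t => by rw [← h (t • η), map_smul, smul_eq_mul])
    simpa using h2
  have h4 : g = D 0 := funext fun η => (h1 η).symm
  exact (hg η).unique (h4 ▸ (D 0).hasFDerivAt)

end Homogeneous

/-! ### Descent of `α`-preserving fields to the base. -/

section HamiltonianSymmetry

variable {E : Type*} [NormedAddCommGroup E] [NormedSpace ℝ E]
  {M : Type*} [TopologicalSpace M] [ChartedSpace E M] [IsManifold 𝓘(ℝ, E) ∞ M]

theorem hasFDerivAt_fibreC {G : CotangentBundle E M → ℝ} {ξ : CotangentBundle E M}
    (hG : ContMDiff (cotModel E) 𝓘(ℝ, ℝ) ∞ G) :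
    HasFDerivAt (fibreC G ξ.1)
      ((cotDiff G ξ).comp (ContinuousLinearMap.inr ℝ E (E →L[ℝ] ℝ))) (covec ξ) := by
  have hx := mem_extChartAt_target (I := 𝓘(ℝ, E)) ξ.1
  have h1 : hamFamily G ξ.1 =ᶠ[𝓝 (extChartAt 𝓘(ℝ, E) ξ.1 ξ.1, covec ξ)]
      G ∘ (extChartAt (cotModel E) ξ).symm := by
    have := extChartAt_target_mem_nhds (I := cotModel E) ξ
    rw [extChartAt_cotangent_self] at this
    filter_upwards [this] with y hy
    rw [extChartAt_cotangent_target] at hy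
    exact hamFamily_eq_comp G ξ hy.1
  have h2 : HasFDerivAt (hamFamily G ξ.1)
      (fderiv ℝ (hamFamily G ξ.1) (extChartAt 𝓘(ℝ, E) ξ.1 ξ.1, covec ξ))
      (extChartAt 𝓘(ℝ, E) ξ.1 ξ.1, covec ξ) :=
    ((contDiffAt_hamFamily (y := (_, covec ξ)) hG hx).differentiableAt (by simp)).hasFDerivAt
  have h3 : cotDiff G ξ =
      fderiv ℝ (hamFamily G ξ.1) (extChartAt 𝓘(ℝ, E) ξ.1 ξ.1, covec ξ) := by
    rw [h1.fderiv_eq, ← extChartAt_cotangent_self]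
    exact mfderiv_eq_fderiv_comp_extChartAt_symm (hG.mdifferentiable (by simp) ξ)
  rw [h3, fibreC_eq_hamFamily]
  exact HasFDerivAt.comp (g := hamFamily G ξ.1) (covec ξ) h2
    (hasFDerivAt_prodMk_right (extChartAt 𝓘(ℝ, E) ξ.1 ξ.1) (covec ξ))

/-- Needed for uniqueness of integral curves in `T*M`. Points of one fibre lie in a common chart;
points of different fibres are separated by the projection. -/
instance CotangentBundle.t2Space [T2Space M] : T2Space (CotangentBundle E M) where
  t2 ξ ζ hne := by
    have hc : Continuous fun η : CotangentBundle E M => η.1 :=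
      FiberBundle.continuous_proj (E →L[ℝ] ℝ) (fun p : M => TangentSpace 𝓘(ℝ, E) p →L[ℝ] ℝ)
    by_cases h : ξ.1 = ζ.1
    · have hζ : ζ ∈ (extChartAt (cotModel E) ξ).source := by
        rw [extChartAt_cotangent_source]
        exact h ▸ mem_extChartAt_source (I := 𝓘(ℝ, E)) ξ.1
      have hξ := mem_extChartAt_source (I := cotModel E) ξ
      obtain ⟨u, v, hu, hv, hu', hv', huv⟩ := t2_separation
        fun e => hne ((extChartAt (cotModel E) ξ).injOn hξ hζ e)
      have ho := isOpen_extChartAt_source (I := cotModel E) ξ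
      have hcont := continuousOn_extChartAt (I := cotModel E) ξ
      exact ⟨_, _, hcont.isOpen_inter_preimage ho hu, hcont.isOpen_inter_preimage ho hv,
        ⟨hξ, hu'⟩, ⟨hζ, hv'⟩, (huv.preimage _).mono inter_subset_right inter_subset_right⟩
    · exact separated_by_continuous hc h

variable (W : VecField (cotModel E) (CotangentBundle E M))

/-- The projection to `M` of the restriction of a vector field on `T*M` to the zero section. -/
def baseField : VecField 𝓘(ℝ, E) M := fun p =>
  (W ⟨p, (0 : E →L[ℝ] ℝ)⟩ : E × (E →L[ℝ] ℝ)).1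

theorem contMDiff_zeroCovector :
    ContMDiff 𝓘(ℝ, E) (cotModel E) ∞ (fun p : M => (⟨p, (0 : E →L[ℝ] ℝ)⟩ : CotangentBundle E M)) :=
  contMDiff_zeroSection ℝ (fun p : M => TangentSpace 𝓘(ℝ, E) p →L[ℝ] ℝ)

variable {W}

theorem SmoothField.smoothField_baseField (hW : SmoothField (cotModel E) W) :
    SmoothField 𝓘(ℝ, E) (baseField W) := by
  refine smoothField_iff.2 fun p => ?_
  have h1 := smoothField_iff.1 hW ⟨p, (0 : E →L[ℝ] ℝ)⟩
  have h2 := contDiff_fst.contMDiff.contMDiffAt.comp p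
    (h1.comp p contMDiff_zeroCovector.contMDiffAt)
  refine h2.congr_of_eventuallyEq ?_
  filter_upwards [extChartAt_source_mem_nhds (I := 𝓘(ℝ, E)) p] with q hq
  rw [← chartL_eq_mfderiv hq]
  exact (mfderiv_extChartAt_cotangent_fst (ξ₀ := ⟨p, (0 : E →L[ℝ] ℝ)⟩)
    (ξ := ⟨q, (0 : E →L[ℝ] ℝ)⟩) hq _).symm

variable [FiniteDimensional ℝ E]

theorem hamField_alphaOf (hW : SmoothField (cotModel E) W) (hα : PreservesTaut W) :
    hamField (alphaOf W) = W := by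
  funext ξ
  exact (eq_hamField ((preservesTaut_iff
    (hW.contMDiff_alphaOf.mdifferentiable (by simp))).1 hα ξ)).symm

theorem isHamiltonianConservedQuantity_alphaOf {H : CotangentBundle E M → ℝ}
    {D : Set (CotangentBundle E M)} (hW : IsHamiltonianSymmetry D H W) (hα : PreservesTaut W) :
    IsHamiltonianConservedQuantity D H W (alphaOf W) where
  smooth := hW.smooth.contMDiff_alphaOf.contMDiffOn
  poisson_eq_zero ξ hξ := by
    rw [poisson_eq_neg_lieFun, hamField_alphaOf hW.smooth hα, hW.lie_ham ξ hξ, neg_zero]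
  eq_hamField ξ _ := by rw [hamField_alphaOf hW.smooth hα]
  eq_alpha _ _ := rfl

/-- The projection to `M` of a vector field which preserves the tautological form is constant on
the fibres. -/
theorem PreservesTaut.fst_eq_baseField (hα : PreservesTaut W) (hW : SmoothField (cotModel E) W)
    (ξ : CotangentBundle E M) : (W ξ : E × (E →L[ℝ] ℝ)).1 = baseField W ξ.1 := by
  have hG := hW.contMDiff_alphaOf
  let w : (E →L[ℝ] ℝ) → E := fun η => (W ⟨ξ.1, η⟩ : E × (E →L[ℝ] ℝ)).1
  -- Testing `ι_W ω = d(α(W))` on vertical vectors `(0, ζ)` leaves `ζ(w η)`.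
  have h1 : ∀ η : E →L[ℝ] ℝ, HasFDerivAt (fibreC (alphaOf W) ξ.1) (evalL E (w η)) η := by
    intro η
    have h2 := hasFDerivAt_fibreC (ξ := ⟨ξ.1, η⟩) hG
    have h3 : (cotDiff (alphaOf W) ⟨ξ.1, η⟩).comp (ContinuousLinearMap.inr ℝ E (E →L[ℝ] ℝ)) =
        evalL E (w η) := by
      ext ζ
      have h4 := (preservesTaut_iff (hG.mdifferentiable (by simp))).1 hα ⟨ξ.1, η⟩ (0, ζ)
      refine h4.symm.trans ((sympForm_apply _ _ _).trans ?_)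
      simp only [map_zero, sub_zero]
      rfl
    exact h3 ▸ h2
  -- Euler's relation here is `α(W) = η(w η)`, so `w` takes the same value at `ξ` as at the zero
  -- covector.
  have h5 := fderiv_eq_fderiv_zero_of_euler h1
    (fun η => (alphaOf_eq W ⟨ξ.1, η⟩).symm) (covec ξ)
  exact injective_evalL h5

theorem PreservesTaut.alphaOf_eq_momentum (hα : PreservesTaut W)
    (hW : SmoothField (cotModel E) W) : alphaOf W = momentum (baseField W) := by
  funext ξ
  rw [alphaOf_eq, hα.fst_eq_baseField hW]
  rfl

end HamiltonianSymmetry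

/-! ### The flow on the base and its lift. -/

section BaseFlow

variable {E : Type*} [NormedAddCommGroup E] [NormedSpace ℝ E] [FiniteDimensional ℝ E]
  {M : Type*} [TopologicalSpace M] [T2Space M] [ChartedSpace E M] [IsManifold 𝓘(ℝ, E) ∞ M]
  {W : VecField (cotModel E) (CotangentBundle E M)}
  {ψ : ℝ → CotangentBundle E M → CotangentBundle E M}

theorem PreservesTaut.isMIntegralCurve_proj (hα : PreservesTaut W)
    (hW : SmoothField (cotModel E) W) {c : ℝ → CotangentBundle E M}
    (hc : IsMIntegralCurve (I := cotModel E) c W) :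
    IsMIntegralCurve (I := 𝓘(ℝ, E)) (fun s => (c s).1) (baseField W) := by
  intro t
  have h1 := (mdifferentiableAt_cotangent_proj (c t)).hasMFDerivAt.comp t (hc t)
  have h2 : (ContinuousLinearMap.smulRight (1 : ℝ →L[ℝ] ℝ) (baseField W (c t).1 : E) :
      ℝ →L[ℝ] E) = (dProj (c t) : E × (E →L[ℝ] ℝ) →L[ℝ] E).comp
        (ContinuousLinearMap.smulRight (1 : ℝ →L[ℝ] ℝ) (W (c t) : E × (E →L[ℝ] ℝ)) :
          ℝ →L[ℝ] E × (E →L[ℝ] ℝ)) := by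
    rw [dProj_eq_fst, ← hα.fst_eq_baseField hW]
    rfl
  exact h2 ▸ h1

theorem IsFlow.eq_of_isMIntegralCurve (hW : SmoothField (cotModel E) W)
    (hψ : IsFlow (cotModel E) W ψ) {c : ℝ → CotangentBundle E M}
    (hc : IsMIntegralCurve (I := cotModel E) c W) (s : ℝ) : ψ s (c 0) = c s := by
  have := FiniteDimensional.complete ℝ E
  exact congr_fun (isMIntegralCurve_Ioo_eq_of_contMDiff_boundaryless (t₀ := 0)
    (hW.of_le (by simp)) (hψ.integralCurve (c 0)) hc (hψ.zero _)) s

variable (hα : PreservesTaut W) (hW : SmoothField (cotModel E) W) (hψ : IsFlow (cotModel E) W ψ)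
include hα hW hψ

/-- Both projected orbits are integral curves of `baseField W` with the same initial point. -/
theorem IsFlow.fst_eq {ξ ζ : CotangentBundle E M} (h : ξ.1 = ζ.1) (s : ℝ) :
    (ψ s ξ).1 = (ψ s ζ).1 := by
  have := FiniteDimensional.complete ℝ E
  refine congr_fun (isMIntegralCurve_Ioo_eq_of_contMDiff_boundaryless (t₀ := 0)
    (hW.smoothField_baseField.of_le (by simp))
    (hα.isMIntegralCurve_proj hW (hψ.integralCurve ξ))
    (hα.isMIntegralCurve_proj hW (hψ.integralCurve ζ)) ?_) s
  simp only [hψ.zero]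
  exact h

omit hα hW [T2Space M] in
theorem IsFlow.contMDiff_base : ContMDiff (𝓘(ℝ, ℝ).prod 𝓘(ℝ, E)) 𝓘(ℝ, E) ∞
    (fun q : ℝ × M => (ψ q.1 ⟨q.2, (0 : E →L[ℝ] ℝ)⟩).1) :=
  (contMDiff_proj (n := ∞) (fun p : M => TangentSpace 𝓘(ℝ, E) p →L[ℝ] ℝ)).comp
    (hψ.smooth.comp (contMDiff_fst.prodMk (contMDiff_zeroCovector.comp contMDiff_snd)))

theorem IsFlow.base_add (s t : ℝ) (p : M) : (ψ (s + t) ⟨p, (0 : E →L[ℝ] ℝ)⟩).1 =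
    (ψ s ⟨(ψ t ⟨p, (0 : E →L[ℝ] ℝ)⟩).1, (0 : E →L[ℝ] ℝ)⟩).1 := by
  rw [hψ.add]
  exact hψ.fst_eq hα hW (ξ := ψ t ⟨p, (0 : E →L[ℝ] ℝ)⟩)
    (ζ := ⟨(ψ t ⟨p, (0 : E →L[ℝ] ℝ)⟩).1, (0 : E →L[ℝ] ℝ)⟩) rfl s

theorem IsFlow.base_add_eq_self {s t : ℝ} (h : s + t = 0) (p : M) :
    (ψ s ⟨(ψ t ⟨p, (0 : E →L[ℝ] ℝ)⟩).1, (0 : E →L[ℝ] ℝ)⟩).1 = p := by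
  refine (hψ.base_add hα hW s t p).symm.trans ?_
  rw [h, hψ.zero]

/-- The diffeomorphisms of `M` covered by the flow of a vector field which preserves the
tautological form. -/
def IsFlow.baseDiffeo (s : ℝ) : M ≃ₘ^∞⟮𝓘(ℝ, E), 𝓘(ℝ, E)⟯ M where
  toFun p := (ψ s ⟨p, (0 : E →L[ℝ] ℝ)⟩).1
  invFun p := (ψ (-s) ⟨p, (0 : E →L[ℝ] ℝ)⟩).1
  left_inv := hψ.base_add_eq_self hα hW (neg_add_cancel s)
  right_inv := hψ.base_add_eq_self hα hW (add_neg_cancel s)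
  contMDiff_toFun := hψ.contMDiff_base.comp (contMDiff_const.prodMk contMDiff_id)
  contMDiff_invFun := hψ.contMDiff_base.comp (contMDiff_const.prodMk contMDiff_id)

theorem IsFlow.isSmoothFamily_baseDiffeo : IsSmoothFamily (hψ.baseDiffeo hα hW) where
  smooth := hψ.contMDiff_base
  zero _ := congr_arg (fun ξ : CotangentBundle E M => ξ.1) (hψ.zero _)

theorem IsFlow.isOneParameterGroup_baseDiffeo : IsOneParameterGroup (hψ.baseDiffeo hα hW) :=
  hψ.base_add hα hW

theorem IsFlow.generator_baseDiffeo : generator (hψ.baseDiffeo hα hW) = baseField W := by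
  funext p
  have h1 := hα.isMIntegralCurve_proj hW (hψ.integralCurve ⟨p, (0 : E →L[ℝ] ℝ)⟩) 0
  have h2 := DFunLike.congr_fun h1.mfderiv (1 : ℝ)
  refine h2.trans ((one_smul ℝ _).trans ?_)
  exact congr_arg (fun ξ : CotangentBundle E M => (baseField W ξ.1 : E)) (hψ.zero _)

/-- Both sides are the Hamiltonian field of one function, `α(W)`, which is the momentum of
`baseField W`. -/
theorem IsFlow.liftedGenerator_baseDiffeo : liftedGenerator (hψ.baseDiffeo hα hW) = W := by
  rw [(hψ.isSmoothFamily_baseDiffeo hα hW).liftedGenerator_eq, hψ.generator_baseDiffeo hα hW,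
    ← hα.alphaOf_eq_momentum hW, hamField_alphaOf hW hα]

theorem IsFlow.eq_cotangentLift_baseDiffeo (s : ℝ) :
    ψ s = cotangentLift (hψ.baseDiffeo hα hW s) := by
  have h1 := (hψ.isOneParameterGroup_baseDiffeo hα hW).isFlow_cotangentLift
    (hψ.isSmoothFamily_baseDiffeo hα hW)
  rw [hψ.liftedGenerator_baseDiffeo hα hW] at h1
  funext ξ
  exact (congr_arg (ψ s) (h1.zero ξ).symm).trans
    (hψ.eq_of_isMIntegralCurve hW (h1.integralCurve ξ) s)

end BaseFlow

/-! ### Invariance of `H`, of `Φ_H` and of `H*`. -/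

section HamiltonianInvariance

variable {E : Type*} [NormedAddCommGroup E] [NormedSpace ℝ E]
  {M : Type*} [TopologicalSpace M] [ChartedSpace E M] [IsManifold 𝓘(ℝ, E) ∞ M]

theorem IsFlow.comp_eq_of_lieFun_eq_zero {W : VecField (cotModel E) (CotangentBundle E M)}
    {ψ : ℝ → CotangentBundle E M → CotangentBundle E M} (hψ : IsFlow (cotModel E) W ψ)
    {H : CotangentBundle E M → ℝ} (hH : MDifferentiable (cotModel E) 𝓘(ℝ, ℝ) H)
    (h : ∀ ξ, lieFun (cotModel E) W H ξ = 0) (s : ℝ) (ξ : CotangentBundle E M) :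
    H (ψ s ξ) = H ξ := by
  have h1 : ∀ t, HasDerivAt (fun t => H (ψ t ξ)) 0 t := by
    intro t
    have h2 := (hH (ψ t ξ)).hasMFDerivAt.comp t (hψ.integralCurve ξ t)
    have h3 : HasFDerivAt (fun t => H (ψ t ξ)) ((cotDiff H (ψ t ξ)).comp
        (ContinuousLinearMap.smulRight (1 : ℝ →L[ℝ] ℝ) (W (ψ t ξ) : E × (E →L[ℝ] ℝ)) :
          ℝ →L[ℝ] E × (E →L[ℝ] ℝ))) t := h2.hasFDerivAt
    have h4 : (cotDiff H (ψ t ξ)) ((1 : ℝ) • (W (ψ t ξ) : E × (E →L[ℝ] ℝ))) = 0 := by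
      rw [one_smul]
      exact h (ψ t ξ)
    exact h4 ▸ h3.hasDerivAt
  have h5 := is_const_of_deriv_eq_zero (fun t => (h1 t).differentiableAt)
    (fun t => (h1 t).deriv) s 0
  rwa [hψ.zero] at h5

variable {H : CotangentBundle E M → ℝ} {f : M ≃ₘ^∞⟮𝓘(ℝ, E), 𝓘(ℝ, E)⟯ M}

/-- The map induced on covectors by the differential of a diffeomorphism. -/
def codiffeoEquiv (f : M ≃ₘ^∞⟮𝓘(ℝ, E), 𝓘(ℝ, E)⟯ M) (p : M) : (E →L[ℝ] ℝ) ≃L[ℝ] (E →L[ℝ] ℝ) :=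
  (diffeoEquiv f p).arrowCongr (ContinuousLinearEquiv.refl ℝ ℝ)

theorem evalL_comp_codiffeoEquiv (f : M ≃ₘ^∞⟮𝓘(ℝ, E), 𝓘(ℝ, E)⟯ M) (p : M) (v : E) :
    (evalL E v).comp (codiffeoEquiv f p : (E →L[ℝ] ℝ) →L[ℝ] (E →L[ℝ] ℝ)) =
      evalL E ((diffeoEquiv f p).symm v) := by
  ext η
  rfl

theorem fibreC_comp_codiffeoEquiv (h : ∀ ξ, H (cotangentLift f ξ) = H ξ) (p : M) :
    fibreC H p = fibreC H (f p) ∘ codiffeoEquiv f p :=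
  funext fun η => (h ⟨p, η⟩).symm

theorem dualC_tangentLift (h : ∀ ξ, H (cotangentLift f ξ) = H ξ)
    (z : TangentBundle 𝓘(ℝ, E) M) : dualC H (tangentLift f z) = dualC H z := by
  have h1 := dualValues_comp_equiv (f := fibreC H (f z.1)) (codiffeoEquiv f z.1)
    (evalL E (diffeoEquiv f z.1 (vec z)))
  rw [evalL_comp_codiffeoEquiv, ← fibreC_comp_codiffeoEquiv h,
    ContinuousLinearEquiv.symm_apply_apply] at h1
  exact (congr_arg (dualC H) (tangentLift_eq f z.1 (vec z))).trans (congr_arg sSup h1.symm)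

variable [FiniteDimensional ℝ E]

/-- Equivariance of `Φ_H`, obtained by differentiating along the fibre the invariance `H_p = H_{f p}
∘ f_♯`. -/
theorem tangentLift_legendreC (h : ∀ ξ, H (cotangentLift f ξ) = H ξ)
    (ξ : CotangentBundle E M) :
    tangentLift f (legendreC H ξ) = legendreC H (cotangentLift f ξ) := by
  have h1 := fderiv_comp_equiv (f := fibreC H (f ξ.1)) (codiffeoEquiv f ξ.1) (covec ξ)
  have h2 := fderiv_fibreC H (cotangentLift f ξ)
  have h3 : covec (cotangentLift f ξ) = codiffeoEquiv f ξ.1 (covec ξ) := rfl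
  have h4 : (cotangentLift f ξ).1 = f ξ.1 := rfl
  rw [h3, h4] at h2
  rw [h2, evalL_comp_codiffeoEquiv, ← fibreC_comp_codiffeoEquiv h, fderiv_fibreC] at h1
  have h5 := (diffeoEquiv f ξ.1).eq_symm_apply.1 (injective_evalL h1)
  exact (tangentLift_eq f ξ.1 (vec (legendreC H ξ))).trans (tangentBundle_ext rfl h5)

end HamiltonianInvariance

/-! ### Noether's theorem for a Lagrangian on an open subset of `TM`. -/

section Noether

variable {E : Type*} [NormedAddCommGroup E] [NormedSpace ℝ E] [FiniteDimensional ℝ E]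
  {M : Type*} [TopologicalSpace M] [ChartedSpace E M] [IsManifold 𝓘(ℝ, E) ∞ M]
  {θ : ℝ → M ≃ₘ^∞⟮𝓘(ℝ, E), 𝓘(ℝ, E)⟯ M} {L : TangentBundle 𝓘(ℝ, E) M → ℝ}

theorem lagFamily_extChartAt (L : TangentBundle 𝓘(ℝ, E) M → ℝ) {p : M}
    {z : TangentBundle 𝓘(ℝ, E) M} (hz : z.1 ∈ (extChartAt 𝓘(ℝ, E) p).source) :
    lagFamily L p (extChartAt 𝓘(ℝ, E) p z.1, chartL E p z.1 (vec z)) = L z := by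
  simp only [lagFamily]
  rw [(extChartAt 𝓘(ℝ, E) p).left_inv hz, chartSymmL_chartL hz]
  rfl

theorem contDiffAt_lagFamily_extChartAt {p : M} {z : TangentBundle 𝓘(ℝ, E) M}
    (hz : z.1 ∈ (extChartAt 𝓘(ℝ, E) p).source)
    (hL : ContMDiffAt 𝓘(ℝ, E).tangent 𝓘(ℝ, ℝ) ∞ L z) :
    ContDiffAt ℝ ∞ (lagFamily L p) (extChartAt 𝓘(ℝ, E) p z.1, chartL E p z.1 (vec z)) := by
  refine contDiffAt_lagFamily ((extChartAt 𝓘(ℝ, E) p).map_source hz) ?_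
  have e : (⟨(extChartAt 𝓘(ℝ, E) p).symm (extChartAt 𝓘(ℝ, E) p z.1),
      (chartSymmL E p ((extChartAt 𝓘(ℝ, E) p).symm (extChartAt 𝓘(ℝ, E) p z.1))
        (chartL E p z.1 (vec z)) : E)⟩ : TangentBundle 𝓘(ℝ, E) M) = z := by
    refine tangentBundle_ext ((extChartAt 𝓘(ℝ, E) p).left_inv hz) ?_
    simp only [vec]
    rw [(extChartAt 𝓘(ℝ, E) p).left_inv hz]
    exact chartSymmL_chartL hz (vec z)
  exact e.symm ▸ hL

theorem noetherQuantity_eq_inChart {p : M} {z : TangentBundle 𝓘(ℝ, E) M}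
    (hz : z.1 ∈ (extChartAt 𝓘(ℝ, E) p).source) :
    noetherQuantity L θ z = (paramLegendre (lagFamily L p)
      (extChartAt 𝓘(ℝ, E) p z.1, chartL E p z.1 (vec z))).2
        (fieldInChart (generator θ) p (extChartAt 𝓘(ℝ, E) p z.1)) := by
  have hz' : legendreT L z ∈
      (extChartAt (cotModel E) (⟨p, (0 : E →L[ℝ] ℝ)⟩ : CotangentBundle E M)).source := by
    rw [extChartAt_cotangent_source]; exact hz
  have h1 := momentum_eq_inChart (generator θ) hz'
  rw [extChartAt_legendreT L hz] at h1
  exact h1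

theorem contMDiffAt_noetherQuantity (hθ : IsSmoothFamily θ) {z : TangentBundle 𝓘(ℝ, E) M}
    (hL : ∀ᶠ w in 𝓝 z, ContMDiffAt 𝓘(ℝ, E).tangent 𝓘(ℝ, ℝ) ∞ L w) :
    ContMDiffAt 𝓘(ℝ, E).tangent 𝓘(ℝ, ℝ) ∞ (noetherQuantity L θ) z := by
  have hz := mem_extChartAt_source (I := 𝓘(ℝ, E)) z.1
  have h1 : ContDiffAt ℝ ∞ (fun y : E × E => fderiv ℝ (lagFamily L z.1) y
      (0, fieldInChart (generator θ) z.1 y.1))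
      (extChartAt 𝓘(ℝ, E) z.1 z.1, chartL E z.1 z.1 (vec z)) :=
    ((contDiffAt_lagFamily_extChartAt hz hL.self_of_nhds).fderiv_right (by simp)).clm_apply
      (contDiffAt_const.prodMk (ContDiffAt.comp (g := fieldInChart (generator θ) z.1)
        (extChartAt 𝓘(ℝ, E) z.1 z.1, chartL E z.1 z.1 (vec z))
        (hθ.smoothField_generator.contDiffAt_fieldInChart z.1) contDiffAt_fst))
  have h2 : ContMDiffAt 𝓘(ℝ, E).tangent 𝓘(ℝ, E × E) ∞ (extChartAt 𝓘(ℝ, E).tangent z) z :=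
    contMDiffAt_extChartAt (I := 𝓘(ℝ, E).tangent)
  refine (h1.contMDiffAt.comp_of_eq h2 (extChartAt_tangent_apply z z hz)).congr_of_eventuallyEq ?_
  filter_upwards [hL, extChartAt_source_mem_nhds (I := 𝓘(ℝ, E).tangent) z] with w hw hw'
  rw [extChartAt_tangent_source] at hw'
  have e := extChartAt_tangent_apply z w hw'
  rw [noetherQuantity_eq_inChart hw', Function.comp_apply, e, paramLegendre,
    fderiv_fibre_eq (contDiffAt_lagFamily_extChartAt hw' hw)]
  rfl

theorem lagFamily_famInChart (h : ∀ s z, L (tangentLift (θ s) z) = L z) {p : M} {s : ℝ}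
    (hθ : IsSmoothFamily θ) (hs : θ s p ∈ (extChartAt 𝓘(ℝ, E) p).source) (v : E) :
    lagFamily L p (famInChart θ p (s, extChartAt 𝓘(ℝ, E) p p),
      fderiv ℝ (famInChart θ p) (s, extChartAt 𝓘(ℝ, E) p p) (0, v)) =
        lagFamily L p (extChartAt 𝓘(ℝ, E) p p, v) := by
  rw [hθ.fderiv_famInChart_inr (mem_extChartAt_target p) (by rwa [extChartAt_to_inv]),
    famInChart]
  simp only [extChartAt_to_inv, chartSymmL_self]
  have h1 := lagFamily_extChartAt L (z := tangentLift (θ s) ⟨p, v⟩) hs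
  rw [tangentLift_eq] at h1
  have h2 := lagFamily_extChartAt L (z := ⟨p, v⟩) (mem_extChartAt_source (I := 𝓘(ℝ, E)) p)
  rw [chartL_self] at h2
  exact h1.trans (((congr_arg L (tangentLift_eq (θ s) p v)).symm.trans (h s ⟨p, v⟩)).trans h2.symm)

/-- The infinitesimal form of the invariance of a Lagrangian. -/
theorem fderiv_lagFamily_generator (h : ∀ s z, L (tangentLift (θ s) z) = L z) {p : M} {v : E}
    (hθ : IsSmoothFamily θ)
    (hL : DifferentiableAt ℝ (lagFamily L p) (extChartAt 𝓘(ℝ, E) p p, v)) :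
    fderiv ℝ (lagFamily L p) (extChartAt 𝓘(ℝ, E) p p, v)
      (fieldInChart (generator θ) p (extChartAt 𝓘(ℝ, E) p p),
        fderiv ℝ (fieldInChart (generator θ) p) (extChartAt 𝓘(ℝ, E) p p) v) = 0 := by
  have hx := mem_extChartAt_target (I := 𝓘(ℝ, E)) p
  have h0 : θ 0 ((extChartAt 𝓘(ℝ, E) p).symm (extChartAt 𝓘(ℝ, E) p p)) ∈
      (extChartAt 𝓘(ℝ, E) p).source := by
    rw [hθ.zero, extChartAt_to_inv]; exact mem_extChartAt_source p
  have h1 : HasDerivAt (fun s : ℝ => famInChart θ p (s, extChartAt 𝓘(ℝ, E) p p))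
      (fieldInChart (generator θ) p (extChartAt 𝓘(ℝ, E) p p)) 0 := by
    rw [hθ.fieldInChart_generator hx]
    exact HasFDerivAt.comp_hasDerivAt (l := famInChart θ p)
      (f := fun s : ℝ => (s, extChartAt 𝓘(ℝ, E) p p)) (0 : ℝ)
      ((hθ.contDiffAt_famInChart hx h0).differentiableAt (by simp)).hasFDerivAt
      ((hasDerivAt_id (0 : ℝ)).prodMk (hasDerivAt_const _ _))
  have h2 := h1.prodMk (hθ.hasDerivAt_fderiv_famInChart p v)
  have h3 : ((famInChart θ p (0, extChartAt 𝓘(ℝ, E) p p),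
      fderiv ℝ (famInChart θ p) (0, extChartAt 𝓘(ℝ, E) p p) (0, v)) : E × E) =
      (extChartAt 𝓘(ℝ, E) p p, v) := by
    rw [hθ.fderiv_famInChart_inr hx h0, famInChart]
    simp only [extChartAt_to_inv, chartSymmL_self]
    rw [hθ.zero, diffeoEquiv_eq_refl hθ.zero, chartL_self]
    rfl
  -- Differentiate `s ↦ L(θ_s x, dθ_s v)` in the chart at `s = 0`; by invariance it is constant for
  -- small `s`.
  have h4 := HasFDerivAt.comp_hasDerivAt (l := lagFamily L p)
    (f := fun s : ℝ => (famInChart θ p (s, extChartAt 𝓘(ℝ, E) p p),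
      fderiv ℝ (famInChart θ p) (s, extChartAt 𝓘(ℝ, E) p p) (0, v))) (0 : ℝ)
    (h3.symm ▸ hL.hasFDerivAt) h2
  have hs : ∀ᶠ s : ℝ in 𝓝 0, θ s p ∈ (extChartAt 𝓘(ℝ, E) p).source := by
    refine (hθ.contMDiff_apply p).continuous.continuousAt.preimage_mem_nhds ?_
    rw [hθ.zero]
    exact extChartAt_source_mem_nhds (I := 𝓘(ℝ, E)) p
  have h5 := h4.unique ((hasDerivAt_const (0 : ℝ)
    (lagFamily L p (extChartAt 𝓘(ℝ, E) p p, v))).congr_of_eventuallyEq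
      (hs.mono fun s hs => lagFamily_famInChart h hθ hs v))
  rwa [h3] at h5

theorem lagInChart_eq_lagFamily (L : TangentBundle 𝓘(ℝ, E) M → ℝ) {p : M} {x : E}
    (hx : x ∈ (extChartAt 𝓘(ℝ, E) p).target) :
    lagInChart L p x = fun v => lagFamily L p (x, v) := by
  funext v
  exact congr_arg (fun w : E => fibreT L ((extChartAt 𝓘(ℝ, E) p).symm x) w)
    (DFunLike.congr_fun (chartSymmL_extChartAt_symm hx) v).symm

theorem chartL_velocity {γ : ℝ → M} {t : ℝ} {p : M}
    (hγ : MDifferentiableAt 𝓘(ℝ, ℝ) 𝓘(ℝ, E) γ t) (hp : γ t ∈ (extChartAt 𝓘(ℝ, E) p).source) :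
    chartL E p (γ t) (vec (velocity γ t)) = deriv (curveInChart (E := E) γ p) t := by
  rw [chartL_eq_mfderiv hp]
  exact (hasDerivAt_extChartAt_comp hγ hp).deriv.symm

/-- Noether's theorem: the quantity attached to a symmetry is constant along the motions. -/
theorem IsLagrangianSymmetry.isLagrangianConserved (hθ : IsLagrangianSymmetry L θ)
    {D : Set (TangentBundle 𝓘(ℝ, E) M)} (hD : IsOpen D)
    (hL : ContMDiffOn 𝓘(ℝ, E).tangent 𝓘(ℝ, ℝ) ∞ L D) :
    IsLagrangianConserved D L (noetherQuantity L θ) where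
  smooth z hz := by
    refine (contMDiffAt_noetherQuantity hθ.toIsSmoothFamily ?_).contMDiffWithinAt
    filter_upwards [hD.mem_nhds hz] with w hw
    exact hL.contMDiffAt (hD.mem_nhds hw)
  conserved J γ hJ hγ hγD t₀ ht₀ := by
    have hs := hθ.toIsSmoothFamily
    have hγ' : ∀ t ∈ J, ContMDiffAt 𝓘(ℝ, ℝ) 𝓘(ℝ, E) ∞ γ t := fun t ht =>
      hγ.1.contMDiffAt (hJ.mem_nhds ht)
    have hL' : ∀ t ∈ J, ContMDiffAt 𝓘(ℝ, E).tangent 𝓘(ℝ, ℝ) ∞ L (velocity γ t) := fun t ht =>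
      hL.contMDiffAt (hD.mem_nhds (hγD t ht))
    have hp := mem_extChartAt_source (I := 𝓘(ℝ, E)) (γ t₀)
    have hx := mem_extChartAt_target (I := 𝓘(ℝ, E)) (γ t₀)
    set p := γ t₀ with hpdef
    set c : ℝ → E := curveInChart γ p with hc
    have hct₀ : c t₀ = extChartAt 𝓘(ℝ, E) p p := rfl
    have hev : ∀ᶠ t in 𝓝 t₀, t ∈ J ∧ γ t ∈ (extChartAt 𝓘(ℝ, E) p).source :=
      (hJ.eventually_mem ht₀).and
        ((hγ' t₀ ht₀).continuousAt.preimage_mem_nhds (extChartAt_source_mem_nhds (I := 𝓘(ℝ, E)) p))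
    have hdiff : ∀ t ∈ J, γ t ∈ (extChartAt 𝓘(ℝ, E) p).source →
        ContDiffAt ℝ ∞ (lagFamily L p) (c t, deriv c t) := by
      intro t ht htp
      have := contDiffAt_lagFamily_extChartAt (z := velocity γ t) htp (hL' t ht)
      rwa [show (velocity γ t : TangentBundle 𝓘(ℝ, E) M).1 = γ t from rfl,
        chartL_velocity ((hγ' t ht).mdifferentiableAt (by simp)) htp] at this
    have hc' : HasDerivAt c (deriv c t₀) t₀ :=
      (hasDerivAt_extChartAt_comp ((hγ' t₀ ht₀).mdifferentiableAt (by simp))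
        hp).differentiableAt.hasDerivAt
    have h1 := hγ.2 t₀ ht₀
    have h2 : HasFDerivAt (fieldInChart (generator θ) p)
        (fderiv ℝ (fieldInChart (generator θ) p) (c t₀)) (c t₀) :=
      ((hs.smoothField_generator.contDiffAt_fieldInChart p).differentiableAt (by simp)).hasFDerivAt
    -- Product rule for `∂L/∂v · w(c)`, with `d/dt ∂L/∂v` replaced by `∂L/∂x` through
    -- Euler–Lagrange.
    have h3 := h1.clm_apply (h2.comp_hasDerivAt t₀ hc')
    have h4 : (fun t => noetherQuantity L θ (velocity γ t)) =ᶠ[𝓝 t₀] fun t =>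
        fderiv ℝ (fun v : E => lagInChart L p (c t) v) (deriv c t)
          ((fieldInChart (generator θ) p ∘ c) t) := by
      filter_upwards [hev] with t ht
      rw [noetherQuantity_eq_inChart (z := velocity γ t) ht.2, paramLegendre,
        show (velocity γ t : TangentBundle 𝓘(ℝ, E) M).1 = γ t from rfl,
        chartL_velocity ((hγ' t ht.1).mdifferentiableAt (by simp)) ht.2,
        lagInChart_eq_lagFamily L (x := c t) ((extChartAt 𝓘(ℝ, E) p).map_source ht.2)]
      rfl
    refine (h3.congr_of_eventuallyEq h4).congr_deriv ?_
    have h5 := (hdiff t₀ ht₀ hp).differentiableAt (by simp)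
    have h6 : fderiv ℝ (fun x : E => lagInChart L p x (deriv c t₀)) (c t₀) =
        (fderiv ℝ (lagFamily L p) (c t₀, deriv c t₀)).comp (ContinuousLinearMap.inl ℝ E E) := by
      have e : (fun x : E => lagInChart L p x (deriv c t₀)) =ᶠ[𝓝 (c t₀)]
          fun x => lagFamily L p (x, deriv c t₀) := by
        filter_upwards [extChartAt_target_mem_nhds (I := 𝓘(ℝ, E)) p] with x hx
        rw [lagInChart_eq_lagFamily L hx]
      rw [e.fderiv_eq]
      exact (HasFDerivAt.comp (g := lagFamily L p) (c t₀) h5.hasFDerivAt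
        (hasFDerivAt_prodMk_left (c t₀) (deriv c t₀))).fderiv
    have h7 : fderiv ℝ (fun v : E => lagInChart L p (c t₀) v) (deriv c t₀) =
        (fderiv ℝ (lagFamily L p) (c t₀, deriv c t₀)).comp (ContinuousLinearMap.inr ℝ E E) := by
      rw [lagInChart_eq_lagFamily L (x := c t₀) hx]
      exact fderiv_fibre_eq (y := (c t₀, deriv c t₀)) (hdiff t₀ ht₀ hp)
    -- The total `∂L/∂x · w + ∂L/∂v · Dw(c')` is the infinitesimal variation of `L`, which vanishes.
    have h8 := fderiv_lagFamily_generator hθ.invariant hs (p := p) (v := deriv c t₀) h5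
    have h9 := map_add (fderiv ℝ (lagFamily L p) (c t₀, deriv c t₀))
      (fieldInChart (generator θ) p (c t₀), (0 : E))
      ((0 : E), fderiv ℝ (fieldInChart (generator θ) p) (c t₀) (deriv c t₀))
    rw [Prod.mk_add_mk, add_zero, zero_add] at h9
    rw [h6, h7]
    exact h9.symm.trans h8

end Noether

/-! ### The base flow as a Lagrangian symmetry, and the theorem. -/

section BaseFlowSymmetry

variable {E : Type*} [NormedAddCommGroup E] [NormedSpace ℝ E] [FiniteDimensional ℝ E]
  {M : Type*} [TopologicalSpace M] [T2Space M] [ChartedSpace E M] [IsManifold 𝓘(ℝ, E) ∞ M]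
  {W : VecField (cotModel E) (CotangentBundle E M)}
  {ψ : ℝ → CotangentBundle E M → CotangentBundle E M} {H : CotangentBundle E M → ℝ}

theorem IsFlow.hamiltonian_cotangentLift_baseDiffeo (hα : PreservesTaut W)
    (hW : IsHamiltonianSymmetry univ H W) (hψ : IsFlow (cotModel E) W ψ)
    (hH : ContMDiff (cotModel E) 𝓘(ℝ, ℝ) ∞ H) (s : ℝ) (ξ : CotangentBundle E M) :
    H (cotangentLift (hψ.baseDiffeo hα hW.smooth s) ξ) = H ξ := by
  rw [← hψ.eq_cotangentLift_baseDiffeo hα hW.smooth]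
  exact hψ.comp_eq_of_lieFun_eq_zero (hH.mdifferentiable (by simp))
    (fun ξ => hW.lie_ham ξ (mem_univ ξ)) s ξ

theorem IsFlow.isLagrangianSymmetry_baseDiffeo (hα : PreservesTaut W)
    (hW : IsHamiltonianSymmetry univ H W) (hψ : IsFlow (cotModel E) W ψ)
    (hH : ContMDiff (cotModel E) 𝓘(ℝ, ℝ) ∞ H) :
    IsLagrangianSymmetry (dualC H) (hψ.baseDiffeo hα hW.smooth) where
  toIsSmoothFamily := hψ.isSmoothFamily_baseDiffeo hα hW.smooth
  invariant s := dualC_tangentLift (hψ.hamiltonian_cotangentLift_baseDiffeo hα hW hH s)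

theorem IsFlow.noetherQuantity_baseDiffeo (hα : PreservesTaut W)
    (hW : SmoothField (cotModel E) W) (hψ : IsFlow (cotModel E) W ψ)
    (L : TangentBundle 𝓘(ℝ, E) M → ℝ) :
    noetherQuantity L (hψ.baseDiffeo hα hW) = alphaOf W ∘ legendreT L := by
  rw [hα.alphaOf_eq_momentum hW, ← hψ.generator_baseDiffeo hα hW]
  rfl

end BaseFlowSymmetry
end

theorem theorem6p15 {E : Type*} [NormedAddCommGroup E] [NormedSpace ℝ E] [FiniteDimensional ℝ E]
    {M : Type*} [TopologicalSpace M] [T2Space M] [ChartedSpace E M] [IsManifold 𝓘(ℝ, E) ∞ M] :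
    -- from Lagrangian to Hamiltonian symmetries
    (∀ L : TangentBundle 𝓘(ℝ, E) M → ℝ,
      ContMDiff 𝓘(ℝ, E).tangent 𝓘(ℝ, ℝ) ∞ L →
      (∀ p, StronglyConvex (fibreT L p)) →
      ∀ θ : ℝ → M ≃ₘ^∞⟮𝓘(ℝ, E), 𝓘(ℝ, E)⟯ M,
      IsLagrangianSymmetry L θ →
        -- `H = L*` is a smooth function on the open set `Φ_L(TM)`, and `Φ_H = Φ_L⁻¹` there
        (IsOpen (range (legendreT L)) ∧
          (∀ ξ ∈ range (legendreT L), IsLUB (dualValuesT L ξ) (dualT L ξ)) ∧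
          ContMDiffOn (cotModel E) 𝓘(ℝ, ℝ) ∞ (dualT L) (range (legendreT L)) ∧
          ∀ z, legendreC (dualT L) (legendreT L z) = z) ∧
        -- the generator `W` is smooth; `W_♯` is its cotangent lift: if `W` has a flow, then the
        -- lift of this flow is the flow of `W_♯`
        SmoothField 𝓘(ℝ, E) (generator θ) ∧
        (∀ φ : ℝ → M ≃ₘ^∞⟮𝓘(ℝ, E), 𝓘(ℝ, E)⟯ M, IsSmoothFamily φ → IsOneParameterGroup φ →
          generator φ = generator θ →
          IsFlow (cotModel E) (liftedGenerator θ) (fun s => cotangentLift (φ s))) ∧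
        -- `W_♯` is an `α`-preserving symmetry, with conserved quantity `F ∘ Φ_H`
        IsHamiltonianSymmetry (range (legendreT L)) (dualT L) (liftedGenerator θ) ∧
        PreservesTaut (liftedGenerator θ) ∧
        IsHamiltonianConservedQuantity (range (legendreT L)) (dualT L) (liftedGenerator θ)
          (noetherQuantity L θ ∘ legendreC (dualT L))) ∧
    -- from Hamiltonian to Lagrangian symmetries
    (∀ H : CotangentBundle E M → ℝ,
      ContMDiff (cotModel E) 𝓘(ℝ, ℝ) ∞ H →
      (∀ p, StronglyConvex (fibreC H p)) →
      ∀ (W : VecField (cotModel E) (CotangentBundle E M))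
        (ψ : ℝ → CotangentBundle E M → CotangentBundle E M),
      IsHamiltonianSymmetry univ H W → PreservesTaut W → IsFlow (cotModel E) W ψ →
        -- `L = H*` is a smooth function on the open set `Φ_H(T*M)`, and `Φ_L = Φ_H⁻¹` there
        (IsOpen (range (legendreC H)) ∧
          (∀ z ∈ range (legendreC H), IsLUB (dualValuesC H z) (dualC H z)) ∧
          ContMDiffOn 𝓘(ℝ, E).tangent 𝓘(ℝ, ℝ) ∞ (dualC H) (range (legendreC H)) ∧
          ∀ ξ, legendreT (dualC H) (legendreC H ξ) = ξ) ∧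
        -- the conserved quantity `G = α(W)` of `W`
        IsHamiltonianConservedQuantity univ H W (alphaOf W) ∧
        -- the flow of `W` is the cotangent lift of a Lagrangian symmetry, with conserved
        -- quantity `G ∘ Φ_L`
        ∃ θ : ℝ → M ≃ₘ^∞⟮𝓘(ℝ, E), 𝓘(ℝ, E)⟯ M,
          (∀ s, ψ s = cotangentLift (θ s)) ∧
          IsOneParameterGroup θ ∧
          IsLagrangianSymmetry (dualC H) θ ∧
          (∀ s, MapsTo (tangentLift (θ s)) (range (legendreC H)) (range (legendreC H))) ∧
          noetherQuantity (dualC H) θ = alphaOf W ∘ legendreT (dualC H) ∧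
          IsLagrangianConserved (range (legendreC H)) (dualC H)
            (alphaOf W ∘ legendreT (dualC H))) := by

  refine ⟨fun L hL hc θ hθ => ?_, fun H hH hc W ψ hW hα hψ => ?_⟩
  · have hs := hθ.toIsSmoothFamily
    refine ⟨⟨isOpen_range_legendreT hL hc, ?_, ?_, legendreC_legendreT hL hc⟩,
      hs.smoothField_generator, fun φ hφ hg hφθ => ?_, hθ.isHamiltonianSymmetry hL hc,
      hs.preservesTaut_liftedGenerator, hθ.isHamiltonianConservedQuantity hL hc⟩
    · rintro _ ⟨z, rfl⟩
      have h := isGreatest_dualT hL hc z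
      rw [dualT, h.csSup_eq]
      exact h.isLUB
    · rintro _ ⟨z, rfl⟩
      exact (contMDiffAt_dualT hL hc z).contMDiffWithinAt
    -- The field `W_♯` depends on the family only through its generator, so `θ` may be replaced by
    -- the group `φ`.
    · rw [hs.liftedGenerator_eq, ← hφθ, ← hφ.liftedGenerator_eq]
      exact hg.isFlow_cotangentLift hφ
  · have hD := isOpen_range_legendreC hH hc
    have hL : ContMDiffOn 𝓘(ℝ, E).tangent 𝓘(ℝ, ℝ) ∞ (dualC H) (range (legendreC H)) := by
      rintro _ ⟨ξ, rfl⟩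
      exact (contMDiffAt_dualC hH hc ξ).contMDiffWithinAt
    have hθ := hψ.isLagrangianSymmetry_baseDiffeo hα hW hH
    have hF := hψ.noetherQuantity_baseDiffeo hα hW.smooth (dualC H)
    refine ⟨⟨hD, ?_, hL, legendreT_legendreC hH hc⟩,
      isHamiltonianConservedQuantity_alphaOf hW hα, hψ.baseDiffeo hα hW.smooth,
      hψ.eq_cotangentLift_baseDiffeo hα hW.smooth,
      hψ.isOneParameterGroup_baseDiffeo hα hW.smooth, hθ, ?_, hF, ?_⟩
    · rintro _ ⟨ξ, rfl⟩
      have h := isGreatest_dualC hH hc ξ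
      rw [dualC, h.csSup_eq]
      exact h.isLUB
    · rintro s _ ⟨ξ, rfl⟩
      exact ⟨_, (tangentLift_legendreC
        (hψ.hamiltonian_cotangentLift_baseDiffeo hα hW hH s) ξ).symm⟩
    · rw [← hF]
      exact hθ.isLagrangianConserved hD hL
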